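/- **Setting.** Let $n,m\ge 1$, let $b_1,b_1'\in L^\infty(\mathbb R^n)$ and $b_2,b_2'\in L^\infty(\mathbb R^m)$ be complex valued, and let $b=b_1\otimes b_2$ and $b'=b_1'\otimes b_2'$ be pseudo-accretive: there is a constant $C>0$ such that $\frac1{|R|}\left|\int_R b\right|>C$ for every rectangle $R=K\times V$ with $K\subset\mathbb R^n$, $V\subset\mathbb R^m$ cubes (sides parallel to the axes), and similarly for $b'$. Let $T$ be a bounded linear operator on $L^2(\mathbb R^n\times\mathbb R^m)$, let $M_b$ denote multiplication by $b$, and let $\langle u,v\rangle=\int uv$ (bilinear pairing). Let $f,g\in C_0^\infty(\mathbb R^n\times\mathbb R^m)$ be complex valued. **Random grids.** Let $\mathcal D_0^n$ be the family of the half-open standard dyadic cubes of $\mathbb R^n$, of side lengths $\ell(I)=2^{-p}$, $p\in\mathbb Z$. For $\omega^n=(\omega^n_i)_{i\in\mathbb Z}\in(\{0,1\}^n)^{\mathbb Z}$ put $I\dotplus\omega^n=I+\sum_{i:\,2^{-i}<\ell(I)}2^{-i}\omega^n_i$ and $\mathcal D^n=\mathcal D^n_{\omega^n}=\{I\dotplus\omega^n: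 I\in\mathcal D_0^n\}$; let $\mathcal D^n_p$ consist of its cubes of side length $2^{-p}$. The $\omega_i^n$ are independent and uniformly distributed in $\{0,1\}^n$. The grids $\mathcal D^m$ are defined in the same way from $\omega^m$, which is independent of $\omega^n$. Let $\mathbb E_{\omega^n},\mathbb E_{\omega^m}$ be the expectations. **Martingale differences.** For $I\in\mathcal D_p^n$, in the first variable, $\Delta_I^{b_1}f=\chi_I\,(E_{p+1}^{b_1}f-E_p^{b_1}f)$, where $E_p^{b_1}f=\sum_{K\in\mathcal D^n_p}\frac{\int_K f b_1}{\int_K b_1}\chi_K$; similarly for $\Delta_J^{b_2}$, $J\in\mathcal D^m$, in the second variable, and for $b_1',b_2'$. **Good cubes.** Fix $\delta>0$ and put $\gamma_n=\delta/(2n+2\delta)$. For $r\in\mathbb N$, a cube $I\in\mathcal D^n$ is *bad* if there is $\tilde I\in\mathcal D^n$ with $\ell(\tilde I)\ge 2^r\ell(I)$ and $d(I,\partial\tilde I)\le 2\,\ell(I)^{\gamma_n}\ell(\tilde I)^{1-\gamma_n}$, and *good* otherwise; similarly in $\mathbb R^m$. Let $\chi_{\rm good}(I)$ be $1$ if $I$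 is good and $0$ otherwise, and let $\mathrm{small}(I_1,I_2)$ be $I_1$ if $\ell(I_1)\le\ell(I_2)$ and $I_2$ otherwise. **Proposition 4.1.** For every $r$, the probability $\pi^n_{\rm good}=\mathbb P_{\omega^n}(I\dotplus\omega^n\text{ is good})$ does not depend on $I\in\mathcal D_0^n$, and similarly for $\pi^m_{\rm good}$; both are positive for all sufficiently large $r$. All the functions $b\,\Delta_{I_1}^{b_1}\Delta_{J_1}^{b_2}f$ and $\Delta_{I_2}^{b_1'}\Delta_{J_2}^{b_2'}g$ are in $L^2$. For every $r$ with $\pi^n_{\rm good}>0$ and $\pi^m_{\rm good}>0$, $$\langle M_{b'}TM_bf,g\rangle=\frac1{\pi^n_{\rm good}\,\pi^m_{\rm good}}\,\mathbb E_{\omega^n}\mathbb E_{\omega^m}\sum_{\substack{I_1,I_2\in\mathcal D^n\\ J_1,J_2\in\mathcal D^m}}\chi_{\rm good}(\mathrm{small}(I_1,I_2))\,\chi_{\rm good}(\mathrm{small}(J_1,J_2))\,\langle M_{b'}TM_b\Delta_{I_1}^{b_1}\Delta_{J_1}^{b_2}f,\ \Delta_{I_2}^{b_1'}\Delta_{J_2}^{b_2'}g\rangle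 .$$ The sum is taken first over the cubes of four fixed side lengths $2^{-p_1},2^{-p_2},2^{-q_1},2^{-q_2}$ of $I_1,I_2,J_1,J_2$, and then over $(p_1,p_2,q_1,q_2)\in\mathbb Z^4$. For all $\omega^n,\omega^m$ the inner sums have only finitely many nonzero terms and the outer sum converges absolutely; as a function of $(\omega^n,\omega^m)$ the sum is integrable. -/

import Mathlib

open MeasureTheory
open scoped ENNReal

noncomputable section

namespace BiParam

/-- `ℝⁿ` with its Euclidean norm and Lebesgue measure. -/
abbrev E (n : ℕ) : Type := EuclideanSpace ℝ (Fin n)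

/-! ### Cubes, random dyadic grids, good cubes -/

/-- The half-open cube with lower left corner `a` and side length `s`. -/
def cube {n : ℕ} (a : E n) (s : ℝ) : Set (E n) :=
  {x | ∀ j, a j ≤ x j ∧ x j < a j + s}

/-- The parameters `ω = (ω_i)_{i ∈ ℤ}`, `ω_i ∈ {0,1}ⁿ`, of a dyadic grid. -/
abbrev GridParam (n : ℕ) : Type := ℤ → Fin n → Fin 2

/-- The natural probability measure on `({0,1}ⁿ)^ℤ`: the `ω_i` are independent and
uniformly distributed in `{0,1}ⁿ`. -/
def gridMeasure (n : ℕ) : Measure (GridParam n) :=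
  Measure.infinitePi fun _ : ℤ => (PMF.uniformOfFintype (Fin n → Fin 2)).toMeasure

/-- Labels of dyadic cubes: `I = (p, k)` is the label of the standard dyadic cube
`2^{-p} ([0,1)ⁿ + k)`, and, for each `ω`, of the corresponding cube of the shifted grid. -/
abbrev CubeLabel (n : ℕ) : Type := ℤ × (Fin n → ℤ)

/-- The side length `ℓ(I) = 2^{-p}`. -/
def side {n : ℕ} (I : CubeLabel n) : ℝ := (2 : ℝ) ^ (-I.1)

/-- The standard dyadic cube `2^{-p} ([0,1)ⁿ + k)`. -/
def stdCube {n : ℕ} (I : CubeLabel n) : Set (E n) :=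
  cube (WithLp.toLp 2 fun j => side I * (I.2 j : ℝ)) (side I)

/-- The vector `∑_{i : 2^{-i} < 2^{-p}} 2^{-i} ω_i`. -/
def gridShift {n : ℕ} (ω : GridParam n) (p : ℤ) : E n :=
  WithLp.toLp 2 fun j => ∑' i : {i : ℤ // p < i}, (2 : ℝ) ^ (-(i : ℤ)) * ((ω i j).val : ℝ)

/-- The shifted cube `I ∔ ω = I + ∑_{i : 2^{-i} < ℓ(I)} 2^{-i} ω_i`. The grid `𝒟_ω` is the
family of all the sets `gridCube ω I`. -/
def gridCube {n : ℕ} (ω : GridParam n) (I : CubeLabel n) : Set (E n) :=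
  {x | x - gridShift ω I.1 ∈ stdCube I}

/-- The distance of two nonempty sets. -/
def setDist {n : ℕ} (A B : Set (E n)) : ℝ :=
  sInf {t | ∃ x ∈ A, ∃ y ∈ B, t = dist x y}

/-- `γ_n = δ / (2n + 2δ)`. -/
def gammaExp (n : ℕ) (δ : ℝ) : ℝ := δ / (2 * (n : ℝ) + 2 * δ)

/-- `I ∔ ω` is bad: some cube `L ∔ ω` of the same grid has `ℓ(L) ≥ 2^r ℓ(I)` and
`d(I ∔ ω, ∂(L ∔ ω)) ≤ 2 ℓ(I)^γ ℓ(L)^{1-γ}`. -/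
def IsBad {n : ℕ} (δ : ℝ) (r : ℕ) (ω : GridParam n) (I : CubeLabel n) : Prop :=
  ∃ L : CubeLabel n, (2 : ℝ) ^ r * side I ≤ side L ∧
    setDist (gridCube ω I) (frontier (gridCube ω L)) ≤
      2 * side I ^ gammaExp n δ * side L ^ (1 - gammaExp n δ)

/-- `I ∔ ω` is good, i.e. not bad. -/
def IsGood {n : ℕ} (δ : ℝ) (r : ℕ) (ω : GridParam n) (I : CubeLabel n) : Prop :=
  ¬ IsBad δ r ω I

/-- The probability that `I ∔ ω` is good. -/
def goodProb {n : ℕ} (δ : ℝ) (r : ℕ) (I : CubeLabel n) : ℝ :=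
  (gridMeasure n).real {ω | IsGood δ r ω I}

/-- `π_good`: the probability that `I ∔ ω` is good, for the unit cube `I = [0,1)ⁿ`. -/
def piGood (n : ℕ) (δ : ℝ) (r : ℕ) : ℝ := goodProb δ r ((0, 0) : CubeLabel n)

open Classical in
/-- `χ_good(I ∔ ω)`. -/
def chiGood {n : ℕ} (δ : ℝ) (r : ℕ) (ω : GridParam n) (I : CubeLabel n) : ℂ :=
  if IsGood δ r ω I then 1 else 0

/-- The smaller of two cubes; the first one if the side lengths are equal. -/
def small {n : ℕ} (I₁ I₂ : CubeLabel n) : CubeLabel n :=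
  if I₂.1 ≤ I₁.1 then I₁ else I₂

/-! ### Pseudo-accretive functions and adapted martingale differences -/

/-- The tensor product `b₁ ⊗ b₂`. -/
def tensor {n m : ℕ} (b₁ : E n → ℂ) (b₂ : E m → ℂ) : E n × E m → ℂ :=
  fun x => b₁ x.1 * b₂ x.2

/-- Pseudo-accretive functions on `ℝⁿ × ℝᵐ`: bounded, with averages over rectangles
`R = K × V` (`K`, `V` cubes) bounded away from `0`. -/
def IsPseudoAccretive {n m : ℕ} (b : E n × E m → ℂ) : Prop :=
  MemLp b ∞ volume ∧ ∃ C : ℝ, 0 < C ∧ ∀ (a : E n) (s : ℝ) (a' : E m) (s' : ℝ),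
    0 < s → 0 < s' →
      C < ‖∫ x in cube a s ×ˢ cube a' s', b x‖ / (volume (cube a s ×ˢ cube a' s')).toReal

/-- The adapted expectation `E_p^b h = ∑_{I ∈ 𝒟_p} (∫_I h b / ∫_I b) χ_I` of a function of one
variable. At each point exactly one term of the sum can be nonzero. -/
def expect {n : ℕ} (b : E n → ℂ) (ω : GridParam n) (p : ℤ) (h : E n → ℂ) : E n → ℂ :=
  fun x => ∑' k : Fin n → ℤ, (gridCube ω (p, k)).indicator
    (fun _ => (∫ y in gridCube ω (p, k), h y * b y) / ∫ y in gridCube ω (p, k), b y) x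

/-- `Δ_I^b h = χ_I (E_{p+1}^b h - E_p^b h)` for `I ∈ 𝒟_p`, for a function of one variable. -/
def delta {n : ℕ} (b : E n → ℂ) (ω : GridParam n) (I : CubeLabel n) (h : E n → ℂ) : E n → ℂ :=
  (gridCube ω I).indicator fun x => expect b ω (I.1 + 1) h x - expect b ω I.1 h x

/-- `Δ_I^{b₁}` acting in the first variable. -/
def delta₁ {n m : ℕ} (b₁ : E n → ℂ) (ω : GridParam n) (I : CubeLabel n)
    (f : E n × E m → ℂ) : E n × E m → ℂ :=
  fun x => delta b₁ ω I (fun y => f (y, x.2)) x.1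

/-- `Δ_J^{b₂}` acting in the second variable. -/
def delta₂ {n m : ℕ} (b₂ : E m → ℂ) (ω : GridParam m) (J : CubeLabel m)
    (f : E n × E m → ℂ) : E n × E m → ℂ :=
  fun x => delta b₂ ω J (fun y => f (x.1, y)) x.2

/-- `Δ_I^{b₁} Δ_J^{b₂} f`. -/
def doubleDelta {n m : ℕ} (b₁ : E n → ℂ) (b₂ : E m → ℂ) (ω : GridParam n) (ω' : GridParam m)
    (I : CubeLabel n) (J : CubeLabel m) (f : E n × E m → ℂ) : E n × E m → ℂ :=
  delta₁ b₁ ω I (delta₂ b₂ ω' J f)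

/-! ### The bilinear form and the sum over cubes -/

/-- `L²(ℝⁿ × ℝᵐ)`, complex valued. -/
abbrev L2 (n m : ℕ) : Type := Lp ℂ 2 (volume : Measure (E n × E m))

open Classical in
/-- The class in `L²` of a square integrable function (`0` for other functions). -/
def toL2 {n m : ℕ} (f : E n × E m → ℂ) : L2 n m :=
  if h : MemLp f 2 volume then h.toLp f else 0

/-- The bilinear form `⟨M_{b'} T M_b f, g⟩ = ∫ b' T(b f) g` (no complex conjugate). -/
def form {n m : ℕ} (T : L2 n m →L[ℂ] L2 n m) (b b' f g : E n × E m → ℂ) : ℂ :=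
  ∫ x, b' x * (T (toL2 fun y => b y * f y) : E n × E m → ℂ) x * g x

/-- Four scales `(p₁, p₂, q₁, q₂)`, for `I₁`, `I₂`, `J₁`, `J₂`. -/
abbrev Scales : Type := ℤ × ℤ × ℤ × ℤ

/-- Four positions, for `I₁`, `I₂`, `J₁`, `J₂`. -/
abbrev Positions (n m : ℕ) : Type :=
  (Fin n → ℤ) × (Fin n → ℤ) × (Fin m → ℤ) × (Fin m → ℤ)

/-- The summand
`χ_good(small(I₁,I₂)) χ_good(small(J₁,J₂)) ⟨M_{b'} T M_b Δ_{I₁} Δ_{J₁} f, Δ_{I₂} Δ_{J₂} g⟩`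
for `I₁ = (p₁,k₁)`, `I₂ = (p₂,k₂)`, `J₁ = (q₁,l₁)`, `J₂ = (q₂,l₂)`, where
`P = (p₁,p₂,q₁,q₂)` and `Q = (k₁,k₂,l₁,l₂)`, `b = b₁ ⊗ b₂`, `b' = b₁' ⊗ b₂'`. -/
def summand {n m : ℕ} (δ : ℝ) (r : ℕ) (T : L2 n m →L[ℂ] L2 n m)
    (b₁ b₁' : E n → ℂ) (b₂ b₂' : E m → ℂ) (f g : E n × E m → ℂ)
    (ω : GridParam n) (ω' : GridParam m) (P : Scales) (Q : Positions n m) : ℂ :=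
  let I₁ : CubeLabel n := (P.1, Q.1)
  let I₂ : CubeLabel n := (P.2.1, Q.2.1)
  let J₁ : CubeLabel m := (P.2.2.1, Q.2.2.1)
  let J₂ : CubeLabel m := (P.2.2.2, Q.2.2.2)
  chiGood δ r ω (small I₁ I₂) * chiGood δ r ω' (small J₁ J₂) *
    form T (tensor b₁ b₂) (tensor b₁' b₂')
      (doubleDelta b₁ b₂ ω ω' I₁ J₁ f) (doubleDelta b₁' b₂' ω ω' I₂ J₂ g)

/-- The sum of the summands over all cubes of the given four scales. -/
def scaleSum {n m : ℕ} (δ : ℝ) (r : ℕ) (T : L2 n m →L[ℂ] L2 n m)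
    (b₁ b₁' : E n → ℂ) (b₂ b₂' : E m → ℂ) (f g : E n × E m → ℂ)
    (ω : GridParam n) (ω' : GridParam m) (P : Scales) : ℂ :=
  ∑' Q : Positions n m, summand δ r T b₁ b₁' b₂ b₂' f g ω ω' P Q

/-- The sum over all `I₁, I₂ ∈ 𝒟ⁿ`, `J₁, J₂ ∈ 𝒟ᵐ`: first over the cubes of four given scales,
then over the scales. -/
def goodSum {n m : ℕ} (δ : ℝ) (r : ℕ) (T : L2 n m →L[ℂ] L2 n m)
    (b₁ b₁' : E n → ℂ) (b₂ b₂' : E m → ℂ) (f g : E n × E m → ℂ)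
    (ω : GridParam n) (ω' : GridParam m) : ℂ :=
  ∑' P : Scales, scaleSum δ r T b₁ b₁' b₂ b₂' f g ω ω' P

end BiParam

end

/-!
The position of a cube of side `2 ^ (-p)`, hence its martingale difference, only involves the
coordinates `ω i` with `i > p`, whereas its goodness is decided by its position relative to the
larger cubes, that is, by the coordinates with `i ≤ p`. So the goodness of a cube is independent of
every term involving no larger cube. In expectation, the sum with goodness imposed on the smaller
cube is therefore the sum with goodness imposed on the first cube, plus the sum with goodness
imposed on the second, minus `π_good` times the unrestricted sum. In each of the three, a factor
without a goodness condition can be summed over all scales, which reproduces `f` or `g`, and then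
independence gives `π_good` times the full pairing. Doing this in one parameter at a time yields the
two factors.

Absolute convergence over the scales comes from the decay of the martingale differences of a
Lipschitz function of compact support: they are small at fine scales by the Lipschitz bound, and at
coarse scales because averages over large cubes are small in `L²`.
-/

noncomputable section

namespace BiParam

/-! ### Geometry of the shifted grids -/

/-- The integers larger than `p` in increasing order: the index set of the sum `gridShift ω p`. -/
def succSeqEquiv (p : ℤ) : ℕ ≃ {i : ℤ // p < i} where
  toFun k := ⟨p + 1 + k, by omega⟩
  invFun i := (i.1 - p - 1).toNat
  left_inv k := by simp only; omega
  right_inv i := Subtype.ext (by have := i.2; simp only; omega)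

section GridShift

variable {n : ℕ} (ω : GridParam n) (p : ℤ)

lemma gridShift_apply (j : Fin n) :
    gridShift ω p j = ∑' k : ℕ, (2 : ℝ) ^ (-(p + 1 + k)) * ((ω (p + 1 + k) j).val : ℝ) :=
  ((succSeqEquiv p).tsum_eq
    (fun i : {i : ℤ // p < i} => (2 : ℝ) ^ (-(i : ℤ)) * ((ω i j).val : ℝ))).symm

lemma gridShift_term_le (a : Fin 2) (k : ℕ) :
    (2 : ℝ) ^ (-(p + 1 + k)) * (a.val : ℝ) ≤ 2 ^ (-p) / 2 / 2 ^ k := by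
  have hsplit : (2 : ℝ) ^ (-(p + 1 + k)) = 2 ^ (-p) / 2 / 2 ^ k := by
    rw [neg_add, neg_add, zpow_add₀ two_ne_zero, zpow_add₀ two_ne_zero, zpow_neg 2 (k : ℤ),
      zpow_natCast, zpow_neg_one, div_eq_mul_inv, div_eq_mul_inv]
  rw [hsplit]
  exact mul_le_of_le_one_right (by positivity) (by exact_mod_cast Fin.is_le a)

lemma summable_gridShift (j : Fin n) :
    Summable fun k : ℕ => (2 : ℝ) ^ (-(p + 1 + k)) * ((ω (p + 1 + k) j).val : ℝ) :=
  .of_nonneg_of_le (fun _ => by positivity) (fun k => gridShift_term_le p _ k)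
    (summable_geometric_two' _)

lemma gridShift_nonneg (j : Fin n) : 0 ≤ gridShift ω p j := by
  rw [gridShift_apply]
  exact tsum_nonneg fun _ => by positivity

lemma gridShift_le (j : Fin n) : gridShift ω p j ≤ 2 ^ (-p) := by
  rw [gridShift_apply, ← tsum_geometric_two' ((2 : ℝ) ^ (-p))]
  exact (summable_gridShift ω p j).tsum_le_tsum (fun k => gridShift_term_le p _ k)
    (summable_geometric_two' _)

lemma gridShift_pred (j : Fin n) :
    gridShift ω (p - 1) j = gridShift ω p j + 2 ^ (-p) * ((ω p j).val : ℝ) := by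
  rw [gridShift_apply, gridShift_apply, (summable_gridShift ω (p - 1) j).tsum_eq_zero_add, add_comm]
  simp only [sub_add_cancel, Nat.cast_add, Nat.cast_one, Nat.cast_zero, add_zero, add_assoc,
    add_comm (1 : ℤ)]

lemma dependsOn_gridShift : DependsOn (fun ω : GridParam n => gridShift ω p) (Set.Ioi p) := by
  intro ω ω' h
  ext j
  simp only [gridShift_apply]
  congr! 4 with k
  exact congrArg (fun v => (v j).val) (h _ (show p < p + 1 + k by omega))

lemma continuous_gridShift : Continuous fun ω : GridParam n => gridShift ω p := by
  refine (PiLp.continuous_toLp 2 _).comp (continuous_pi fun j => ?_)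
  change Continuous fun ω : GridParam n => gridShift ω p j
  simp only [gridShift_apply]
  refine continuous_tsum (u := fun k : ℕ => (2 : ℝ) ^ (-p) / 2 / 2 ^ k) (fun k => ?_)
    (summable_geometric_two' _) (fun k ω => ?_)
  · exact continuous_const.mul ((continuous_of_discreteTopology
      (f := fun a : Fin 2 => (a.val : ℝ))).comp (by fun_prop))
  · rw [Real.norm_of_nonneg (by positivity)]
    exact gridShift_term_le p _ k

/-- The coordinates `ω_p, ω_{p-1}, …, ω_{p-s+1}`, which determine the position of the grid of
scale `p` inside the one of scale `p - s`. -/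
def window (s : ℕ) : Fin s → Fin n → Fin 2 := fun i => ω (p - i)

/-- The number `∑_{i < s} 2^i ω_{p-i,j}`: the position, in units of `2^{-p}`, of the grid of scale
`p - s` relative to the one of scale `p` in the `j`-th coordinate. -/
def position (s : ℕ) (j : Fin n) : ℕ := finFunctionFinEquiv fun i => window ω p s i j

lemma position_succ (s : ℕ) (j : Fin n) :
    position ω p (s + 1) j = position ω p s j + 2 ^ s * (ω (p - s) j).val := by
  simp only [position, window, finFunctionFinEquiv_apply, Fin.sum_univ_castSucc, Fin.val_castSucc,
    Fin.val_last, mul_comm]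

lemma two_zpow_neg_sub (s : ℕ) : (2 : ℝ) ^ (-(p - s)) = 2 ^ (-p) * 2 ^ s := by
  rw [neg_sub, sub_eq_neg_add, zpow_add₀ two_ne_zero, zpow_natCast]

lemma gridShift_sub (s : ℕ) (j : Fin n) :
    gridShift ω (p - s) j = gridShift ω p j + 2 ^ (-p) * position ω p s j := by
  induction s with
  | zero => simp [position]
  | succ s ih =>
    rw [Nat.cast_succ, ← sub_sub, gridShift_pred, ih, position_succ, two_zpow_neg_sub]
    push_cast
    ring

end GridShift

section Cubes

variable {n : ℕ} (ω : GridParam n)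

lemma side_pos (I : CubeLabel n) : 0 < side I := zpow_pos two_pos _

/-- The lower left corner of the cube `I ∔ ω`. -/
def corner (I : CubeLabel n) : E n :=
  WithLp.toLp 2 fun j => gridShift ω I.1 j + side I * (I.2 j : ℝ)

lemma gridCube_eq_cube (I : CubeLabel n) : gridCube ω I = cube (corner ω I) (side I) := by
  ext x
  simp only [gridCube, stdCube, corner, cube, Set.mem_ofPred_eq, PiLp.sub_apply]
  refine forall_congr' fun j => ⟨?_, ?_⟩ <;> rintro ⟨hl, hr⟩ <;> constructor <;> linarith

/-- The position of the cube of scale `p` that contains `x`. -/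
def cubeIndex (p : ℤ) (x : E n) : Fin n → ℤ :=
  fun j => ⌊2 ^ p * (x j - gridShift ω p j)⌋

lemma mem_gridCube_iff {ω : GridParam n} {p : ℤ} {k : Fin n → ℤ} {x : E n} :
    x ∈ gridCube ω (p, k) ↔ cubeIndex ω p x = k := by
  have h2p : (0 : ℝ) < 2 ^ p := by positivity
  simp only [gridCube, stdCube, cube, Set.mem_ofPred_eq, PiLp.sub_apply, side, cubeIndex,
    funext_iff, Int.floor_eq_iff, zpow_neg]
  refine forall_congr' fun j => ?_
  rw [inv_mul_le_iff₀ h2p, ← mul_add_one, lt_inv_mul_iff₀ h2p]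

lemma mem_gridCube_cubeIndex (p : ℤ) (x : E n) : x ∈ gridCube ω (p, cubeIndex ω p x) :=
  mem_gridCube_iff.2 rfl

lemma setDist_homothety (c : E n) {s : ℝ} (hs : 0 < s) (A B : Set (E n)) :
    setDist ((fun x => c + s • x) '' A) (frontier ((fun x => c + s • x) '' B)) =
      s * setDist A (frontier B) := by
  have hh : IsHomeomorph fun x : E n => c + s • x :=
    ((Homeomorph.smulOfNeZero s hs.ne').trans (Homeomorph.addLeft c)).isHomeomorph
  rw [← hh.image_frontier]
  unfold setDist
  rw [← smul_eq_mul, ← Real.sInf_smul_of_nonneg hs.le]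
  congr 1
  ext t
  simp only [Set.mem_ofPred_eq, Set.exists_mem_image, Set.mem_smul_set, dist_add_left, dist_smul₀,
    Real.norm_of_nonneg hs.le, smul_eq_mul]
  constructor
  · rintro ⟨x, hx, y, hy, rfl⟩
    exact ⟨_, ⟨x, hx, y, hy, rfl⟩, rfl⟩
  · rintro ⟨_, ⟨x, hx, y, hy, rfl⟩, rfl⟩
    exact ⟨x, hx, y, hy, rfl⟩

lemma image_cube (c a : E n) {s : ℝ} (hs : 0 < s) (l : ℝ) :
    (fun x => c + s • x) '' cube a l = cube (c + s • a) (s * l) := by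
  have hinv : Function.RightInverse (fun x : E n => s⁻¹ • (x - c)) fun x => c + s • x :=
    fun x => by simp [hs.ne']
  have hleft : Function.LeftInverse (fun x : E n => s⁻¹ • (x - c)) fun x => c + s • x :=
    fun x => by simp [hs.ne']
  rw [Set.image_eq_preimage_of_inverse hleft hinv]
  ext x
  simp only [Set.mem_preimage, cube, Set.mem_ofPred_eq, PiLp.add_apply, PiLp.smul_apply,
    PiLp.sub_apply, smul_eq_mul]
  refine forall_congr' fun j => ?_
  rw [le_inv_mul_iff₀ hs, inv_mul_lt_iff₀ hs, mul_add]
  constructor <;> rintro ⟨hl, hr⟩ <;> constructor <;> linarith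

lemma gridCube_eq_image (I : CubeLabel n) :
    gridCube ω I = (fun x => corner ω I + side I • x) '' cube 0 1 := by
  rw [image_cube _ _ (side_pos I), gridCube_eq_cube, smul_zero, add_zero, mul_one]

lemma gridCube_coarse_eq_image (I : CubeLabel n) (s : ℕ) (l : Fin n → ℤ) :
    gridCube ω (I.1 - s, l) = (fun x => corner ω I + side I • x) ''
      cube (WithLp.toLp 2 fun j => ((position ω I.1 s j - I.2 j + 2 ^ s * l j : ℤ) : ℝ))
        (2 ^ s) := by
  rw [image_cube _ _ (side_pos I), gridCube_eq_cube]
  simp only [side, two_zpow_neg_sub]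
  congr 1
  ext j
  simp only [corner, gridShift_sub, side, two_zpow_neg_sub, PiLp.add_apply, PiLp.smul_apply,
    smul_eq_mul]
  push_cast
  ring

end Cubes

/-! ### Goodness in terms of relative positions -/

section Offset

variable {n : ℕ}

/-- The position of the grid of scale `I.1 - s` relative to the cube `I ∔ ω`, in units of `ℓ(I)`.
That grid is invariant under translations by `2^s ℓ(I)`, so only the residue modulo `2^s`
matters. -/
def offset (ω : GridParam n) (I : CubeLabel n) (s : ℕ) : Fin n → ZMod (2 ^ s) :=
  fun j => position ω I.1 s j - I.2 j

/-- The relative positions for which the unit cube is too close to the boundary of some cube of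
side length `2^s`. -/
def badOffsets (n : ℕ) (δ : ℝ) (s : ℕ) : Set (Fin n → ZMod (2 ^ s)) :=
  {a | ∃ z : Fin n → ℤ, (∀ j, (z j : ZMod (2 ^ s)) = a j) ∧
    setDist (cube (0 : E n) 1) (frontier (cube (WithLp.toLp 2 fun j => (z j : ℝ)) (2 ^ s))) ≤
      2 * (2 ^ s) ^ (1 - gammaExp n δ)}

lemma side_mul_le_iff {r : ℕ} {I L : CubeLabel n} :
    (2 : ℝ) ^ r * side I ≤ side L ↔ L.1 + r ≤ I.1 := by
  unfold side
  rw [← zpow_natCast, ← zpow_add₀ two_ne_zero, zpow_le_zpow_iff_right₀ one_lt_two]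
  omega

lemma setDist_coarse_le_iff {δ : ℝ} (ω : GridParam n) (I : CubeLabel n) (s : ℕ) (l : Fin n → ℤ) :
    setDist (gridCube ω I) (frontier (gridCube ω (I.1 - s, l))) ≤
        2 * side I ^ gammaExp n δ * side ((I.1 - s, l) : CubeLabel n) ^ (1 - gammaExp n δ) ↔
      setDist (cube (0 : E n) 1) (frontier (cube (WithLp.toLp 2 fun j =>
        ((position ω I.1 s j - I.2 j + 2 ^ s * l j : ℤ) : ℝ)) (2 ^ s))) ≤
      2 * (2 ^ s) ^ (1 - gammaExp n δ) := by
  have hI := side_pos I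
  have hside : side ((I.1 - s, l) : CubeLabel n) = side I * 2 ^ s := two_zpow_neg_sub _ _
  have hpow : 2 * side I ^ gammaExp n δ * (side I * 2 ^ s) ^ (1 - gammaExp n δ) =
      side I * (2 * (2 ^ s) ^ (1 - gammaExp n δ)) := by
    calc _ = side I ^ gammaExp n δ * side I ^ (1 - gammaExp n δ) *
          (2 * (2 ^ s) ^ (1 - gammaExp n δ)) := by
          rw [Real.mul_rpow hI.le (by positivity)]; ring
      _ = _ := by rw [← Real.rpow_add hI, add_sub_cancel, Real.rpow_one]
  rw [hside, hpow, gridCube_coarse_eq_image, gridCube_eq_image, setDist_homothety _ hI,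
    mul_le_mul_iff_right₀ hI]

lemma isBad_iff {δ : ℝ} {r : ℕ} {ω : GridParam n} {I : CubeLabel n} :
    IsBad δ r ω I ↔ ∃ s, r ≤ s ∧ offset ω I s ∈ badOffsets n δ s := by
  constructor
  · rintro ⟨⟨q, l⟩, hL, h⟩
    rw [side_mul_le_iff] at hL
    obtain ⟨s, rfl⟩ : ∃ s : ℕ, q = I.1 - s := ⟨(I.1 - q).toNat, by omega⟩
    refine ⟨s, by omega, _, fun j => ?_, (setDist_coarse_le_iff ω I s l).1 h⟩
    have hs : (2 : ZMod (2 ^ s)) ^ s = 0 := by exact_mod_cast ZMod.natCast_self (2 ^ s)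
    simp [offset, hs]
  · rintro ⟨s, hs, z, hz, h⟩
    have hdvd (j : Fin n) : ∃ l, z j = position ω I.1 s j - I.2 j + 2 ^ s * l := by
      have : ((position ω I.1 s j - I.2 j : ℤ) : ZMod (2 ^ s)) = z j := by simp [hz, offset]
      obtain ⟨l, hl⟩ := (ZMod.intCast_eq_intCast_iff_dvd_sub _ _ _).1 this
      exact ⟨l, by push_cast at hl; linarith⟩
    choose l hl using hdvd
    refine ⟨(I.1 - s, l), side_mul_le_iff.2 (by simp only; omega),
      (setDist_coarse_le_iff ω I s l).2 ?_⟩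
    simpa only [hl] using h

end Offset

/-! ### The probability of being good -/

instance (n : ℕ) : IsProbabilityMeasure (gridMeasure n) := by
  unfold gridMeasure; infer_instance

section Law

variable {n : ℕ}

lemma gridMeasure_cylinder {ι : Type*} [Fintype ι] {e : ι → ℤ} (he : e.Injective)
    (c : ι → Fin n → Fin 2) :
    (gridMeasure n).real {ω | ∀ i, ω (e i) = c i} = (((2 : ℝ) ^ n) ^ Fintype.card ι)⁻¹ := by
  classical
  have hpi : {ω : GridParam n | ∀ i, ω (e i) = c i} =
      ((Finset.univ.image e : Finset ℤ) : Set ℤ).pi fun i => {Function.extend e c 0 i} := by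
    ext ω
    simp [he.extend_apply]
  rw [hpi, measureReal_def, gridMeasure,
    Measure.infinitePi_pi _ fun _ _ => measurableSet_singleton _]
  simp [Finset.card_image_of_injective _ he]

lemma measurable_window (p : ℤ) (s : ℕ) : Measurable fun ω : GridParam n => window ω p s :=
  measurable_pi_lambda _ fun _ => measurable_pi_apply _

lemma gridMeasure_window_mem (p : ℤ) (s : ℕ) (A : Set (Fin s → Fin n → Fin 2)) :
    (gridMeasure n).real {ω | window ω p s ∈ A} = A.ncard * (((2 : ℝ) ^ n) ^ s)⁻¹ := by
  classical
  have hA : {ω : GridParam n | window ω p s ∈ A} =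
      (fun ω => window ω p s) ⁻¹' (A.toFinset : Set (Fin s → Fin n → Fin 2)) := by
    rw [Set.coe_toFinset]; rfl
  have hsingle (c : Fin s → Fin n → Fin 2) :
      (gridMeasure n).real ((fun ω => window ω p s) ⁻¹' {c}) = (((2 : ℝ) ^ n) ^ s)⁻¹ := by
    have := gridMeasure_cylinder (n := n) (e := fun i : Fin s => p - (i : ℤ))
      (fun i i' h => Fin.ext (by simpa using h)) c
    rw [Fintype.card_fin] at this
    rw [← this]
    congr 1
    ext ω
    exact funext_iff
  rw [hA, ← sum_measureReal_preimage_singleton _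
    fun c _ => measurable_window p s (measurableSet_singleton c)]
  simp only [hsingle, Finset.sum_const, nsmul_eq_mul, Set.ncard_eq_toFinset_card']

/-- The relative position `offset ω I s` as a function of the digits `window ω I.1 s`. -/
def offsetOfDigits (k : Fin n → ℤ) (s : ℕ) (c : Fin s → Fin n → Fin 2) : Fin n → ZMod (2 ^ s) :=
  fun j => ((finFunctionFinEquiv fun i => c i j : Fin (2 ^ s)) : ℕ) - k j

lemma offset_eq_offsetOfDigits (ω : GridParam n) (I : CubeLabel n) (s : ℕ) :
    offset ω I s = offsetOfDigits I.2 s (window ω I.1 s) := rfl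

lemma bijective_offsetOfDigits (k : Fin n → ℤ) (s : ℕ) :
    Function.Bijective (offsetOfDigits k s) := by
  refine (Fintype.bijective_iff_injective_and_card _).2 ⟨fun c c' h => ?_, ?_⟩
  · ext i j : 2
    have hj := sub_left_injective (congrFun h j)
    rw [ZMod.natCast_eq_natCast_iff', Nat.mod_eq_of_lt (Fin.is_lt _),
      Nat.mod_eq_of_lt (Fin.is_lt _)] at hj
    exact congrFun (finFunctionFinEquiv.injective (Fin.ext hj)) i
  · simp [ZMod.card, ← pow_mul, mul_comm]

lemma measurable_offset (I : CubeLabel n) (s : ℕ) (A : Set (Fin n → ZMod (2 ^ s))) :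
    MeasurableSet {ω : GridParam n | offset ω I s ∈ A} := by
  simp only [offset_eq_offsetOfDigits]
  exact measurable_window I.1 s (Set.toFinite (offsetOfDigits I.2 s ⁻¹' A)).measurableSet

lemma gridMeasure_offset_mem (I : CubeLabel n) (s : ℕ) (A : Set (Fin n → ZMod (2 ^ s))) :
    (gridMeasure n).real {ω | offset ω I s ∈ A} = A.ncard * (((2 : ℝ) ^ s) ^ n)⁻¹ := by
  have hbij := bijective_offsetOfDigits I.2 s
  have hcard : (offsetOfDigits I.2 s ⁻¹' A).ncard = A.ncard :=
    Set.ncard_preimage_of_injective_subset_range hbij.injective fun a _ => hbij.surjective a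
  rw [← hcard, ← pow_mul, mul_comm s n, pow_mul]
  simp only [offset_eq_offsetOfDigits]
  exact gridMeasure_window_mem I.1 s (offsetOfDigits I.2 s ⁻¹' A)

lemma castHom_offset (ω : GridParam n) (I : CubeLabel n) {s N : ℕ} (h : s ≤ N) (j : Fin n) :
    ZMod.castHom (pow_dvd_pow 2 h) (ZMod (2 ^ s)) (offset ω I N j) = offset ω I s j := by
  simp only [offset, map_sub, map_natCast, map_intCast, sub_left_inj]
  induction N, h using Nat.le_induction with
  | base => rfl
  | succ N hN ih =>
    have hzero : ((2 ^ N : ℕ) : ZMod (2 ^ s)) = 0 :=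
      (ZMod.natCast_eq_zero_iff _ _).2 (pow_dvd_pow 2 hN)
    rw [position_succ, Nat.cast_add, Nat.cast_mul, hzero, zero_mul, add_zero, ih]

/-- The relative positions modulo `2^N` for which no cube of relative side length between `2^r`
and `2^N` makes the small cube bad. -/
def goodOffsets (n : ℕ) (δ : ℝ) (r N : ℕ) : Set (Fin n → ZMod (2 ^ N)) :=
  {a | ∀ s, r ≤ s → ∀ h : s ≤ N,
    (fun j => ZMod.castHom (pow_dvd_pow 2 h) (ZMod (2 ^ s)) (a j)) ∉ badOffsets n δ s}

lemma offset_mem_goodOffsets_iff {δ : ℝ} {r N : ℕ} {ω : GridParam n} {I : CubeLabel n} :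
    offset ω I N ∈ goodOffsets n δ r N ↔
      ∀ s, r ≤ s → s ≤ N → offset ω I s ∉ badOffsets n δ s := by
  refine forall₃_congr fun s _ h => ?_
  rw [show (fun j => ZMod.castHom (pow_dvd_pow 2 h) (ZMod (2 ^ s)) (offset ω I N j)) = _ from
    funext (castHom_offset ω I h)]

lemma setOf_isGood (δ : ℝ) (r : ℕ) (I : CubeLabel n) :
    {ω | IsGood δ r ω I} = ⋂ N, {ω | offset ω I N ∈ goodOffsets n δ r N} := by
  ext ω
  simp only [IsGood, isBad_iff, offset_mem_goodOffsets_iff, Set.mem_ofPred_eq, Set.mem_iInter,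
    not_exists, not_and]
  exact ⟨fun h _ s hrs _ => h s hrs, fun h s hrs => h s s hrs le_rfl⟩

lemma measurableSet_isGood (δ : ℝ) (r : ℕ) (I : CubeLabel n) :
    MeasurableSet {ω | IsGood δ r ω I} := by
  rw [setOf_isGood]
  exact .iInter fun N => measurable_offset I N _

open Filter Topology in
lemma tendsto_goodProb (δ : ℝ) (r : ℕ) (I : CubeLabel n) :
    Tendsto (fun N => (goodOffsets n δ r N).ncard * (((2 : ℝ) ^ N) ^ n)⁻¹) atTop
      (𝓝 (goodProb δ r I)) := by
  simp only [← gridMeasure_offset_mem I]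
  rw [goodProb, setOf_isGood]
  refine (ENNReal.tendsto_toReal (measure_ne_top _ _)).comp (tendsto_measure_iInter_atTop
    (fun N => (measurable_offset I N _).nullMeasurableSet) (fun N M hNM ω hω => ?_)
    ⟨0, measure_ne_top _ _⟩)
  exact offset_mem_goodOffsets_iff.2 fun s hrs hsN =>
    offset_mem_goodOffsets_iff.1 hω s hrs (hsN.trans hNM)

lemma goodProb_eq (δ : ℝ) (r : ℕ) (I : CubeLabel n) : goodProb δ r I = piGood n δ r :=
  tendsto_nhds_unique (tendsto_goodProb δ r I) (tendsto_goodProb δ r (0, 0))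

end Law

/-! ### Good cubes exist -/

section Positivity

variable {n : ℕ}

lemma frontier_cube_subset (a : E n) (s : ℝ) :
    frontier (cube a s) ⊆ {y | ∃ j, y j = a j ∨ y j = a j + s} := by
  have hcont (j : Fin n) : Continuous fun x : E n => x j := by fun_prop
  have hclosed : IsClosed {x : E n | ∀ j, a j ≤ x j ∧ x j ≤ a j + s} := by
    simp only [Set.ofPred_forall, Set.ofPred_and]
    exact isClosed_iInter fun j => (isClosed_le continuous_const (hcont j)).inter
      (isClosed_le (hcont j) continuous_const)
  have hopen : IsOpen {x : E n | ∀ j, a j < x j ∧ x j < a j + s} := by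
    simp only [Set.ofPred_forall, Set.ofPred_and]
    exact isOpen_iInter_of_finite fun j => (isOpen_lt continuous_const (hcont j)).inter
      (isOpen_lt (hcont j) continuous_const)
  rintro y ⟨hcl, hint⟩
  have hy := closure_minimal (fun x hx j => ⟨(hx j).1, (hx j).2.le⟩ :
    cube a s ⊆ {x : E n | ∀ j, a j ≤ x j ∧ x j ≤ a j + s}) hclosed hcl
  by_contra! hne
  exact hint (interior_maximal (fun x hx j => ⟨(hx j).1.le, (hx j).2⟩ :
    {x : E n | ∀ j, a j < x j ∧ x j < a j + s} ⊆ cube a s) hopen fun j =>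
      ⟨(hy j).1.lt_of_ne' fun h => hne ⟨j, .inl h⟩, (hy j).2.lt_of_ne fun h => hne ⟨j, .inr h⟩⟩)

lemma cube_nonempty (a : E n) {s : ℝ} (hs : 0 < s) : (cube a s).Nonempty :=
  ⟨a, fun _ => ⟨le_rfl, lt_add_of_pos_right _ hs⟩⟩

lemma frontier_cube_nonempty (hn : 0 < n) (a : E n) {s : ℝ} (hs : 0 < s) :
    (frontier (cube a s)).Nonempty := by
  rw [Set.nonempty_iff_ne_empty, Ne, frontier_eq_empty_iff, not_or]
  refine ⟨(cube_nonempty a hs).ne_empty, fun huniv => ?_⟩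
  have hmem : (WithLp.toLp 2 fun j => a j - 1 : E n) ∈ cube a s := huniv ▸ Set.mem_univ _
  have := (hmem ⟨0, hn⟩).1
  simp only at this
  linarith

lemma exists_mem_of_setDist_lt {A B : Set (E n)} (hA : A.Nonempty) (hB : B.Nonempty) {t : ℝ}
    (h : setDist A B < t) : ∃ x ∈ A, ∃ y ∈ B, dist x y < t := by
  obtain ⟨x₀, hx₀⟩ := hA
  obtain ⟨y₀, hy₀⟩ := hB
  have hne : {t | ∃ x ∈ A, ∃ y ∈ B, t = dist x y}.Nonempty := ⟨_, x₀, hx₀, y₀, hy₀, rfl⟩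
  obtain ⟨_, ⟨x, hx, y, hy, rfl⟩, ht⟩ := exists_lt_of_csInf_lt hne h
  exact ⟨x, hx, y, hy, ht⟩

lemma exists_near_of_mem_badOffsets (hn : 0 < n) {δ : ℝ} {s : ℕ} {a : Fin n → ZMod (2 ^ s)}
    (h : a ∈ badOffsets n δ s) :
    ∃ j, ∃ t : ℤ, (t : ZMod (2 ^ s)) = a j ∧ |(t : ℝ)| ≤ 2 * (2 ^ s) ^ (1 - gammaExp n δ) + 2 := by
  obtain ⟨z, hz, hdist⟩ := h
  have hs : (0 : ℝ) < 2 ^ s := by positivity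
  obtain ⟨x, hx, y, hy, hxy⟩ := exists_mem_of_setDist_lt (cube_nonempty (0 : E n) one_pos)
    (frontier_cube_nonempty hn _ hs) (hdist.trans_lt (lt_add_one _))
  obtain ⟨j, hj⟩ := frontier_cube_subset _ _ hy
  obtain ⟨t, hta, hty⟩ : ∃ t : ℤ, (t : ZMod (2 ^ s)) = a j ∧ y j = t := by
    rcases hj with hj | hj
    · exact ⟨z j, hz j, hj⟩
    · have hzero : (2 : ZMod (2 ^ s)) ^ s = 0 := by exact_mod_cast ZMod.natCast_self (2 ^ s)
      exact ⟨z j + 2 ^ s, by simp [hz, hzero], by rw [hj]; push_cast; rfl⟩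
  refine ⟨j, t, hta, ?_⟩
  have hcoord : |x j - y j| < _ := (PiLp.norm_apply_le (x - y) j).trans_lt (dist_eq_norm x y ▸ hxy)
  have hxj := hx j
  simp only [PiLp.zero_apply, zero_add] at hxj
  rw [abs_lt] at hcoord
  rw [← hty, abs_le]
  constructor <;> linarith [hcoord.1, hcoord.2, hxj.1, hxj.2]

lemma ncard_int_abs_le {x : ℝ} (hx : 0 ≤ x) : ({t : ℤ | |(t : ℝ)| ≤ x}.ncard : ℝ) ≤ 2 * x + 1 := by
  have hIcc : {t : ℤ | |(t : ℝ)| ≤ x} = (Finset.Icc (-⌊x⌋) ⌊x⌋ : Finset ℤ) := by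
    ext t
    rw [Set.mem_ofPred_eq, Finset.coe_Icc, Set.mem_Icc, ← abs_le, Int.le_floor, Int.cast_abs]
  have hfloor := Int.floor_nonneg.2 hx
  rw [hIcc, Set.ncard_coe_finset, Int.card_Icc, ← Int.cast_natCast, Int.toNat_of_nonneg (by omega)]
  push_cast
  linarith [Int.floor_le x]

lemma ncard_setOf_apply_mem {ι R : Type*} [Fintype ι] [Fintype R] (j : ι) (S : Set R) :
    {a : ι → R | a j ∈ S}.ncard = S.ncard * Fintype.card R ^ (Fintype.card ι - 1) := by
  classical
  have hprod : {a : ι → R | a j ∈ S} = Equiv.funSplitAt j R ⁻¹' (S ×ˢ Set.univ) := by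
    ext a
    simp
  rw [hprod, Set.ncard_preimage_of_injective_subset_range (Equiv.injective _) (by simp),
    Set.ncard_prod, Set.ncard_univ, Nat.card_eq_fintype_card, Fintype.card_fun,
    Fintype.card_subtype_compl, Fintype.card_subtype_eq]

lemma gammaExp_pos {δ : ℝ} (hδ : 0 < δ) : 0 < gammaExp n δ := by
  unfold gammaExp; positivity

lemma gammaExp_le_one {δ : ℝ} (hδ : 0 < δ) : gammaExp n δ ≤ 1 := by
  unfold gammaExp
  rw [div_le_one (by positivity)]
  linarith [Nat.cast_nonneg (α := ℝ) n]

lemma ncard_badOffsets_le (hn : 0 < n) {δ : ℝ} (hδ : 0 < δ) (s : ℕ) :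
    ((badOffsets n δ s).ncard : ℝ) ≤
      n * (9 * (2 ^ s) ^ (1 - gammaExp n δ) * (2 ^ s) ^ (n - 1)) := by
  set M : ℝ := (2 ^ s) ^ (1 - gammaExp n δ)
  have hM : 1 ≤ M := Real.one_le_rpow (one_le_pow₀ one_le_two) (sub_nonneg.2 (gammaExp_le_one hδ))
  set S : Set (ZMod (2 ^ s)) := (fun t : ℤ => (t : ZMod (2 ^ s))) '' {t : ℤ | |(t : ℝ)| ≤ 2 * M + 2}
  have hfin : {t : ℤ | |(t : ℝ)| ≤ 2 * M + 2}.Finite :=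
    (Set.finite_Icc (-⌊2 * M + 2⌋) ⌊2 * M + 2⌋).subset fun t ht => by
      rwa [Set.mem_Icc, ← abs_le, Int.le_floor, Int.cast_abs]
  have hS : (S.ncard : ℝ) ≤ 9 * M :=
    calc (S.ncard : ℝ) ≤ ({t : ℤ | |(t : ℝ)| ≤ 2 * M + 2}.ncard : ℝ) :=
          Nat.cast_le.2 (Set.ncard_image_le hfin)
      _ ≤ 2 * (2 * M + 2) + 1 := ncard_int_abs_le (by positivity)
      _ ≤ 9 * M := by linarith
  have hsub : badOffsets n δ s ⊆ ⋃ j ∈ Finset.univ, {a | a j ∈ S} := fun a ha => by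
    obtain ⟨j, t, hta, ht⟩ := exists_near_of_mem_badOffsets hn ha
    exact Set.mem_iUnion₂.2 ⟨j, Finset.mem_univ j, t, ht, hta⟩
  calc ((badOffsets n δ s).ncard : ℝ)
      ≤ ∑ j : Fin n, ({a : Fin n → ZMod (2 ^ s) | a j ∈ S}.ncard : ℝ) := by
        exact_mod_cast (Set.ncard_le_ncard hsub).trans (Finset.set_ncard_biUnion_le _ _)
    _ = n * (S.ncard * (2 ^ s) ^ (n - 1)) := by
        simp [ncard_setOf_apply_mem]
    _ ≤ n * (9 * M * (2 ^ s) ^ (n - 1)) := by gcongr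

lemma gridMeasure_badOffsets_le (hn : 0 < n) {δ : ℝ} (hδ : 0 < δ) (I : CubeLabel n) (s : ℕ) :
    (gridMeasure n).real {ω | offset ω I s ∈ badOffsets n δ s} ≤
      9 * n * ((2 : ℝ) ^ (-gammaExp n δ)) ^ s := by
  have h2s : (0 : ℝ) < 2 ^ s := by positivity
  rw [gridMeasure_offset_mem]
  calc _ ≤ n * (9 * (2 ^ s) ^ (1 - gammaExp n δ) * (2 ^ s) ^ (n - 1)) * (((2 : ℝ) ^ s) ^ n)⁻¹ := by
        gcongr; exact ncard_badOffsets_le hn hδ s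
    _ = 9 * n * ((2 ^ s) ^ (1 - gammaExp n δ) / 2 ^ s) := by
        obtain ⟨d, rfl⟩ := Nat.exists_eq_add_of_lt hn
        simp only [zero_add, Nat.add_sub_cancel, pow_succ]
        field_simp
    _ = _ := by
        rw [← Real.rpow_sub_one h2s.ne', sub_sub_cancel_left, ← Real.rpow_natCast 2 s,
          ← Real.rpow_natCast, ← Real.rpow_mul zero_le_two, ← Real.rpow_mul zero_le_two, mul_comm
          (s : ℝ)]

lemma exists_piGood_pos (hn : 0 < n) {δ : ℝ} (hδ : 0 < δ) :
    ∃ r₀ : ℕ, ∀ r : ℕ, r₀ ≤ r → 0 < piGood n δ r := by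
  set P : ℕ → ℝ := fun s => 9 * n * ((2 : ℝ) ^ (-gammaExp n δ)) ^ s
  have hP (s : ℕ) : 0 ≤ P s := by positivity
  have hsum : Summable P := (summable_geometric_of_lt_one (by positivity)
    (Real.rpow_lt_one_of_one_lt_of_neg one_lt_two (neg_lt_zero.2 (gammaExp_pos hδ)))).mul_left _
  obtain ⟨r₀, hr₀⟩ := Filter.eventually_atTop.1
    ((tendsto_sum_nat_add P).eventually_lt_const one_pos)
  refine ⟨r₀, fun r hr => ?_⟩
  have hcompl : {ω : GridParam n | IsGood δ r ω (0, 0)}ᶜ ⊆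
      ⋃ i, {ω | offset ω (0, 0) (i + r) ∈ badOffsets n δ (i + r)} := fun ω hω => by
    obtain ⟨s, hs, h⟩ := isBad_iff.1 (not_not.1 hω)
    exact Set.mem_iUnion.2 ⟨s - r, by rwa [Nat.sub_add_cancel hs]⟩
  have hbad : gridMeasure n {ω | IsGood δ r ω (0, 0)}ᶜ < 1 :=
    calc _ ≤ ∑' i, gridMeasure n {ω | offset ω (0, 0) (i + r) ∈ badOffsets n δ (i + r)} :=
          (measure_mono hcompl).trans (measure_iUnion_le _)
      _ ≤ ∑' i, ENNReal.ofReal (P (i + r)) := ENNReal.tsum_le_tsum fun i => by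
          rw [← ofReal_measureReal]
          exact ENNReal.ofReal_le_ofReal (gridMeasure_badOffsets_le hn hδ _ _)
      _ = ENNReal.ofReal (∑' i, P (i + r)) :=
          (ENNReal.ofReal_tsum_of_nonneg (fun _ => hP _) ((summable_nat_add_iff r).2 hsum)).symm
      _ < 1 := ENNReal.ofReal_lt_one.2 (hr₀ r hr)
  rw [prob_compl_eq_one_sub (measurableSet_isGood δ r (0, 0))] at hbad
  refine ENNReal.toReal_pos (fun hzero => ?_) (measure_ne_top _ _)
  simp [hzero] at hbad

end Positivity

/-! ### Goodness is independent of the finer scales -/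

section Independence

open ProbabilityTheory

lemma comap_le_iSup_comap_of_dependsOn {ι β : Type*} {Ω : ι → Type*} [∀ i, MeasurableSpace (Ω i)]
    [∀ i, Nonempty (Ω i)] [MeasurableSpace β] {S : Set ι} {X : ((i : ι) → Ω i) → β}
    (hX : Measurable X) (hXS : DependsOn X S) :
    MeasurableSpace.comap X inferInstance ≤
      ⨆ i ∈ S, MeasurableSpace.comap (fun ω : (i : ι) → Ω i => ω i) inferInstance := by
  classical
  let ρ : ((i : ι) → Ω i) → (i : ι) → Ω i := fun ω i => if i ∈ S then ω i else Classical.arbitrary _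
  have hXρ : X = X ∘ ρ := funext fun ω => hXS fun i hi => by simp [ρ, hi]
  have hρ : Measurable[⨆ i ∈ S, MeasurableSpace.comap (fun ω : (i : ι) → Ω i => ω i)
      inferInstance] ρ := by
    refine (@measurable_pi_iff _ _ _ (_) _ _).2 fun i => ?_
    by_cases hi : i ∈ S
    · simp only [ρ, hi, if_true]
      exact (comap_measurable _).mono (le_iSup₂_of_le i hi le_rfl) le_rfl
    · simp only [ρ, hi, if_false]
      exact measurable_const
  rw [hXρ]
  exact (hX.comp hρ).comap_le

lemma indepFun_infinitePi_of_dependsOn {ι β β' : Type*} {Ω : ι → Type*}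
    [∀ i, MeasurableSpace (Ω i)] [MeasurableSpace β] [MeasurableSpace β']
    {μ : (i : ι) → Measure (Ω i)} [∀ i, IsProbabilityMeasure (μ i)] {S T : Set ι}
    (hST : Disjoint S T) {X : ((i : ι) → Ω i) → β} {Y : ((i : ι) → Ω i) → β'}
    (hX : Measurable X) (hY : Measurable Y) (hXS : DependsOn X S) (hYT : DependsOn Y T) :
    IndepFun X Y (Measure.infinitePi μ) := by
  have hΩ : ∀ i, Nonempty (Ω i) := fun i => (μ i).nonempty_of_neZero
  have hcoord : iIndep (fun i => MeasurableSpace.comap (fun ω : (i : ι) → Ω i => ω i) inferInstance)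
      (Measure.infinitePi μ) :=
    iIndepFun_infinitePi (X := fun _ x => x) fun _ => measurable_id
  have hdisj := indep_iSup_of_disjoint (fun i => (measurable_pi_apply i).comap_le) hcoord hST
  rw [IndepFun_iff_Indep]
  exact indep_of_indep_of_le_left
    (indep_of_indep_of_le_right hdisj (comap_le_iSup_comap_of_dependsOn hY hYT))
    (comap_le_iSup_comap_of_dependsOn hX hXS)

end Independence

section ChiGood

variable {n : ℕ}

lemma dependsOn_position (p : ℤ) (s : ℕ) :
    DependsOn (fun ω : GridParam n => position ω p s) (Set.Iic p) := by
  intro ω ω' h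
  ext j
  have hwin : window ω p s = window ω' p s := funext fun i => h _ (by simp)
  simp only [position, hwin]

lemma dependsOn_chiGood (δ : ℝ) (r : ℕ) (I : CubeLabel n) :
    DependsOn (fun ω => chiGood δ r ω I) (Set.Iic I.1) := by
  intro (ω : GridParam n) (ω' : GridParam n) h
  have hoff : ∀ s, offset ω I s = offset ω' I s := fun s => by
    unfold offset
    rw [show position ω I.1 s = position ω' I.1 s from dependsOn_position I.1 s h]
  have hgood : IsGood δ r ω I ↔ IsGood δ r ω' I := by
    rw [IsGood, IsGood, isBad_iff, isBad_iff]
    exact not_congr (exists_congr fun s => by rw [hoff])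
  change chiGood δ r ω I = chiGood δ r ω' I
  unfold chiGood
  rw [propext hgood]

lemma chiGood_eq_indicator (δ : ℝ) (r : ℕ) (I : CubeLabel n) :
    (fun ω => chiGood δ r ω I) = {ω | IsGood δ r ω I}.indicator 1 := by
  classical
  ext ω
  simp [chiGood, Set.indicator_apply]

lemma measurable_chiGood (δ : ℝ) (r : ℕ) (I : CubeLabel n) :
    Measurable fun ω => chiGood δ r ω I := by
  rw [chiGood_eq_indicator]
  exact measurable_one.indicator (measurableSet_isGood δ r I)

lemma norm_chiGood_le (δ : ℝ) (r : ℕ) (ω : GridParam n) (I : CubeLabel n) :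
    ‖chiGood δ r ω I‖ ≤ 1 := by
  unfold chiGood
  split_ifs <;> simp

lemma integral_chiGood (δ : ℝ) (r : ℕ) (I : CubeLabel n) :
    ∫ ω, chiGood δ r ω I ∂gridMeasure n = piGood n δ r := by
  rw [chiGood_eq_indicator, Pi.one_def, integral_indicator_const _ (measurableSet_isGood δ r I),
    ← goodProb_eq δ r I]
  simp [goodProb]

lemma integral_chiGood_mul (δ : ℝ) (r : ℕ) (I : CubeLabel n) {Z : GridParam n → ℂ}
    (hZ : Measurable Z) (hZI : DependsOn Z (Set.Ioi I.1)) :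
    ∫ ω, chiGood δ r ω I * Z ω ∂gridMeasure n = piGood n δ r * ∫ ω, Z ω ∂gridMeasure n := by
  have hdisj : Disjoint (Set.Iic I.1) (Set.Ioi I.1) := Set.Iic_disjoint_Ioi le_rfl
  rw [← integral_chiGood δ r I]
  exact (indepFun_infinitePi_of_dependsOn hdisj (measurable_chiGood δ r I) hZ
    (dependsOn_chiGood δ r I) hZI).integral_fun_mul_eq_mul_integral
    (measurable_chiGood δ r I).aestronglyMeasurable hZ.aestronglyMeasurable

end ChiGood

/-! ### Bilinear forms of random series -/

section RandomSeries

lemma hasSum_integral_of_summable_bound {Ω ι : Type*} [MeasurableSpace Ω] {μ : Measure Ω}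
    [IsFiniteMeasure μ] [Countable ι] {F : ι → Ω → ℂ} {f : Ω → ℂ} {t : ι → ℝ}
    (hF : ∀ i, StronglyMeasurable (F i)) (hFt : ∀ i ω, ‖F i ω‖ ≤ t i) (ht : Summable t)
    (hf : ∀ ω, HasSum (fun i => F i ω) (f ω)) :
    HasSum (fun i => ∫ ω, F i ω ∂μ) (∫ ω, f ω ∂μ) :=
  hasSum_integral_of_dominated_convergence (fun i _ => t i)
    (fun i => (hF i).aestronglyMeasurable) (fun i => ae_of_all _ (hFt i)) (ae_of_all _ fun _ => ht)
    (integrable_const _) (ae_of_all _ hf)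

variable {X Y : Type*} [NormedAddCommGroup X] [NormedSpace ℂ X] [NormedAddCommGroup Y]
  [NormedSpace ℂ Y] (B : X →L[ℂ] Y →L[ℂ] ℂ)

lemma norm_bilin_le {U : X} {V : Y} {s t : ℝ} (hU : ‖U‖ ≤ s) (hV : ‖V‖ ≤ t) :
    ‖B U V‖ ≤ ‖B‖ * (s * t) := by
  have hs : 0 ≤ s := (norm_nonneg _).trans hU
  calc ‖B U V‖ ≤ ‖B‖ * ‖U‖ * ‖V‖ := B.le_opNorm₂ U V
    _ ≤ ‖B‖ * s * t := by gcongr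
    _ = ‖B‖ * (s * t) := mul_assoc _ _ _

lemma bilin_weighted_sum {ι κ : Type*} (s : Finset ι) (t : Finset κ) (ε : ι → ℂ) (η : κ → ℂ)
    (U : ι → X) (V : κ → Y) :
    B (∑ k ∈ s, ε k • U k) (∑ l ∈ t, η l • V l) =
      ∑ k ∈ s, ∑ l ∈ t, ε k * η l * B (U k) (V l) := by
  simp only [map_sum, map_smul, _root_.sum_apply, _root_.smul_apply, smul_eq_mul, Finset.mul_sum]
  rw [Finset.sum_comm]
  exact Finset.sum_congr rfl fun _ _ => Finset.sum_congr rfl fun _ _ => by ring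

variable {Ω ι κ : Type*} [MeasurableSpace Ω] {μ : Measure Ω}

lemma stronglyMeasurable_bilin {U : Ω → X} {V : Ω → Y} (hU : StronglyMeasurable U)
    (hV : StronglyMeasurable V) : StronglyMeasurable fun ω => B (U ω) (V ω) :=
  B.continuous₂.comp_stronglyMeasurable (hU.prodMk hV)

variable [IsProbabilityMeasure μ] [Countable κ]

lemma integrable_bilin {U : Ω → X} {V : Ω → Y} (hU : StronglyMeasurable U)
    (hV : StronglyMeasurable V) {s t : ℝ} (hUs : ∀ ω, ‖U ω‖ ≤ s) (hVt : ∀ ω, ‖V ω‖ ≤ t) :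
    Integrable (fun ω => B (U ω) (V ω)) μ :=
  Integrable.of_bound (stronglyMeasurable_bilin B hU hV).aestronglyMeasurable (‖B‖ * (s * t))
    (ae_of_all _ fun ω => norm_bilin_le B (hUs ω) (hVt ω))

lemma hasSum_integral_bilin {U : Ω → X} {V : Ω → κ → Y} {y : Y} {s : ℝ} {t : κ → ℝ}
    (hU : StronglyMeasurable U) (hV : ∀ q, StronglyMeasurable fun ω => V ω q)
    (hUs : ∀ ω, ‖U ω‖ ≤ s) (hVt : ∀ ω q, ‖V ω q‖ ≤ t q) (ht : Summable t)
    (hy : ∀ ω, HasSum (V ω) y) :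
    HasSum (fun q => ∫ ω, B (U ω) (V ω q) ∂μ) (∫ ω, B (U ω) y ∂μ) :=
  hasSum_integral_of_summable_bound (fun q => stronglyMeasurable_bilin B hU (hV q))
    (fun q ω => norm_bilin_le B (hUs ω) (hVt ω q)) ((ht.mul_left s).mul_left ‖B‖)
    fun ω => (hy ω).mapL (B (U ω))

lemma hasSum_integral_bilin_prod {U : Ω → ι → X} {V : Ω → κ → Y} {y : Y} {z : ℂ} {s : ι → ℝ}
    {t : κ → ℝ} (hU : ∀ p, StronglyMeasurable fun ω => U ω p)
    (hV : ∀ q, StronglyMeasurable fun ω => V ω q) (hUs : ∀ ω p, ‖U ω p‖ ≤ s p)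
    (hVt : ∀ ω q, ‖V ω q‖ ≤ t q) (hs : Summable s) (ht : Summable t)
    (hy : ∀ ω, HasSum (V ω) y) (hz : HasSum (fun p => ∫ ω, B (U ω p) y ∂μ) z) :
    HasSum (fun P : ι × κ => ∫ ω, B (U ω P.1) (V ω P.2) ∂μ) z := by
  obtain ⟨ω₀⟩ := μ.nonempty_of_neZero
  have hs₀ : 0 ≤ s := fun p => (norm_nonneg _).trans (hUs ω₀ p)
  have ht₀ : 0 ≤ t := fun q => (norm_nonneg _).trans (hVt ω₀ q)
  have hbound : Summable fun P : ι × κ => ‖B‖ * (s P.1 * t P.2) :=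
    (hs.mul_of_nonneg ht hs₀ ht₀).mul_left _
  have hsum : Summable fun P : ι × κ => ∫ ω, B (U ω P.1) (V ω P.2) ∂μ := by
    refine Summable.of_norm_bounded hbound fun P => (norm_integral_le_of_norm_le_const
      (ae_of_all _ fun ω => norm_bilin_le B (hUs ω P.1) (hVt ω P.2))).trans ?_
    rw [probReal_univ, mul_one]
  have hrow : ∀ p, HasSum (fun q => ∫ ω, B (U ω p) (V ω q) ∂μ) (∫ ω, B (U ω p) y ∂μ) := fun p =>
    hasSum_integral_bilin B (hU p) hV (fun ω => hUs ω p) hVt ht hy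
  rw [← (hsum.hasSum.prod_fiberwise hrow).unique hz]
  exact hsum.hasSum

end RandomSeries

/-! ### Averaging a bilinear form over random grids, one parameter -/

/-- A decomposition `x = ∑_p ∑_k u ω p k` along the cubes `(p, k)` of the random grid. At each
scale only the positions in `K p` contribute, the terms depend on the strictly finer scales of the
grid only, and the sums over the cubes of scale `p` are bounded by `a p`, whatever weights of
modulus at most `1` are put on the cubes. -/
structure IsGridDecomp {n : ℕ} {X : Type*} [NormedAddCommGroup X] [NormedSpace ℂ X]
    (K : ℤ → Finset (Fin n → ℤ)) (a : ℤ → ℝ)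
    (u : GridParam n → ℤ → (Fin n → ℤ) → X) (x : X) : Prop where
  stronglyMeasurable : ∀ p k, StronglyMeasurable fun ω => u ω p k
  dependsOn : ∀ p k, DependsOn (fun ω => u ω p k) (Set.Ioi p)
  norm_weighted_sum_le : ∀ ω p (ε : (Fin n → ℤ) → ℂ), (∀ k, ‖ε k‖ ≤ 1) →
    ‖∑ k ∈ K p, ε k • u ω p k‖ ≤ a p
  summable : Summable a
  hasSum : ∀ ω, HasSum (fun p => ∑ k ∈ K p, u ω p k) x

section Weights

variable {n : ℕ}

/-- The contribution of the first cube `(p₁, k)` to `χ_good(small(I₁, I₂))`, if `I₂` has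
scale `p₂`. -/
def weightLeft (δ : ℝ) (r : ℕ) (ω : GridParam n) (p₁ p₂ : ℤ) (k : Fin n → ℤ) : ℂ :=
  if p₂ ≤ p₁ then chiGood δ r ω (p₁, k) else 1

/-- The contribution of the second cube `(p₂, k)` to `χ_good(small(I₁, I₂))`, if `I₁` has
scale `p₁`. -/
def weightRight (δ : ℝ) (r : ℕ) (ω : GridParam n) (p₁ p₂ : ℤ) (k : Fin n → ℤ) : ℂ :=
  if p₂ ≤ p₁ then 1 else chiGood δ r ω (p₂, k)

lemma chiGood_small (δ : ℝ) (r : ℕ) (ω : GridParam n) (p₁ p₂ : ℤ) (k₁ k₂ : Fin n → ℤ) :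
    chiGood δ r ω (small (p₁, k₁) (p₂, k₂)) =
      weightLeft δ r ω p₁ p₂ k₁ * weightRight δ r ω p₁ p₂ k₂ := by
  unfold small weightLeft weightRight
  split_ifs <;> simp

lemma norm_weightLeft_le (δ : ℝ) (r : ℕ) (ω : GridParam n) (p₁ p₂ : ℤ) (k : Fin n → ℤ) :
    ‖weightLeft δ r ω p₁ p₂ k‖ ≤ 1 := by
  unfold weightLeft
  split_ifs
  exacts [norm_chiGood_le _ _ _ _, norm_one.le]

lemma norm_weightRight_le (δ : ℝ) (r : ℕ) (ω : GridParam n) (p₁ p₂ : ℤ) (k : Fin n → ℤ) :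
    ‖weightRight δ r ω p₁ p₂ k‖ ≤ 1 := by
  unfold weightRight
  split_ifs
  exacts [norm_one.le, norm_chiGood_le _ _ _ _]

end Weights

section OneParam

variable {n : ℕ} {X Y : Type*} [NormedAddCommGroup X] [NormedSpace ℂ X]
  [NormedAddCommGroup Y] [NormedSpace ℂ Y]
  {K L : ℤ → Finset (Fin n → ℤ)} {a c : ℤ → ℝ}
  {u : GridParam n → ℤ → (Fin n → ℤ) → X} {v : GridParam n → ℤ → (Fin n → ℤ) → Y} {x : X} {y : Y}

lemma IsGridDecomp.nonneg (hu : IsGridDecomp K a u x) : 0 ≤ a := fun p =>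
  (norm_nonneg _).trans (hu.norm_weighted_sum_le (fun _ _ => 0) p (fun _ => 0) (by simp))

lemma IsGridDecomp.norm_sum_le (hu : IsGridDecomp K a u x) (ω : GridParam n) (p : ℤ) :
    ‖∑ k ∈ K p, u ω p k‖ ≤ a p := by
  simpa using hu.norm_weighted_sum_le ω p (fun _ => 1) (by simp)

lemma IsGridDecomp.norm_good_sum_le (hu : IsGridDecomp K a u x) (δ : ℝ) (r : ℕ)
    (ω : GridParam n) (p : ℤ) : ‖∑ k ∈ K p, chiGood δ r ω (p, k) • u ω p k‖ ≤ a p :=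
  hu.norm_weighted_sum_le ω p _ fun k => norm_chiGood_le δ r ω (p, k)

lemma IsGridDecomp.norm_le (hu : IsGridDecomp K a u x) (ω : GridParam n) {p : ℤ}
    {k : Fin n → ℤ} (hk : k ∈ K p) : ‖u ω p k‖ ≤ a p := by
  classical
  have h := hu.norm_weighted_sum_le ω p (fun l => if l = k then 1 else 0)
    fun l => by split_ifs <;> simp
  simpa [ite_smul, Finset.sum_ite_eq', hk] using h

lemma IsGridDecomp.stronglyMeasurable_sum (hu : IsGridDecomp K a u x) (p : ℤ) :
    StronglyMeasurable fun ω => ∑ k ∈ K p, u ω p k :=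
  Finset.stronglyMeasurable_fun_sum _ fun k _ => hu.stronglyMeasurable p k

lemma IsGridDecomp.stronglyMeasurable_good_sum (hu : IsGridDecomp K a u x) (δ : ℝ) (r : ℕ)
    (p : ℤ) : StronglyMeasurable fun ω => ∑ k ∈ K p, chiGood δ r ω (p, k) • u ω p k :=
  Finset.stronglyMeasurable_fun_sum _ fun k _ =>
    (measurable_chiGood δ r (p, k)).stronglyMeasurable.smul (hu.stronglyMeasurable p k)

lemma IsGridDecomp.dependsOn_sum (hu : IsGridDecomp K a u x) {p q : ℤ} (hqp : q ≤ p) :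
    DependsOn (fun ω => ∑ k ∈ K p, u ω p k) (Set.Ioi q) := fun _ _ h =>
  Finset.sum_congr rfl fun k _ => (hu.dependsOn p k).mono (Set.Ioi_subset_Ioi hqp) h

variable (δ : ℝ) (r : ℕ) (B : X →L[ℂ] Y →L[ℂ] ℂ)

lemma IsGridDecomp.integral_good_sum (hu : IsGridDecomp K a u x) (p : ℤ) {V : GridParam n → Y}
    (hV : StronglyMeasurable V) (hVp : DependsOn V (Set.Ioi p)) {d : ℝ} (hVd : ∀ ω, ‖V ω‖ ≤ d) :
    ∫ ω, B (∑ k ∈ K p, chiGood δ r ω (p, k) • u ω p k) (V ω) ∂gridMeasure n =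
      piGood n δ r * ∫ ω, B (∑ k ∈ K p, u ω p k) (V ω) ∂gridMeasure n := by
  have hint : ∀ k ∈ K p, Integrable (fun ω => B (u ω p k) (V ω)) (gridMeasure n) := fun k hk =>
    integrable_bilin B (hu.stronglyMeasurable p k) hV (fun ω => hu.norm_le ω hk) hVd
  have hgood : ∀ k ∈ K p,
      Integrable (fun ω => chiGood δ r ω (p, k) * B (u ω p k) (V ω)) (gridMeasure n) := fun k hk =>
    (hint k hk).bdd_mul (measurable_chiGood δ r (p, k)).aestronglyMeasurable
      (ae_of_all _ fun ω => norm_chiGood_le δ r ω (p, k))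
  simp only [map_sum, map_smul, _root_.sum_apply, _root_.smul_apply, smul_eq_mul]
  rw [integral_finsetSum _ hint, integral_finsetSum _ hgood, Finset.mul_sum]
  refine Finset.sum_congr rfl fun k _ => integral_chiGood_mul δ r (p, k)
    (stronglyMeasurable_bilin B (hu.stronglyMeasurable p k) hV).measurable fun ω ω' h => ?_
  rw [hVp h, show u ω p k = u ω' p k from hu.dependsOn p k h]

lemma IsGridDecomp.hasSum_integral_left (hu : IsGridDecomp K a u x) (y : Y) :
    HasSum (fun p => ∫ ω, B (∑ k ∈ K p, u ω p k) y ∂gridMeasure n) (B x y) := by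
  have h := hasSum_integral_bilin (μ := gridMeasure n) B.flip (U := fun _ => y)
    stronglyMeasurable_const hu.stronglyMeasurable_sum (fun _ => le_rfl) hu.norm_sum_le
    hu.summable hu.hasSum
  simpa using h

lemma IsGridDecomp.hasSum_integral_all (hu : IsGridDecomp K a u x) (hv : IsGridDecomp L c v y) :
    HasSum (fun P : ℤ × ℤ => ∫ ω, B (∑ k ∈ K P.1, u ω P.1 k) (∑ l ∈ L P.2, v ω P.2 l)
      ∂gridMeasure n) (B x y) :=
  hasSum_integral_bilin_prod B (U := fun ω p => ∑ k ∈ K p, u ω p k)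
    (V := fun ω q => ∑ l ∈ L q, v ω q l) hu.stronglyMeasurable_sum hv.stronglyMeasurable_sum
    hu.norm_sum_le hv.norm_sum_le hu.summable hv.summable hv.hasSum (hu.hasSum_integral_left B y)

lemma IsGridDecomp.hasSum_integral_good_left (hu : IsGridDecomp K a u x)
    (hv : IsGridDecomp L c v y) :
    HasSum (fun P : ℤ × ℤ => ∫ ω, B (∑ k ∈ K P.1, chiGood δ r ω (P.1, k) • u ω P.1 k)
      (∑ l ∈ L P.2, v ω P.2 l) ∂gridMeasure n) (piGood n δ r * B x y) := by
  refine hasSum_integral_bilin_prod B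
    (U := fun ω p => ∑ k ∈ K p, chiGood δ r ω (p, k) • u ω p k)
    (V := fun ω q => ∑ l ∈ L q, v ω q l) (hu.stronglyMeasurable_good_sum δ r)
    hv.stronglyMeasurable_sum (hu.norm_good_sum_le δ r) hv.norm_sum_le hu.summable hv.summable
    hv.hasSum ?_
  have hindep : ∀ p, ∫ ω, B (∑ k ∈ K p, chiGood δ r ω (p, k) • u ω p k) y ∂gridMeasure n =
      piGood n δ r * ∫ ω, B (∑ k ∈ K p, u ω p k) y ∂gridMeasure n := fun p =>
    hu.integral_good_sum δ r B p stronglyMeasurable_const (fun _ _ _ => rfl) fun _ => le_rfl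
  simpa only [hindep] using (hu.hasSum_integral_left B y).mul_left (piGood n δ r : ℂ)

/-- The sum of the values `B (u ω p₁ k) (v ω p₂ l)` over the cubes of two given scales
`P = (p₁, p₂)`, restricted to the pairs of cubes the smaller one of which is good. -/
def goodPairSum (K L : ℤ → Finset (Fin n → ℤ)) (u : GridParam n → ℤ → (Fin n → ℤ) → X)
    (v : GridParam n → ℤ → (Fin n → ℤ) → Y) (ω : GridParam n) (P : ℤ × ℤ) : ℂ :=
  ∑ k ∈ K P.1, ∑ l ∈ L P.2,
    chiGood δ r ω (small (P.1, k) (P.2, l)) * B (u ω P.1 k) (v ω P.2 l)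

lemma goodPairSum_eq (ω : GridParam n) (P : ℤ × ℤ) :
    goodPairSum δ r B K L u v ω P =
      B (∑ k ∈ K P.1, weightLeft δ r ω P.1 P.2 k • u ω P.1 k)
        (∑ l ∈ L P.2, weightRight δ r ω P.1 P.2 l • v ω P.2 l) := by
  simp only [goodPairSum, bilin_weighted_sum, chiGood_small]

lemma goodPairSum_of_le (ω : GridParam n) {P : ℤ × ℤ} (h : P.2 ≤ P.1) :
    goodPairSum δ r B K L u v ω P =
      B (∑ k ∈ K P.1, chiGood δ r ω (P.1, k) • u ω P.1 k) (∑ l ∈ L P.2, v ω P.2 l) := by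
  simp only [goodPairSum_eq, weightLeft, weightRight, h, if_true, one_smul]

lemma goodPairSum_of_lt (ω : GridParam n) {P : ℤ × ℤ} (h : P.1 < P.2) :
    goodPairSum δ r B K L u v ω P =
      B (∑ k ∈ K P.1, u ω P.1 k) (∑ l ∈ L P.2, chiGood δ r ω (P.2, l) • v ω P.2 l) := by
  simp only [goodPairSum_eq, weightLeft, weightRight, h.not_ge, if_false, one_smul]

lemma norm_goodPairSum_le (hu : IsGridDecomp K a u x) (hv : IsGridDecomp L c v y)
    (ω : GridParam n) (P : ℤ × ℤ) :
    ‖goodPairSum δ r B K L u v ω P‖ ≤ ‖B‖ * (a P.1 * c P.2) := by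
  rw [goodPairSum_eq]
  exact norm_bilin_le B
    (hu.norm_weighted_sum_le ω P.1 _ (norm_weightLeft_le δ r ω P.1 P.2))
    (hv.norm_weighted_sum_le ω P.2 _ (norm_weightRight_le δ r ω P.1 P.2))

lemma summable_norm_goodPairSum_bound (hu : IsGridDecomp K a u x) (hv : IsGridDecomp L c v y) :
    Summable fun P : ℤ × ℤ => ‖B‖ * (a P.1 * c P.2) :=
  (hu.summable.mul_of_nonneg hv.summable hu.nonneg hv.nonneg).mul_left _

lemma summable_goodPairSum (hu : IsGridDecomp K a u x) (hv : IsGridDecomp L c v y)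
    (ω : GridParam n) : Summable (goodPairSum δ r B K L u v ω) :=
  .of_norm_bounded (summable_norm_goodPairSum_bound B hu hv) (norm_goodPairSum_le δ r B hu hv ω)

lemma stronglyMeasurable_goodPairSum (hu : IsGridDecomp K a u x) (hv : IsGridDecomp L c v y)
    (P : ℤ × ℤ) : StronglyMeasurable fun ω => goodPairSum δ r B K L u v ω P :=
  Finset.stronglyMeasurable_fun_sum _ fun k _ => Finset.stronglyMeasurable_fun_sum _ fun l _ =>
    (measurable_chiGood δ r _).stronglyMeasurable.mul
      (stronglyMeasurable_bilin B (hu.stronglyMeasurable P.1 k) (hv.stronglyMeasurable P.2 l))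

lemma integral_goodPairSum (hu : IsGridDecomp K a u x) (hv : IsGridDecomp L c v y) (P : ℤ × ℤ) :
    ∫ ω, goodPairSum δ r B K L u v ω P ∂gridMeasure n =
      ∫ ω, B (∑ k ∈ K P.1, chiGood δ r ω (P.1, k) • u ω P.1 k) (∑ l ∈ L P.2, v ω P.2 l)
          ∂gridMeasure n +
        ∫ ω, B (∑ k ∈ K P.1, u ω P.1 k) (∑ l ∈ L P.2, chiGood δ r ω (P.2, l) • v ω P.2 l)
          ∂gridMeasure n -
        piGood n δ r * ∫ ω, B (∑ k ∈ K P.1, u ω P.1 k) (∑ l ∈ L P.2, v ω P.2 l)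
          ∂gridMeasure n := by
  rcases le_or_gt P.2 P.1 with h | h
  · have hright := hv.integral_good_sum δ r B.flip P.2 (hu.stronglyMeasurable_sum P.1)
      (hu.dependsOn_sum h) fun ω => hu.norm_sum_le ω P.1
    simp only [ContinuousLinearMap.flip_apply] at hright
    simp only [goodPairSum_of_le δ r B _ h, hright, add_sub_cancel_right]
  · have hleft := hu.integral_good_sum δ r B P.1 (hv.stronglyMeasurable_sum P.2)
      (hv.dependsOn_sum h.le) fun ω => hv.norm_sum_le ω P.2
    simp only [goodPairSum_of_lt δ r B _ h, hleft, add_sub_cancel_left]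

theorem hasSum_integral_goodPairSum (hu : IsGridDecomp K a u x) (hv : IsGridDecomp L c v y) :
    HasSum (fun P : ℤ × ℤ => ∫ ω, goodPairSum δ r B K L u v ω P ∂gridMeasure n)
      (piGood n δ r * B x y) := by
  have hleft := hu.hasSum_integral_good_left δ r B hv
  have hright := (Equiv.prodComm ℤ ℤ).hasSum_iff.2 (hv.hasSum_integral_good_left δ r B.flip hu)
  have hall := (hu.hasSum_integral_all B hv).mul_left (piGood n δ r : ℂ)
  have hsum := (hleft.add hright).sub hall
  rw [ContinuousLinearMap.flip_apply, add_sub_cancel_right] at hsum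
  exact hsum.congr_fun fun P => integral_goodPairSum δ r B hu hv P

theorem integral_tsum_goodPairSum (hu : IsGridDecomp K a u x) (hv : IsGridDecomp L c v y) :
    ∫ ω, ∑' P : ℤ × ℤ, goodPairSum δ r B K L u v ω P ∂gridMeasure n = piGood n δ r * B x y :=
  (hasSum_integral_of_summable_bound (stronglyMeasurable_goodPairSum δ r B hu hv)
    (fun P ω => norm_goodPairSum_le δ r B hu hv ω P) (summable_norm_goodPairSum_bound B hu hv)
    fun ω => (summable_goodPairSum δ r B hu hv ω).hasSum).unique
      (hasSum_integral_goodPairSum δ r B hu hv)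

end OneParam

/-! ### Pseudo-accretive functions of one variable -/

lemma measurableSet_cube {n : ℕ} (a : E n) (s : ℝ) : MeasurableSet (cube a s) := by
  have h : cube a s = ⋂ j, ({x : E n | a j ≤ x j} ∩ {x | x j < a j + s}) := by
    ext x
    simp only [cube, Set.mem_ofPred_eq, Set.mem_iInter, Set.mem_inter_iff]
  rw [h]
  have hc : ∀ j, Measurable fun x : E n => x j := fun j => by fun_prop
  exact MeasurableSet.iInter fun j => (measurableSet_le measurable_const (hc j)).inter
    (measurableSet_lt (hc j) measurable_const)

lemma volume_cube {n : ℕ} (a : E n) (s : ℝ) : volume (cube a s) = ENNReal.ofReal s ^ n := by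
  have h : cube a s = WithLp.ofLp ⁻¹' (Set.univ.pi fun j => Set.Ico (a j) (a j + s)) := by
    ext x
    simp [cube, Set.mem_pi]
  rw [h, (PiLp.volume_preserving_ofLp (Fin n)).measure_preimage
    (MeasurableSet.univ_pi fun _ => measurableSet_Ico).nullMeasurableSet, Real.volume_pi_Ico]
  simp

lemma volume_real_cube {n : ℕ} (a : E n) {s : ℝ} (hs : 0 ≤ s) : volume.real (cube a s) = s ^ n := by
  rw [measureReal_def, volume_cube, ENNReal.toReal_pow, ENNReal.toReal_ofReal hs]

lemma volume_cube_lt_top {n : ℕ} (a : E n) (s : ℝ) : volume (cube a s) < ∞ := by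
  rw [volume_cube]
  exact ENNReal.pow_lt_top ENNReal.ofReal_lt_top

/-- Functions of one variable bounded by `β`, whose averages over cubes are at least `κ` in
absolute value: the one-parameter pseudo-accretivity condition, with its constants. -/
structure IsAccretive {n : ℕ} (b : E n → ℂ) (β κ : ℝ) : Prop where
  aestronglyMeasurable : AEStronglyMeasurable b volume
  ae_norm_le : ∀ᵐ x, ‖b x‖ ≤ β
  le_norm_integral : ∀ (a : E n) (s : ℝ), 0 < s → κ * s ^ n ≤ ‖∫ x in cube a s, b x‖
  bound_pos : 0 < β
  lower_pos : 0 < κ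

lemma exists_pos_ae_norm_le {α F : Type*} [MeasurableSpace α] [NormedAddCommGroup F]
    {μ : Measure α} {b : α → F} (hb : MemLp b ∞ μ) : ∃ β : ℝ, 0 < β ∧ ∀ᵐ x ∂μ, ‖b x‖ ≤ β := by
  refine ⟨max (eLpNorm b ∞ μ).toReal 1, by positivity, ?_⟩
  have h : ∀ᵐ x ∂μ, ‖b x‖ₑ ≤ eLpNorm b ∞ μ := by
    rw [eLpNorm_exponent_top]
    exact ae_le_eLpNormEssSup
  filter_upwards [h] with x hx
  rw [← toReal_enorm]
  exact (ENNReal.toReal_mono hb.2.ne hx).trans (le_max_left _ _)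

lemma norm_integral_cube_le {n : ℕ} {b : E n → ℂ} {β : ℝ} (hb : ∀ᵐ x, ‖b x‖ ≤ β) (a : E n) {s : ℝ}
    (hs : 0 ≤ s) : ‖∫ x in cube a s, b x‖ ≤ β * s ^ n := by
  rw [← volume_real_cube a hs]
  exact norm_setIntegral_le_of_norm_le_const_ae' (volume_cube_lt_top a s)
    (hb.mono fun x hx _ => hx)

lemma IsPseudoAccretive.exists_lt_norm_integral_mul {n m : ℕ} {b₁ : E n → ℂ} {b₂ : E m → ℂ}
    (hb : IsPseudoAccretive (tensor b₁ b₂)) :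
    ∃ C : ℝ, 0 < C ∧ ∀ (a : E n) (s : ℝ) (a' : E m) (s' : ℝ), 0 < s → 0 < s' →
      C * (s ^ n * s' ^ m) < ‖∫ x in cube a s, b₁ x‖ * ‖∫ x in cube a' s', b₂ x‖ := by
  obtain ⟨-, C, hC, h⟩ := hb
  refine ⟨C, hC, fun a s a' s' hs hs' => ?_⟩
  have h_prod : ∫ x in cube a s ×ˢ cube a' s', tensor b₁ b₂ x =
      (∫ x in cube a s, b₁ x) * ∫ x in cube a' s', b₂ x :=
    setIntegral_prod_mul b₁ b₂ (cube a s) (cube a' s')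
  have h_avg := h a s a' s' hs hs'
  rwa [h_prod, norm_mul, Measure.volume_eq_prod, Measure.prod_prod, volume_cube, volume_cube,
    ENNReal.toReal_mul, ENNReal.toReal_pow, ENNReal.toReal_pow, ENNReal.toReal_ofReal hs.le,
    ENNReal.toReal_ofReal hs'.le, lt_div_iff₀ (by positivity)] at h_avg

-- Testing on rectangles with one side a unit cube isolates each of the two factors.
lemma IsPseudoAccretive.exists_isAccretive {n m : ℕ} {b₁ : E n → ℂ} {b₂ : E m → ℂ}
    (hb : IsPseudoAccretive (tensor b₁ b₂)) (hb₁ : MemLp b₁ ∞ volume) (hb₂ : MemLp b₂ ∞ volume) :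
    (∃ β κ, IsAccretive b₁ β κ) ∧ ∃ β κ, IsAccretive b₂ β κ := by
  obtain ⟨C, hC, h⟩ := hb.exists_lt_norm_integral_mul
  obtain ⟨β₁, hβ₁, h₁⟩ := exists_pos_ae_norm_le hb₁
  obtain ⟨β₂, hβ₂, h₂⟩ := exists_pos_ae_norm_le hb₂
  refine ⟨⟨β₁, C / β₂, hb₁.1, h₁, fun a s hs => ?_, hβ₁, by positivity⟩,
    ⟨β₂, C / β₁, hb₂.1, h₂, fun a s hs => ?_, hβ₂, by positivity⟩⟩
  · have h_lower := h a s 0 1 hs one_pos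
    have h_upper := norm_integral_cube_le h₂ 0 zero_le_one
    rw [one_pow, mul_one] at h_lower h_upper
    rw [div_mul_eq_mul_div, div_le_iff₀ hβ₂]
    exact h_lower.le.trans (mul_le_mul_of_nonneg_left h_upper (norm_nonneg _))
  · have h_lower := h 0 1 a s one_pos hs
    have h_upper := norm_integral_cube_le h₁ 0 zero_le_one
    rw [one_pow, one_mul] at h_lower
    rw [one_pow, mul_one] at h_upper
    rw [div_mul_eq_mul_div, div_le_iff₀ hβ₁, mul_comm ‖_‖]
    exact h_lower.le.trans (mul_le_mul_of_nonneg_right h_upper (norm_nonneg _))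

section OneVariable

variable {n : ℕ} {b : E n → ℂ} {β κ : ℝ}

lemma measurableSet_gridCube (ω : GridParam n) (I : CubeLabel n) :
    MeasurableSet (gridCube ω I) := by
  rw [gridCube_eq_cube]
  exact measurableSet_cube _ _

lemma volume_gridCube_lt_top (ω : GridParam n) (I : CubeLabel n) :
    volume (gridCube ω I) < ∞ := by
  rw [gridCube_eq_cube]
  exact volume_cube_lt_top _ _

lemma volume_real_gridCube (ω : GridParam n) (I : CubeLabel n) :
    volume.real (gridCube ω I) = side I ^ n := by
  rw [gridCube_eq_cube]
  exact volume_real_cube _ (side_pos I).le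

lemma norm_le_of_abs_apply_le {x : E n} {t : ℝ} (ht : 0 ≤ t) (h : ∀ j, |x j| ≤ t) :
    ‖x‖ ≤ n * t := by
  rw [EuclideanSpace.norm_eq]
  refine Real.sqrt_le_iff.2 ⟨by positivity, ?_⟩
  calc ∑ i, ‖x i‖ ^ 2 ≤ ∑ _i : Fin n, t ^ 2 :=
        Finset.sum_le_sum fun i _ => pow_le_pow_left₀ (norm_nonneg _) (h i) 2
    _ = n * t ^ 2 := by simp
    _ ≤ (n * t) ^ 2 := by
      rw [mul_pow]
      refine mul_le_mul_of_nonneg_right ?_ (by positivity)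
      exact_mod_cast Nat.le_self_pow two_ne_zero n

lemma norm_sub_le_of_mem_gridCube {ω : GridParam n} {I : CubeLabel n} {x y : E n}
    (hx : x ∈ gridCube ω I) (hy : y ∈ gridCube ω I) : ‖x - y‖ ≤ n * side I := by
  rw [gridCube_eq_cube] at hx hy
  refine norm_le_of_abs_apply_le (side_pos I).le fun j => ?_
  obtain ⟨hx₁, hx₂⟩ := hx j
  obtain ⟨hy₁, hy₂⟩ := hy j
  rw [PiLp.sub_apply, abs_le]
  constructor <;> linarith

lemma IsAccretive.le_norm_integral_gridCube (hb : IsAccretive b β κ) (ω : GridParam n)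
    (I : CubeLabel n) : κ * side I ^ n ≤ ‖∫ x in gridCube ω I, b x‖ := by
  rw [gridCube_eq_cube]
  exact hb.le_norm_integral _ _ (side_pos I)

lemma IsAccretive.integral_gridCube_ne_zero (hb : IsAccretive b β κ) (ω : GridParam n)
    (I : CubeLabel n) : ∫ x in gridCube ω I, b x ≠ 0 :=
  norm_pos_iff.1 <| (mul_pos hb.lower_pos (pow_pos (side_pos I) n)).trans_le
    (hb.le_norm_integral_gridCube ω I)

lemma IsAccretive.integrableOn_gridCube (hb : IsAccretive b β κ) (ω : GridParam n)
    (I : CubeLabel n) : IntegrableOn b (gridCube ω I) :=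
  IntegrableOn.of_bound (volume_gridCube_lt_top ω I) hb.aestronglyMeasurable.restrict β
    (ae_restrict_of_ae hb.ae_norm_le)

/-! ### Adapted expectations and martingale differences at one scale -/

lemma expect_eq (b : E n → ℂ) (ω : GridParam n) (p : ℤ) (h : E n → ℂ) (x : E n) :
    expect b ω p h x = (∫ y in gridCube ω (p, cubeIndex ω p x), h y * b y) /
      ∫ y in gridCube ω (p, cubeIndex ω p x), b y := by
  unfold expect
  rw [tsum_eq_single (cubeIndex ω p x), Set.indicator_of_mem (mem_gridCube_cubeIndex ω p x)]
  intro k hk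
  exact Set.indicator_of_notMem (fun hx => hk (mem_gridCube_iff.1 hx).symm) _

/-- The martingale difference `E_{p+1}^b h - E_p^b h`, i.e. the sum of all `Δ_I^b h` with
`I ∈ 𝒟_p`. -/
def mdiff (b : E n → ℂ) (ω : GridParam n) (p : ℤ) (h : E n → ℂ) (x : E n) : ℂ :=
  expect b ω (p + 1) h x - expect b ω p h x

lemma delta_eq_indicator (b : E n → ℂ) (ω : GridParam n) (I : CubeLabel n) (h : E n → ℂ) :
    delta b ω I h = (gridCube ω I).indicator (mdiff b ω I.1 h) := rfl

lemma mdiff_zero (b : E n → ℂ) (ω : GridParam n) (p : ℤ) (x : E n) :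
    mdiff b ω p (fun _ => 0) x = 0 := by
  simp only [mdiff, expect_eq, zero_mul, integral_zero, zero_div, sub_self]

lemma dependsOn_cubeIndex (p : ℤ) : DependsOn (fun ω : GridParam n => cubeIndex ω p) (Set.Ioi p) :=
  fun ω ω' h => by
    ext x j
    simp only [cubeIndex, dependsOn_gridShift p h]

lemma dependsOn_gridCube (I : CubeLabel n) :
    DependsOn (fun ω : GridParam n => gridCube ω I) (Set.Ioi I.1) := fun ω ω' h => by
  simp only [gridCube, dependsOn_gridShift I.1 h]

lemma dependsOn_expect (b : E n → ℂ) (p : ℤ) : DependsOn (fun ω => expect b ω p) (Set.Ioi p) :=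
  fun ω ω' h => by
    ext f x
    simp only [expect_eq, dependsOn_cubeIndex p h, dependsOn_gridCube (p, _) h]

lemma dependsOn_mdiff (b : E n → ℂ) (p : ℤ) : DependsOn (fun ω => mdiff b ω p) (Set.Ioi p) :=
  fun ω ω' h => by
    have h_succ := dependsOn_expect b (p + 1) fun i hi => h i (Set.Ioi_subset_Ioi (by lia) hi)
    ext f x
    simp only [mdiff, dependsOn_expect b p h, h_succ]

/-- Functions bounded by `M`, with Hölder-`1/2` constant `M`, vanishing outside the ball of
radius `R`. The exponent `1/2` is what remains in each variable when the Lipschitz continuity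
of a function of two variables is split between them. -/
structure IsTame {n : ℕ} (M R : ℝ) (h : E n → ℂ) : Prop where
  norm_le : ∀ x, ‖h x‖ ≤ M
  norm_sub_le : ∀ x y, ‖h x - h y‖ ≤ M * √‖x - y‖
  eq_zero : ∀ x, R < ‖x‖ → h x = 0

variable {M R : ℝ} {h : E n → ℂ}

lemma IsTame.nonneg (hh : IsTame M R h) : 0 ≤ M := (norm_nonneg _).trans (hh.norm_le 0)

open Filter Topology in
lemma IsTame.continuous (hh : IsTame M R h) : Continuous h := by
  refine continuous_iff_continuousAt.2 fun x => tendsto_iff_norm_sub_tendsto_zero.2 ?_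
  refine squeeze_zero (fun _ => norm_nonneg _) (fun y => hh.norm_sub_le y x) ?_
  have hc : Continuous fun y : E n => M * √‖y - x‖ := by fun_prop
  simpa using hc.tendsto x

lemma IsAccretive.integrableOn_mul (hb : IsAccretive b β κ) (hh : IsTame M R h) (ω : GridParam n)
    (I : CubeLabel n) : IntegrableOn (fun y => h y * b y) (gridCube ω I) :=
  (hb.integrableOn_gridCube ω I).bdd_mul hh.continuous.aestronglyMeasurable
    (ae_of_all _ hh.norm_le)

lemma expect_sub (hb : IsAccretive b β κ) {M' R' : ℝ} {h' : E n → ℂ} (hh : IsTame M R h)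
    (hh' : IsTame M' R' h') (ω : GridParam n) (p : ℤ) (x : E n) :
    expect b ω p (fun z => h z - h' z) x = expect b ω p h x - expect b ω p h' x := by
  simp only [expect_eq, sub_mul]
  rw [integral_sub (hb.integrableOn_mul hh ω _) (hb.integrableOn_mul hh' ω _), sub_div]

lemma mdiff_sub (hb : IsAccretive b β κ) {M' R' : ℝ} {h' : E n → ℂ} (hh : IsTame M R h)
    (hh' : IsTame M' R' h') (ω : GridParam n) (p : ℤ) (x : E n) :
    mdiff b ω p (fun z => h z - h' z) x = mdiff b ω p h x - mdiff b ω p h' x := by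
  simp only [mdiff, expect_sub hb hh hh']
  ring

lemma norm_div_integral_gridCube_le (hb : IsAccretive b β κ) (ω : GridParam n) (I : CubeLabel n)
    {z : ℂ} {t : ℝ} (hz : ‖z‖ ≤ t * side I ^ n) : ‖z / ∫ y in gridCube ω I, b y‖ ≤ t / κ := by
  have hκ := hb.lower_pos
  have hs : 0 < side I ^ n := pow_pos (side_pos I) n
  rw [norm_div]
  refine (div_le_div₀ ((norm_nonneg z).trans hz) hz (by positivity)
    (hb.le_norm_integral_gridCube ω I)).trans_eq ?_
  field_simp

lemma norm_expect_sub_le (hb : IsAccretive b β κ) (hh : IsTame M R h) (ω : GridParam n) (p : ℤ)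
    (x : E n) : ‖expect b ω p h x - h x‖ ≤ M * (β / κ * (√n * √(2 ^ (-p)))) := by
  set I : CubeLabel n := (p, cubeIndex ω p x)
  have hx : x ∈ gridCube ω I := mem_gridCube_cubeIndex ω p x
  have hM := hh.nonneg
  have := hb.bound_pos
  have h_eq : expect b ω p h x - h x = (∫ y in gridCube ω I, (h y - h x) * b y) /
      ∫ y in gridCube ω I, b y := by
    rw [expect_eq]
    simp only [sub_mul]
    rw [integral_sub (hb.integrableOn_mul hh ω _) ((hb.integrableOn_gridCube ω _).const_mul _),
      integral_const_mul, sub_div, mul_div_cancel_right₀ _ (hb.integral_gridCube_ne_zero ω I)]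
  have h_osc : ‖∫ y in gridCube ω I, (h y - h x) * b y‖ ≤ M * √(n * side I) * β * side I ^ n := by
    rw [← volume_real_gridCube ω I]
    refine norm_setIntegral_le_of_norm_le_const_ae' (volume_gridCube_lt_top ω I)
      (hb.ae_norm_le.mono fun y hy hyI => ?_)
    rw [norm_mul]
    refine mul_le_mul ((hh.norm_sub_le y x).trans ?_) hy (norm_nonneg _) (by positivity)
    gcongr
    exact norm_sub_le_of_mem_gridCube hyI hx
  rw [h_eq]
  refine (norm_div_integral_gridCube_le hb ω I h_osc).trans_eq ?_
  rw [Real.sqrt_mul (Nat.cast_nonneg n)]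
  change M * (√n * √(2 ^ (-p))) * β / κ = _
  ring

lemma norm_setIntegral_mul_le (hb : IsAccretive b β κ) (hh : IsTame M R h) {A : Set (E n)}
    (hA : MeasurableSet A) :
    ‖∫ y in A, h y * b y‖ ≤ M * β * volume.real (Metric.closedBall (0 : E n) R) := by
  have hM := hh.nonneg
  have hβ := hb.bound_pos
  have h_restrict : ∫ y in A, h y * b y = ∫ y in A ∩ Metric.closedBall 0 R, h y * b y := by
    refine setIntegral_eq_of_subset_of_forall_sdiff_eq_zero hA Set.inter_subset_left
      fun y hy => ?_
    rw [hh.eq_zero y (not_le.1 fun hle => hy.2 ⟨hy.1, mem_closedBall_zero_iff.2 hle⟩), zero_mul]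
  rw [h_restrict]
  refine (norm_setIntegral_le_of_norm_le_const_ae' (C := M * β)
    ((measure_mono Set.inter_subset_right).trans_lt measure_closedBall_lt_top)
    (hb.ae_norm_le.mono fun y hy _ => ?_)).trans ?_
  · rw [norm_mul]
    exact mul_le_mul (hh.norm_le y) hy (norm_nonneg _) hM
  · gcongr
    exacts [measure_closedBall_lt_top.ne, Set.inter_subset_right]

lemma norm_expect_le (hb : IsAccretive b β κ) (hh : IsTame M R h) (ω : GridParam n) (p : ℤ)
    (x : E n) : ‖expect b ω p h x‖ ≤
      M * (β / κ * volume.real (Metric.closedBall (0 : E n) R) * (2 ^ p) ^ n) := by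
  set I : CubeLabel n := (p, cubeIndex ω p x)
  have hs : side I ^ n ≠ 0 := (pow_pos (side_pos I) n).ne'
  rw [expect_eq]
  refine (norm_div_integral_gridCube_le hb ω I ((norm_setIntegral_mul_le hb hh
    (measurableSet_gridCube ω I)).trans_eq (div_mul_cancel₀ _ hs).symm)).trans_eq ?_
  have h_side : (2 : ℝ) ^ p = (side I)⁻¹ := by rw [side, zpow_neg, inv_inv]
  rw [h_side, inv_pow]
  ring

lemma norm_le_of_expect_ne_zero (hsupp : ∀ x, R < ‖x‖ → h x = 0) {ω : GridParam n} {p : ℤ}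
    {x : E n} (hx : expect b ω p h x ≠ 0) : ‖x‖ ≤ R + n * 2 ^ (-p) := by
  contrapose! hx
  rw [expect_eq, setIntegral_eq_zero_of_forall_eq_zero, zero_div]
  intro y hy
  have h_near : ‖x - y‖ ≤ n * 2 ^ (-p) :=
    norm_sub_le_of_mem_gridCube (mem_gridCube_cubeIndex ω p x) hy
  have h_tri := norm_le_norm_add_norm_sub' x y
  rw [hsupp y (by linarith), zero_mul]

lemma norm_le_of_mdiff_ne_zero (hsupp : ∀ x, R < ‖x‖ → h x = 0) {ω : GridParam n} {p : ℤ}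
    {x : E n} (hx : mdiff b ω p h x ≠ 0) : ‖x‖ ≤ R + n * 2 ^ (-p) := by
  by_cases h0 : expect b ω p h x = 0
  · have h1 : expect b ω (p + 1) h x ≠ 0 := by simpa only [mdiff, h0, sub_zero] using hx
    refine (norm_le_of_expect_ne_zero hsupp h1).trans ?_
    gcongr
    exacts [one_le_two, by lia]
  · exact norm_le_of_expect_ne_zero hsupp h0

/-- A finite set containing the positions of all cubes of scale `p`, in any shifted grid, that
meet the ball of radius `R + n 2^{-p}`. -/
def posSet (n : ℕ) (R : ℝ) (p : ℤ) : Finset (Fin n → ℤ) :=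
  Fintype.piFinset fun _ => Finset.Icc (-(⌈2 ^ p * R + n⌉ + 2)) (⌈2 ^ p * R + n⌉ + 2)

lemma cubeIndex_mem_posSet {ω : GridParam n} {p : ℤ} {x : E n} (hx : ‖x‖ ≤ R + n * 2 ^ (-p)) :
    cubeIndex ω p x ∈ posSet n R p := by
  refine Fintype.mem_piFinset.2 fun j => Finset.mem_Icc.2 ?_
  have h_pos : (0 : ℝ) < 2 ^ p := by positivity
  have h_inv : (2 : ℝ) ^ p * 2 ^ (-p) = 1 := by rw [← zpow_add₀ two_ne_zero]; simp
  have h_coord : |2 ^ p * x j| ≤ 2 ^ p * R + n := by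
    rw [abs_mul, abs_of_pos h_pos]
    calc 2 ^ p * |x j| ≤ 2 ^ p * (R + n * 2 ^ (-p)) :=
          mul_le_mul_of_nonneg_left ((PiLp.norm_apply_le x j).trans hx) h_pos.le
      _ = 2 ^ p * R + n * (2 ^ p * 2 ^ (-p)) := by ring
      _ = 2 ^ p * R + n := by rw [h_inv, mul_one]
  have h_shift_le : 2 ^ p * gridShift ω p j ≤ 1 := by
    rw [← h_inv]
    exact mul_le_mul_of_nonneg_left (gridShift_le ω p j) h_pos.le
  have h_shift_nonneg : 0 ≤ 2 ^ p * gridShift ω p j :=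
    mul_nonneg h_pos.le (gridShift_nonneg ω p j)
  have h_ceil := Int.le_ceil ((2 : ℝ) ^ p * R + n)
  obtain ⟨h_lower, h_upper⟩ := abs_le.1 h_coord
  rw [cubeIndex, mul_sub]
  refine ⟨Int.le_floor.2 ?_, Int.floor_le_iff.2 ?_⟩ <;> push_cast <;> linarith

lemma cubeIndex_mem_posSet_of_mdiff_ne_zero (hsupp : ∀ x, R < ‖x‖ → h x = 0) {ω : GridParam n}
    {p : ℤ} {x : E n} (hx : mdiff b ω p h x ≠ 0) : cubeIndex ω p x ∈ posSet n R p :=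
  cubeIndex_mem_posSet (norm_le_of_mdiff_ne_zero hsupp hx)

lemma delta_eq_zero (hsupp : ∀ x, R < ‖x‖ → h x = 0) {ω : GridParam n} {I : CubeLabel n}
    (hI : I.2 ∉ posSet n R I.1) (x : E n) : delta b ω I h x = 0 := by
  rw [delta_eq_indicator, Set.indicator_apply_eq_zero]
  intro hx
  contrapose! hI
  have h_index : cubeIndex ω I.1 x = I.2 := mem_gridCube_iff.1 hx
  exact h_index ▸ cubeIndex_mem_posSet_of_mdiff_ne_zero hsupp hI

lemma sum_delta (hsupp : ∀ x, R < ‖x‖ → h x = 0) (ω : GridParam n) (p : ℤ) (x : E n) :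
    ∑ k ∈ posSet n R p, delta b ω (p, k) h x = mdiff b ω p h x := by
  classical
  simp only [delta_eq_indicator, Set.indicator_apply, mem_gridCube_iff, Finset.sum_ite_eq]
  refine ite_eq_left_iff.2 fun h_index => ?_
  contrapose! h_index
  exact cubeIndex_mem_posSet_of_mdiff_ne_zero hsupp h_index.symm

/-! ### Decay of the martingale differences -/

/-- The decay rate of martingale differences of tame functions at scale `p`: `2^{-p/2}` for
small cubes, by continuity, and `2^{np}` for large cubes, by the size of the cubes. -/
def rate (n : ℕ) (p : ℤ) : ℝ := min √(2 ^ (-p)) ((2 ^ p) ^ n)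

/-- A radius outside which martingale differences at scale `p` vanish. -/
def radius (n : ℕ) (R : ℝ) (p : ℤ) : ℝ := (R + n) * max 1 (2 ^ (-p))

/-- A function of the form `C · rate` on a ball, which dominates the martingale differences of
tame functions at scale `p` in every grid. -/
def profile (n : ℕ) (C R : ℝ) (p : ℤ) : E n → ℝ :=
  (Metric.closedBall 0 (radius n R p)).indicator fun _ => C * rate n p

/-- The constant `C` in `profile` for an accretive function with constants `β` and `κ`. -/
def decayConst (n : ℕ) (β κ R : ℝ) : ℝ :=
  β / κ * (2 * √n + volume.real (Metric.closedBall (0 : E n) R) * (2 ^ n + 1))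

lemma rate_nonneg (n : ℕ) (p : ℤ) : 0 ≤ rate n p := by
  unfold rate
  positivity

lemma profile_nonneg {C : ℝ} (hC : 0 ≤ C) (R : ℝ) (p : ℤ) (x : E n) : 0 ≤ profile n C R p x :=
  Set.indicator_nonneg (fun _ _ => mul_nonneg hC (rate_nonneg n p)) x

lemma IsAccretive.decayConst_nonneg (hb : IsAccretive b β κ) (R : ℝ) :
    0 ≤ decayConst n β κ R := by
  have := hb.bound_pos
  have := hb.lower_pos
  unfold decayConst
  positivity

lemma norm_mdiff_le_sqrt (hb : IsAccretive b β κ) (hh : IsTame M R h) (ω : GridParam n) (p : ℤ)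
    (x : E n) : ‖mdiff b ω p h x‖ ≤ M * (β / κ * (2 * √n) * √(2 ^ (-p))) := by
  have hβ := hb.bound_pos
  have hκ := hb.lower_pos
  have hM := hh.nonneg
  have h_mono : M * (β / κ * (√n * √(2 ^ (-(p + 1))))) ≤ M * (β / κ * (√n * √(2 ^ (-p)))) := by
    gcongr
    exacts [one_le_two, by lia]
  calc ‖mdiff b ω p h x‖ = ‖(expect b ω (p + 1) h x - h x) - (expect b ω p h x - h x)‖ := by
        rw [mdiff, sub_sub_sub_cancel_right]
    _ ≤ M * (β / κ * (√n * √(2 ^ (-p)))) + M * (β / κ * (√n * √(2 ^ (-p)))) :=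
        (norm_sub_le _ _).trans (add_le_add ((norm_expect_sub_le hb hh ω (p + 1) x).trans h_mono)
          (norm_expect_sub_le hb hh ω p x))
    _ = M * (β / κ * (2 * √n) * √(2 ^ (-p))) := by ring

lemma norm_mdiff_le_pow (hb : IsAccretive b β κ) (hh : IsTame M R h) (ω : GridParam n) (p : ℤ)
    (x : E n) : ‖mdiff b ω p h x‖ ≤
      M * (β / κ * (volume.real (Metric.closedBall (0 : E n) R) * (2 ^ n + 1)) * (2 ^ p) ^ n) := by
  refine (norm_sub_le _ _).trans ((add_le_add (norm_expect_le hb hh ω (p + 1) x)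
    (norm_expect_le hb hh ω p x)).trans_eq ?_)
  rw [zpow_add₀ two_ne_zero, zpow_one, mul_pow]
  ring

lemma norm_mdiff_le_rate (hb : IsAccretive b β κ) (hh : IsTame M R h) (ω : GridParam n) (p : ℤ)
    (x : E n) : ‖mdiff b ω p h x‖ ≤ M * (decayConst n β κ R * rate n p) := by
  have hβ := hb.bound_pos
  have hκ := hb.lower_pos
  have hM := hh.nonneg
  rw [rate, mul_min_of_nonneg _ _ (hb.decayConst_nonneg R), mul_min_of_nonneg _ _ hM, decayConst]
  refine le_min ((norm_mdiff_le_sqrt hb hh ω p x).trans ?_)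
    ((norm_mdiff_le_pow hb hh ω p x).trans ?_)
  all_goals
    gcongr
    simp only [le_add_iff_nonneg_right, le_add_iff_nonneg_left]
    positivity

lemma norm_le_radius_of_mdiff_ne_zero (hR : 0 ≤ R) (hsupp : ∀ x, R < ‖x‖ → h x = 0)
    {ω : GridParam n} {p : ℤ} {x : E n} (hx : mdiff b ω p h x ≠ 0) : ‖x‖ ≤ radius n R p := by
  refine (norm_le_of_mdiff_ne_zero hsupp hx).trans ?_
  rw [radius, add_mul]
  gcongr
  exacts [le_mul_of_one_le_right hR (le_max_left _ _), le_max_right _ _]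

lemma norm_mdiff_le (hb : IsAccretive b β κ) (hR : 0 ≤ R) (hh : IsTame M R h) (ω : GridParam n)
    (p : ℤ) (x : E n) :
    ‖mdiff b ω p h x‖ ≤ M * profile n (decayConst n β κ R) R p x := by
  by_cases h0 : mdiff b ω p h x = 0
  · rw [h0, norm_zero]
    exact mul_nonneg hh.nonneg (profile_nonneg (hb.decayConst_nonneg R) R p x)
  · rw [profile, Set.indicator_of_mem (mem_closedBall_zero_iff.2
      (norm_le_radius_of_mdiff_ne_zero hR hh.eq_zero h0))]
    exact norm_mdiff_le_rate hb hh ω p x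

lemma memLp_profile (n : ℕ) (C R : ℝ) (p : ℤ) : MemLp (profile n C R p) 2 volume :=
  memLp_indicator_const 2 Metric.isClosed_closedBall.measurableSet _
    (Or.inr measure_closedBall_lt_top.ne)

lemma summable_pow_natAbs {q : ℝ} (h0 : 0 ≤ q) (h1 : q < 1) :
    Summable fun p : ℤ => q ^ p.natAbs := by
  rw [summable_int_iff_summable_nat_and_neg]
  simp only [Int.natAbs_natCast, Int.natAbs_neg]
  exact ⟨summable_geometric_of_lt_one h0 h1, summable_geometric_of_lt_one h0 h1⟩

-- The square of the `L²` norm of `profile` is of the order of the left hand side.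
lemma rate_sq_mul_le (hn : 0 < n) (p : ℤ) :
    rate n p ^ 2 * max 1 (2 ^ (-p)) ^ n ≤ (1 / 2) ^ p.natAbs := by
  have h_zpow (k : ℕ) : (2 : ℝ) ^ (-(k : ℤ)) = (1 / 2) ^ k := by
    rw [zpow_neg, zpow_natCast, one_div, inv_pow]
  have h_le_one (k : ℕ) : (1 / 2 : ℝ) ^ k ≤ 1 := pow_le_one₀ (by norm_num) (by norm_num)
  obtain ⟨k, rfl | rfl⟩ := p.eq_nat_or_neg
  · rw [h_zpow, max_eq_left (h_le_one k), one_pow, mul_one, Int.natAbs_natCast]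
    calc rate n k ^ 2 ≤ √(2 ^ (-(k : ℤ))) ^ 2 :=
          pow_le_pow_left₀ (rate_nonneg n k) (min_le_left _ _) 2
      _ = (1 / 2) ^ k := by rw [Real.sq_sqrt (by positivity), h_zpow]
  · have h_rate : rate n (-k) ≤ ((1 / 2) ^ k) ^ n := h_zpow k ▸ min_le_right _ _
    have h_cancel : ((1 / 2 : ℝ) ^ k) ^ n * (2 ^ k) ^ n = 1 := by
      rw [← mul_pow, ← mul_pow]
      norm_num
    rw [neg_neg, zpow_natCast, max_eq_right (one_le_pow₀ one_le_two), Int.natAbs_neg,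
      Int.natAbs_natCast]
    calc rate n (-k) ^ 2 * (2 ^ k) ^ n ≤ (((1 / 2) ^ k) ^ n) ^ 2 * (2 ^ k) ^ n := by
          have := rate_nonneg n (-k)
          gcongr
      _ = ((1 / 2) ^ k) ^ n := by rw [sq, mul_assoc, h_cancel, mul_one]
      _ ≤ (1 / 2) ^ k := pow_le_of_le_one (by positivity) (h_le_one k) hn.ne'

lemma eLpNorm_profile {C : ℝ} (hC : 0 ≤ C) (hR : 0 ≤ R) (p : ℤ) :
    (eLpNorm (profile n C R p) 2 volume).toReal =
      C * √((R + n) ^ n * volume.real (Metric.ball (0 : E n) 1)) *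
        √(rate n p ^ 2 * max 1 (2 ^ (-p)) ^ n) := by
  have h_radius : 0 ≤ radius n R p := by
    unfold radius
    positivity
  have h_rate := rate_nonneg n p
  rw [profile, eLpNorm_indicator_const Metric.isClosed_closedBall.measurableSet two_ne_zero
    ENNReal.ofNat_ne_top, ENNReal.toReal_mul, ← ENNReal.toReal_rpow, toReal_enorm,
    Real.norm_of_nonneg (mul_nonneg hC h_rate), ENNReal.toReal_ofNat, ← Real.sqrt_eq_rpow,
    Measure.addHaar_closedBall _ _ h_radius, finrank_euclideanSpace_fin, ENNReal.toReal_mul,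
    ENNReal.toReal_ofReal (by positivity), ← measureReal_def, mul_assoc, mul_assoc,
    ← Real.sqrt_mul (by positivity)]
  nth_rewrite 1 [← Real.sqrt_sq h_rate]
  rw [← Real.sqrt_mul (sq_nonneg _), radius, mul_pow]
  congr 2
  ring

lemma summable_eLpNorm_profile (hn : 0 < n) {C : ℝ} (hC : 0 ≤ C) (hR : 0 ≤ R) :
    Summable fun p => (eLpNorm (profile n C R p) 2 volume).toReal := by
  have h_lt_one : √(1 / 2 : ℝ) < 1 := by rw [Real.sqrt_lt' one_pos]; norm_num
  simp only [eLpNorm_profile hC hR]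
  refine (Summable.of_nonneg_of_le (fun _ => Real.sqrt_nonneg _) (fun p => ?_)
    (summable_pow_natAbs (Real.sqrt_nonneg _) h_lt_one)).mul_left _
  refine Real.sqrt_le_iff.2 ⟨by positivity, (rate_sq_mul_le hn p).trans_eq ?_⟩
  rw [pow_right_comm, Real.sq_sqrt (by norm_num)]

open Filter Topology in
lemma tendsto_sum_mdiff (hn : 0 < n) (hb : IsAccretive b β κ) (hh : IsTame M R h)
    (ω : GridParam n) (x : E n) :
    Tendsto (fun N : ℕ => ∑ p ∈ Finset.Ico (-N : ℤ) N, mdiff b ω p h x) atTop (𝓝 (h x)) := by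
  have h_telescope (N : ℕ) : ∑ p ∈ Finset.Ico (-N : ℤ) N, mdiff b ω p h x =
      expect b ω N h x - expect b ω (-N) h x := by
    simpa only [mdiff, neg_sub_neg] using Finset.sum_Ico_int_sub N fun p => -expect b ω p h x
  simp only [h_telescope]
  have h_pow : Tendsto (fun N : ℕ => (2 : ℝ) ^ (-(N : ℤ))) atTop (𝓝 0) := by
    simp only [zpow_neg, zpow_natCast, ← inv_pow]
    exact tendsto_pow_atTop_nhds_zero_of_lt_one (by norm_num) (by norm_num)
  have h_fine : Tendsto (fun N : ℕ => expect b ω N h x) atTop (𝓝 (h x)) := by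
    rw [tendsto_iff_norm_sub_tendsto_zero]
    refine squeeze_zero (fun _ => norm_nonneg _) (fun N => norm_expect_sub_le hb hh ω N x) ?_
    simpa using (((h_pow.sqrt).const_mul √n).const_mul (β / κ)).const_mul M
  have h_coarse : Tendsto (fun N : ℕ => expect b ω (-N) h x) atTop (𝓝 0) := by
    rw [tendsto_zero_iff_norm_tendsto_zero]
    refine squeeze_zero (fun _ => norm_nonneg _) (fun N => norm_expect_le hb hh ω (-N) x) ?_
    simpa [hn.ne'] using ((h_pow.pow n).const_mul
      (β / κ * volume.real (Metric.closedBall (0 : E n) R))).const_mul M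
  simpa only [sub_zero] using h_fine.sub h_coarse

end OneVariable

section Regularity

open Filter Topology

variable {n : ℕ} {b : E n → ℂ} {β κ : ℝ}

/-! ### Regularity in the grid and in the point -/

/-- `x` lies on no face of a cube of side length `2^{-p}` of the grid with parameters `ω`. -/
def IsGeneric (ω : GridParam n) (p : ℤ) (x : E n) : Prop :=
  ∀ (j : Fin n) (m : ℤ), 2 ^ p * (x j - gridShift ω p j) ≠ m

lemma ae_isGeneric (ω : GridParam n) (p : ℤ) : ∀ᵐ x, IsGeneric ω p x := by
  refine ae_all_iff.2 fun j => ae_all_iff.2 fun m => ?_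
  have h_pow : (2 : ℝ) ^ p ≠ 0 := by positivity
  have h_hyperplane : {x : E n | ¬ 2 ^ p * (x j - gridShift ω p j) ≠ m} =
      WithLp.ofLp ⁻¹' {y : Fin n → ℝ | y j = (m : ℝ) / 2 ^ p + gridShift ω p j} := by
    ext x
    simp only [Set.mem_ofPred_eq, Set.mem_preimage, not_not]
    rw [← sub_eq_iff_eq_add, eq_div_iff h_pow, mul_comm]
  rw [ae_iff, h_hyperplane, (PiLp.volume_preserving_ofLp (Fin n)).measure_preimage, volume_pi]
  · exact Measure.pi_hyperplane _ j _
  · exact (measurableSet_eq_fun (measurable_pi_apply j) measurable_const).nullMeasurableSet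

lemma eventually_floor_eq {t : ℝ} (h : ∀ m : ℤ, t ≠ m) : ∀ᶠ s in 𝓝 t, ⌊s⌋ = ⌊t⌋ := by
  have h_nhds : Set.Ioo (⌊t⌋ : ℝ) (⌊t⌋ + 1) ∈ 𝓝 t :=
    Ioo_mem_nhds ((Int.floor_le t).lt_of_ne (h _).symm) (Int.lt_floor_add_one t)
  filter_upwards [h_nhds] with s hs
  exact Int.floor_eq_iff.2 ⟨hs.1.le, hs.2⟩

lemma IsGeneric.eventually_cubeIndex_eq {ω : GridParam n} {p : ℤ} {x : E n}
    (h : IsGeneric ω p x) : ∀ᶠ ω' in 𝓝 ω, cubeIndex ω' p x = cubeIndex ω p x := by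
  have h_coord (j : Fin n) : ∀ᶠ ω' in 𝓝 ω, cubeIndex ω' p x j = cubeIndex ω p x j := by
    have h_shift : Continuous fun ω' : GridParam n => gridShift ω' p j :=
      (continuous_apply j).comp ((PiLp.continuous_ofLp 2 _).comp (continuous_gridShift p))
    have h_cont : Continuous fun ω' : GridParam n => (2 : ℝ) ^ p * (x j - gridShift ω' p j) := by
      fun_prop
    exact (h_cont.tendsto ω).eventually (eventually_floor_eq (h j))
  filter_upwards [eventually_all.2 h_coord] with ω' hω'
  exact funext hω'

lemma IsGeneric.eventually_mem_gridCube_iff {ω : GridParam n} {I : CubeLabel n} {x : E n}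
    (h : IsGeneric ω I.1 x) : ∀ᶠ ω' in 𝓝 ω, (x ∈ gridCube ω' I ↔ x ∈ gridCube ω I) := by
  filter_upwards [h.eventually_cubeIndex_eq] with ω' hω'
  rw [mem_gridCube_iff, mem_gridCube_iff, hω']

lemma exists_gridCube_subset_closedBall (I : CubeLabel n) :
    ∃ r : ℝ, ∀ ω : GridParam n, gridCube ω I ⊆ Metric.closedBall 0 r := by
  have hs := side_pos I
  refine ⟨n * (side I * (‖I.2‖ + 2)), fun ω x hx => mem_closedBall_zero_iff.2 ?_⟩
  refine norm_le_of_abs_apply_le (by positivity) fun j => ?_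
  rw [gridCube_eq_cube] at hx
  obtain ⟨h_lower, h_upper⟩ := hx j
  have h_pos := gridShift_nonneg ω I.1 j
  have h_le : gridShift ω I.1 j ≤ side I := gridShift_le ω I.1 j
  have h_norm : |(I.2 j : ℝ)| ≤ ‖I.2‖ := by
    simpa only [Int.norm_eq_abs] using norm_le_pi_norm I.2 j
  have h_corner : |side I * (I.2 j : ℝ)| ≤ side I * ‖I.2‖ := by
    rw [abs_mul, abs_of_pos hs]
    gcongr
  rw [abs_le] at h_corner ⊢
  simp only [corner] at h_lower h_upper
  constructor <;> linarith

lemma tendsto_indicator_of_eventually_mem_iff {ι α : Type*} {l : Filter ι} {s : ι → Set α}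
    {s₀ : Set α} {u : ι → α → ℂ} {u₀ : α → ℂ} {x : α} (hs : ∀ᶠ a in l, (x ∈ s a ↔ x ∈ s₀))
    (hu : Tendsto (fun a => u a x) l (𝓝 (u₀ x))) :
    Tendsto (fun a => (s a).indicator (u a) x) l (𝓝 (s₀.indicator u₀ x)) := by
  by_cases hx : x ∈ s₀
  · rw [Set.indicator_of_mem hx]
    refine hu.congr' (hs.mono fun a ha => ?_)
    exact (Set.indicator_of_mem (ha.2 hx) _).symm
  · rw [Set.indicator_of_notMem hx]
    refine tendsto_const_nhds.congr' (hs.mono fun a ha => ?_)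
    exact (Set.indicator_of_notMem (mt ha.1 hx) _).symm

variable {ι : Type*} {l : Filter ι} [l.IsCountablyGenerated] {ω : ι → GridParam n}
  {ω₀ : GridParam n}

lemma tendsto_setIntegral_gridCube (hω : Tendsto ω l (𝓝 ω₀)) (I : CubeLabel n)
    {g : ι → E n → ℂ} {g₀ : E n → ℂ} {G : ℝ} (hg : ∀ a, AEStronglyMeasurable (g a) volume)
    (hG : ∀ a, ∀ᵐ x, ‖g a x‖ ≤ G) (hlim : ∀ x, Tendsto (fun a => g a x) l (𝓝 (g₀ x))) :
    Tendsto (fun a => ∫ x in gridCube (ω a) I, g a x) l (𝓝 (∫ x in gridCube ω₀ I, g₀ x)) := by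
  obtain ⟨r, hr⟩ := exists_gridCube_subset_closedBall I
  simp only [← integral_indicator (measurableSet_gridCube _ I)]
  refine tendsto_integral_filter_of_dominated_convergence
    ((Metric.closedBall (0 : E n) r).indicator fun _ => G) ?_ ?_ ?_ ?_
  · exact Eventually.of_forall fun a => (hg a).indicator (measurableSet_gridCube _ I)
  · refine Eventually.of_forall fun a => (hG a).mono fun x hx => ?_
    rw [norm_indicator_eq_indicator_norm]
    exact (Set.indicator_le_indicator_of_subset (hr _) (fun _ => norm_nonneg _) x).trans
      (Set.indicator_le_indicator hx)
  · exact (integrable_indicator_iff Metric.isClosed_closedBall.measurableSet).2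
      (integrableOn_const measure_closedBall_lt_top.ne)
  · filter_upwards [ae_isGeneric ω₀ I.1] with x hx
    exact tendsto_indicator_of_eventually_mem_iff
      (hω.eventually hx.eventually_mem_gridCube_iff) (hlim x)

lemma tendsto_expect (hb : IsAccretive b β κ) (hω : Tendsto ω l (𝓝 ω₀)) (p : ℤ)
    {h : ι → E n → ℂ} {h₀ : E n → ℂ} {M : ℝ} (hc : ∀ a, Continuous (h a))
    (hM : ∀ a x, ‖h a x‖ ≤ M) (hlim : ∀ x, Tendsto (fun a => h a x) l (𝓝 (h₀ x)))
    {x : E n} (hx : IsGeneric ω₀ p x) :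
    Tendsto (fun a => expect b (ω a) p (h a) x) l (𝓝 (expect b ω₀ p h₀ x)) := by
  have h_expect : (fun a => expect b (ω a) p (h a) x) =ᶠ[l] fun a =>
      (∫ y in gridCube (ω a) (p, cubeIndex ω₀ p x), h a y * b y) /
        ∫ y in gridCube (ω a) (p, cubeIndex ω₀ p x), b y := by
    filter_upwards [hω.eventually hx.eventually_cubeIndex_eq] with a ha
    rw [expect_eq, ha]
  rw [expect_eq]
  refine Tendsto.congr' h_expect.symm (Tendsto.div ?_ ?_ (hb.integral_gridCube_ne_zero ω₀ _))
  · refine tendsto_setIntegral_gridCube hω _ (G := M * β)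
      (fun a => (hc a).aestronglyMeasurable.mul hb.aestronglyMeasurable)
      (fun a => hb.ae_norm_le.mono fun y hy => ?_) (fun y => (hlim y).mul_const _)
    exact norm_mul_le_of_le (hM a y) hy
  · exact tendsto_setIntegral_gridCube hω _ (fun _ => hb.aestronglyMeasurable)
      (fun _ => hb.ae_norm_le) (fun y => tendsto_const_nhds)

lemma tendsto_mdiff (hb : IsAccretive b β κ) (hω : Tendsto ω l (𝓝 ω₀)) (p : ℤ)
    {h : ι → E n → ℂ} {h₀ : E n → ℂ} {M : ℝ} (hc : ∀ a, Continuous (h a))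
    (hM : ∀ a x, ‖h a x‖ ≤ M) (hlim : ∀ x, Tendsto (fun a => h a x) l (𝓝 (h₀ x)))
    {x : E n} (hx : IsGeneric ω₀ p x) (hx' : IsGeneric ω₀ (p + 1) x) :
    Tendsto (fun a => mdiff b (ω a) p (h a) x) l (𝓝 (mdiff b ω₀ p h₀ x)) :=
  (tendsto_expect hb hω (p + 1) hc hM hlim hx').sub (tendsto_expect hb hω p hc hM hlim hx)

variable {Z : Type*} [MeasurableSpace Z]

lemma measurable_cubeIndex_comp (ω : GridParam n) (p : ℤ) {c : (Fin n → ℤ) → Z → ℂ}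
    (hc : ∀ k, Measurable (c k)) : Measurable fun z : E n × Z => c (cubeIndex ω p z.1) z.2 := by
  have h_index : Measurable (cubeIndex ω p) :=
    measurable_pi_lambda _ fun j => Int.measurable_floor.comp (by fun_prop)
  have h_uncurry : Measurable fun w : (Fin n → ℤ) × Z => c w.1 w.2 :=
    measurable_from_prod_countable_right hc
  exact h_uncurry.comp ((h_index.comp measurable_fst).prodMk measurable_snd)

lemma measurable_expect (hb : IsAccretive b β κ) {F : E n → Z → ℂ}
    (hF : Measurable (Function.uncurry F)) (ω : GridParam n) (p : ℤ) :
    Measurable fun z : E n × Z => expect b ω p (fun t => F t z.2) z.1 := by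
  have h_integral (I : CubeLabel n) : Measurable fun w : Z => ∫ y in gridCube ω I, F y w * b y := by
    have hb' := hb.aestronglyMeasurable
    have h_mk : (fun w : Z => ∫ y in gridCube ω I, F y w * b y) =
        fun w => ∫ y in gridCube ω I, F y w * hb'.mk b y := by
      ext w
      refine integral_congr_ae ?_
      filter_upwards [ae_restrict_of_ae hb'.ae_eq_mk] with y hy
      rw [hy]
    rw [h_mk]
    refine (StronglyMeasurable.integral_prod_left (f := fun y w => F y w * hb'.mk b y)
      ?_).measurable
    exact (hF.mul (hb'.stronglyMeasurable_mk.measurable.comp measurable_fst)).stronglyMeasurable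
  simp only [expect_eq]
  exact measurable_cubeIndex_comp ω p (c := fun k w => (∫ y in gridCube ω (p, k), F y w * b y) /
    ∫ y in gridCube ω (p, k), b y) fun k => (h_integral (p, k)).div_const _

lemma measurable_mdiff (hb : IsAccretive b β κ) {F : E n → Z → ℂ}
    (hF : Measurable (Function.uncurry F)) (ω : GridParam n) (p : ℤ) :
    Measurable fun z : E n × Z => mdiff b ω p (fun t => F t z.2) z.1 :=
  (measurable_expect hb hF ω (p + 1)).sub (measurable_expect hb hF ω p)

end Regularity

section SquareIntegrable

open Filter Topology

variable {n m : ℕ}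

/-! ### Square integrable functions of two variables -/

lemma coeFn_toL2 {F : E n × E m → ℂ} (hF : MemLp F 2 volume) :
    (toL2 F : E n × E m → ℂ) =ᵐ[volume] F := by
  rw [toL2, dif_pos hF]
  exact hF.coeFn_toLp

lemma norm_toL2 {F : E n × E m → ℂ} (hF : MemLp F 2 volume) :
    ‖toL2 F‖ = (eLpNorm F 2 volume).toReal := by
  rw [toL2, dif_pos hF, Lp.norm_toLp]

lemma toL2_sum_smul {ι : Type*} (s : Finset ι) (c : ι → ℂ) {F : ι → E n × E m → ℂ}
    (hF : ∀ i, MemLp (F i) 2 volume) :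
    toL2 (fun z => ∑ i ∈ s, c i * F i z) = ∑ i ∈ s, c i • toL2 (F i) := by
  have h_smul (i : ι) : (c i • toL2 (F i) : L2 n m) =ᵐ[volume] fun z => c i * F i z := by
    filter_upwards [Lp.coeFn_smul (c i) (toL2 (F i)), coeFn_toL2 (hF i)] with z hz hz'
    rw [hz, Pi.smul_apply, hz', smul_eq_mul]
  refine Lp.ext ((coeFn_toL2 (memLp_finsetSum s fun i _ => (hF i).const_mul (c i))).trans ?_)
  have h_all := (ae_ball_iff s.countable_toSet).2 fun i _ => h_smul i
  filter_upwards [Lp.coeFn_fun_finsetSum s fun i => c i • toL2 (F i), h_all] with z hz hz'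
  rw [hz]
  exact Finset.sum_congr rfl fun i hi => (hz' i hi).symm

lemma toL2_zero : toL2 (fun _ : E n × E m => (0 : ℂ)) = 0 := by
  simpa using toL2_sum_smul (n := n) (m := m) (∅ : Finset ℕ) 0 (F := 0) fun _ => MemLp.zero

lemma eLpNorm_mul_fst_snd {W₁ : E n → ℝ} {W₂ : E m → ℝ} (h₁ : AEStronglyMeasurable W₁ volume)
    (h₂ : AEStronglyMeasurable W₂ volume) :
    eLpNorm (fun z : E n × E m => W₁ z.1 * W₂ z.2) 2 volume =
      eLpNorm W₁ 2 volume * eLpNorm W₂ 2 volume := by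
  simp only [eLpNorm_eq_lintegral_rpow_enorm_toReal two_ne_zero ENNReal.ofNat_ne_top, enorm_mul]
  rw [← ENNReal.mul_rpow_of_nonneg _ _ (by positivity), Measure.volume_eq_prod,
    ← lintegral_prod_mul (h₁.enorm.pow_const _) (h₂.enorm.pow_const _)]
  simp only [ENNReal.mul_rpow_of_nonneg _ _ ENNReal.toReal_nonneg]

lemma memLp_mul_fst_snd {W₁ : E n → ℝ} {W₂ : E m → ℝ} (h₁ : MemLp W₁ 2 volume)
    (h₂ : MemLp W₂ 2 volume) : MemLp (fun z : E n × E m => W₁ z.1 * W₂ z.2) 2 volume := by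
  refine ⟨?_, ?_⟩
  · rw [Measure.volume_eq_prod]
    exact h₁.1.comp_fst.mul h₂.1.comp_snd
  · rw [eLpNorm_mul_fst_snd h₁.1 h₂.1]
    exact ENNReal.mul_lt_top h₁.2 h₂.2

lemma norm_toL2_le {F : E n × E m → ℂ} (hF : MemLp F 2 volume) {H : E n × E m → ℝ}
    (hH : MemLp H 2 volume) {c : ℝ} (hc : 0 ≤ c) (hle : ∀ᵐ z, ‖F z‖ ≤ c * ‖H z‖) :
    ‖toL2 F‖ ≤ c * (eLpNorm H 2 volume).toReal := by
  rw [norm_toL2 hF, ← ENNReal.toReal_ofReal hc, ← ENNReal.toReal_mul]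
  exact ENNReal.toReal_mono (ENNReal.mul_ne_top ENNReal.ofReal_ne_top hH.2.ne)
    (eLpNorm_le_mul_eLpNorm_of_ae_le_mul hle 2)

lemma tendsto_toL2_of_dominated {ι : Type*} {l : Filter ι} [l.IsCountablyGenerated]
    {F : ι → E n × E m → ℂ} {F₀ : E n × E m → ℂ} {H : E n × E m → ℝ}
    (hF : ∀ i, MemLp (F i) 2 volume) (hF₀ : MemLp F₀ 2 volume) (hH : MemLp H 2 volume)
    (hle : ∀ i, ∀ᵐ z, ‖F i z - F₀ z‖ ≤ H z)
    (hlim : ∀ᵐ z, Tendsto (fun i => F i z) l (𝓝 (F₀ z))) :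
    Tendsto (fun i => toL2 (F i)) l (𝓝 (toL2 F₀)) := by
  simp only [toL2, dif_pos (hF _), dif_pos hF₀]
  rw [Lp.tendsto_Lp_iff_tendsto_eLpNorm'']
  simp only [eLpNorm_eq_lintegral_rpow_enorm_toReal two_ne_zero ENNReal.ofNat_ne_top]
  have h_lintegral : Tendsto (fun i => ∫⁻ z, ‖(F i - F₀) z‖ₑ ^ (2 : ℝ≥0∞).toReal) l (𝓝 0) := by
    rw [← lintegral_zero (μ := (volume : Measure (E n × E m)))]
    refine tendsto_lintegral_filter_of_dominated_convergence'
      (fun z => ‖H z‖ₑ ^ (2 : ℝ≥0∞).toReal)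
      (Eventually.of_forall fun i => ((hF i).1.sub hF₀.1).enorm.pow_const _)
      (Eventually.of_forall fun i => (hle i).mono fun z hz => ?_)
      (lintegral_rpow_enorm_lt_top_of_eLpNorm_lt_top two_ne_zero ENNReal.ofNat_ne_top hH.2).ne
      (hlim.mono fun z hz => ?_)
    · exact ENNReal.rpow_le_rpow (enorm_le_iff_norm_le.2 (hz.trans (le_abs_self _)))
        ENNReal.toReal_nonneg
    · simpa using (hz.sub_const (F₀ z)).enorm.ennrpow_const (2 : ℝ)
  simpa using h_lintegral.ennrpow_const (1 / 2 : ℝ)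

lemma tendsto_Ico_neg_atTop : Tendsto (fun N : ℕ => Finset.Ico (-N : ℤ) N) atTop atTop := by
  refine tendsto_atTop_finset_of_monotone
    (fun a b hab => Finset.Ico_subset_Ico (by omega) (by omega)) fun p => ?_
  exact ⟨p.natAbs + 1, by simp only [Finset.mem_Ico]; omega⟩

-- Some subsequence of the partial sums converges almost everywhere to the sum in `L²`.
lemma hasSum_toL2 {ι : Type*} {K : ℤ → Finset ι} {u : ℤ → ι → E n × E m → ℂ}
    {F₀ : E n × E m → ℂ} (hu : ∀ p k, MemLp (u p k) 2 volume)
    (hs : Summable fun p => ∑ k ∈ K p, toL2 (u p k))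
    (hlim : ∀ z, Tendsto (fun N : ℕ => ∑ p ∈ Finset.Ico (-N : ℤ) N, ∑ k ∈ K p, u p k z) atTop
      (𝓝 (F₀ z))) :
    MemLp F₀ 2 volume ∧ HasSum (fun p => ∑ k ∈ K p, toL2 (u p k)) (toL2 F₀) := by
  obtain ⟨S, hS⟩ := hs
  obtain ⟨ns, hns, h_ae⟩ :=
    (tendstoInMeasure_of_tendsto_Lp (hS.comp tendsto_Ico_neg_atTop)).exists_seq_tendsto_ae
  have h_partial (N : ℕ) :
      ((∑ p ∈ Finset.Ico (-N : ℤ) N, ∑ k ∈ K p, toL2 (u p k) : L2 n m) : E n × E m → ℂ)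
        =ᵐ[volume] fun z => ∑ p ∈ Finset.Ico (-N : ℤ) N, ∑ k ∈ K p, u p k z := by
    have h_sigma := toL2_sum_smul ((Finset.Ico (-N : ℤ) N).sigma K) 1 (F := fun i => u i.1 i.2)
      fun i => hu i.1 i.2
    simp only [Finset.sum_sigma, Pi.one_apply, one_mul, one_smul] at h_sigma
    rw [← h_sigma]
    exact coeFn_toL2 (memLp_finsetSum _ fun p _ => memLp_finsetSum _ fun k _ => hu p k)
  have h_eq : (S : E n × E m → ℂ) =ᵐ[volume] F₀ := by
    filter_upwards [h_ae, ae_all_iff.2 h_partial] with z hz hz_partial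
    refine tendsto_nhds_unique hz (((hlim z).comp hns.tendsto_atTop).congr fun i => ?_)
    exact (hz_partial (ns i)).symm
  have hF₀ : MemLp F₀ 2 volume := (memLp_congr_ae h_eq).1 (Lp.memLp S)
  rw [← Lp.ext (h_eq.trans (coeFn_toL2 hF₀).symm)]
  exact ⟨hF₀, hS⟩

end SquareIntegrable

section TwoVariables

variable {n m : ℕ}

/-! ### Double martingale differences -/

/-- Functions of two variables, supported in a ball of radius `R`, which are tame in the second
variable with constant `M`, and whose increments in the first variable are tame in the second
variable with constant `M ‖x - x'‖^{1/2}`. -/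
structure IsTame₂ (M R : ℝ) (f : E n × E m → ℂ) : Prop where
  right : ∀ x, IsTame M R fun y => f (x, y)
  diff : ∀ x x', IsTame (M * √‖x - x'‖) R fun y => f (x, y) - f (x', y)
  eq_zero : ∀ x y, R < ‖x‖ → f (x, y) = 0
  measurable : Measurable f
  radius_nonneg : 0 ≤ R

lemma le_mul_sqrt_mul_sqrt {a A s t : ℝ} (hA : 0 ≤ A) (hs : 0 ≤ s) (ht : 0 ≤ t) (has : a ≤ A * s)
    (hat : a ≤ A * t) : a ≤ A * (√s * √t) := by
  rcases le_total s t with h | h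
  · refine has.trans (mul_le_mul_of_nonneg_left ?_ hA)
    calc s = √s * √s := (Real.mul_self_sqrt hs).symm
      _ ≤ √s * √t := by gcongr
  · refine hat.trans (mul_le_mul_of_nonneg_left ?_ hA)
    calc t = √t * √t := (Real.mul_self_sqrt ht).symm
      _ ≤ √s * √t := by gcongr

open scoped NNReal in
lemma norm_sub_le_mul_sqrt {F G : Type*} [NormedAddCommGroup F] [NormedAddCommGroup G] {f : F → G}
    {L : ℝ≥0} {M : ℝ} (hf : LipschitzWith L f) (hM : ∀ z, ‖f z‖ ≤ M) (z z' : F) :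
    ‖f z - f z'‖ ≤ 2 * max M L * √‖z - z'‖ := by
  have hM₀ : 0 ≤ max M L := le_max_of_le_right L.2
  have h_bound : ‖f z - f z'‖ ≤ 2 * max M L * 1 := by
    linarith [norm_sub_le (f z) (f z'), hM z, hM z', le_max_left M L]
  have h_lip : ‖f z - f z'‖ ≤ 2 * max M L * ‖z - z'‖ := by
    refine (hf.norm_sub_le z z').trans (mul_le_mul_of_nonneg_right ?_ (norm_nonneg _))
    linarith [le_max_right M L]
  simpa only [Real.sqrt_one, one_mul] using
    le_mul_sqrt_mul_sqrt (by positivity) zero_le_one (norm_nonneg _) h_bound h_lip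

-- The second difference of a Lipschitz function is at most `2L min(‖x - x'‖, ‖y - y'‖)`, and
-- the minimum is at most the geometric mean.
open scoped NNReal in
lemma exists_isTame₂ {f : E n × E m → ℂ} {L : ℝ≥0} (hf : LipschitzWith L f)
    (hfc : HasCompactSupport f) : ∃ M R, IsTame₂ M R f := by
  obtain ⟨M, hM⟩ := hfc.exists_bound_of_continuous hf.continuous
  obtain ⟨R, hR, h_subset⟩ := hfc.isCompact.isBounded.subset_closedBall_lt 0 0
  have hM₀ : 0 ≤ max M L := le_max_of_le_right L.2
  have h_zero (z : E n × E m) (hz : R < ‖z‖) : f z = 0 := by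
    contrapose! hz
    exact mem_closedBall_zero_iff.1 (h_subset (subset_tsupport f hz))
  have h_snd (x : E n) (y y' : E m) : ‖((x, y) : E n × E m) - (x, y')‖ = ‖y - y'‖ := by
    simp [Prod.norm_def]
  have h_fst (x x' : E n) (y : E m) : ‖((x, y) : E n × E m) - (x', y)‖ = ‖x - x'‖ := by
    simp [Prod.norm_def]
  have h_lip (z z' : E n × E m) : ‖f z - f z'‖ ≤ max M L * ‖z - z'‖ :=
    (hf.norm_sub_le z z').trans (mul_le_mul_of_nonneg_right (le_max_right _ _) (norm_nonneg _))
  refine ⟨2 * max M L, R, fun x => ⟨fun y => ?_, fun y y' => ?_, fun y hy => ?_⟩,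
    fun x x' => ⟨fun y => ?_, fun y y' => ?_, fun y hy => ?_⟩, fun x y hx => ?_,
    hf.continuous.measurable, hR.le⟩
  · linarith [hM (x, y), le_max_left M L]
  · simpa only [h_snd] using norm_sub_le_mul_sqrt hf hM (x, y) (x, y')
  · exact h_zero _ (hy.trans_le (le_max_right _ _))
  · simpa only [h_fst] using norm_sub_le_mul_sqrt hf hM (x, y) (x', y)
  · rw [mul_assoc]
    refine le_mul_sqrt_mul_sqrt (by positivity) (norm_nonneg _) (norm_nonneg _) ?_ ?_
    · have h₁ := h_lip (x, y) (x', y)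
      have h₂ := h_lip (x, y') (x', y')
      rw [h_fst] at h₁ h₂
      linarith [norm_sub_le (f (x, y) - f (x', y)) (f (x, y') - f (x', y'))]
    · have h₁ := h_lip (x, y) (x, y')
      have h₂ := h_lip (x', y) (x', y')
      rw [h_snd] at h₁ h₂
      rw [sub_sub_sub_comm]
      linarith [norm_sub_le (f (x, y) - f (x, y')) (f (x', y) - f (x', y'))]
  · rw [h_zero (x, y) (hy.trans_le (le_max_right _ _)),
      h_zero (x', y) (hy.trans_le (le_max_right _ _)), sub_zero]
  · exact h_zero _ (hx.trans_le (le_max_left _ _))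

/-- The martingale difference in the second variable, i.e. the sum of all `Δ_J^{b₂} f` with
`J ∈ 𝒟_q`. -/
def mdiff₂ (b₂ : E m → ℂ) (ω' : GridParam m) (q : ℤ) (f : E n × E m → ℂ) (z : E n × E m) : ℂ :=
  mdiff b₂ ω' q (fun t => f (z.1, t)) z.2

/-- The double martingale difference, i.e. the sum of all `Δ_I^{b₁} Δ_J^{b₂} f` with `I ∈ 𝒟_p` and
`J ∈ 𝒟_q`. -/
def mdiff₁₂ (b₁ : E n → ℂ) (b₂ : E m → ℂ) (ω : GridParam n) (ω' : GridParam m) (p q : ℤ)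
    (f : E n × E m → ℂ) (z : E n × E m) : ℂ :=
  mdiff b₁ ω p (fun t => mdiff₂ b₂ ω' q f (t, z.2)) z.1

variable {b₁ : E n → ℂ} {b₂ : E m → ℂ} {β₁ κ₁ β₂ κ₂ M R : ℝ} {f : E n × E m → ℂ}
  {ω : GridParam n} {ω' : GridParam m} {p q : ℤ} {I : CubeLabel n} {J : CubeLabel m}

lemma IsTame₂.nonneg (hf : IsTame₂ M R f) : 0 ≤ M := (hf.right 0).nonneg

lemma IsTame₂.isTame_mdiff₂ (hf : IsTame₂ M R f) (hb₂ : IsAccretive b₂ β₂ κ₂)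
    (ω' : GridParam m) (q : ℤ) (y : E m) : IsTame (M * profile m (decayConst m β₂ κ₂ R) R q y) R
      fun x => mdiff₂ b₂ ω' q f (x, y) where
  norm_le x := norm_mdiff_le hb₂ hf.radius_nonneg (hf.right x) ω' q y
  norm_sub_le x x' := by
    have h := norm_mdiff_le hb₂ hf.radius_nonneg (hf.diff x x') ω' q y
    rwa [mdiff_sub hb₂ (hf.right x) (hf.right x'), mul_right_comm] at h
  eq_zero x hx := by
    have h : (fun t => f (x, t)) = fun _ => 0 := funext fun t => hf.eq_zero x t hx
    simp only [mdiff₂, h, mdiff_zero]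

lemma IsTame₂.norm_mdiff₁₂_le (hf : IsTame₂ M R f) (hb₁ : IsAccretive b₁ β₁ κ₁)
    (hb₂ : IsAccretive b₂ β₂ κ₂) (ω : GridParam n) (ω' : GridParam m) (p q : ℤ) (z : E n × E m) :
    ‖mdiff₁₂ b₁ b₂ ω ω' p q f z‖ ≤ M * (profile n (decayConst n β₁ κ₁ R) R p z.1 *
      profile m (decayConst m β₂ κ₂ R) R q z.2) := by
  refine (norm_mdiff_le hb₁ hf.radius_nonneg (hf.isTame_mdiff₂ hb₂ ω' q z.2) ω p z.1).trans_eq ?_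
  ring

lemma IsTame₂.measurable_mdiff₂ (hf : IsTame₂ M R f) (hb₂ : IsAccretive b₂ β₂ κ₂)
    (ω' : GridParam m) (q : ℤ) : Measurable (mdiff₂ b₂ ω' q f) := by
  have h_swap : Measurable (Function.uncurry fun (t : E m) (x : E n) => f (x, t)) :=
    hf.measurable.comp measurable_swap
  have h := (measurable_mdiff hb₂ h_swap ω' q).comp (measurable_swap (α := E n) (β := E m))
  exact h

lemma IsTame₂.measurable_mdiff₁₂ (hf : IsTame₂ M R f) (hb₁ : IsAccretive b₁ β₁ κ₁)
    (hb₂ : IsAccretive b₂ β₂ κ₂) (ω : GridParam n) (ω' : GridParam m) (p q : ℤ) :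
    Measurable (mdiff₁₂ b₁ b₂ ω ω' p q f) :=
  measurable_mdiff hb₁ (F := fun t y => mdiff₂ b₂ ω' q f (t, y))
    (hf.measurable_mdiff₂ hb₂ ω' q) ω p

lemma delta₂_eq_indicator (b₂ : E m → ℂ) (ω' : GridParam m) (J : CubeLabel m)
    (f : E n × E m → ℂ) :
    delta₂ b₂ ω' J f = (Set.univ ×ˢ gridCube ω' J).indicator (mdiff₂ b₂ ω' J.1 f) := by
  classical
  ext z
  simp only [delta₂, delta_eq_indicator, Set.indicator_apply, Set.mem_prod, Set.mem_univ, true_and,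
    mdiff₂]

lemma doubleDelta_eq_indicator (b₁ : E n → ℂ) (b₂ : E m → ℂ) (ω : GridParam n) (ω' : GridParam m)
    (I : CubeLabel n) (J : CubeLabel m) (f : E n × E m → ℂ) :
    doubleDelta b₁ b₂ ω ω' I J f =
      (gridCube ω I ×ˢ gridCube ω' J).indicator (mdiff₁₂ b₁ b₂ ω ω' I.1 J.1 f) := by
  classical
  ext z
  simp only [doubleDelta, delta₁, delta_eq_indicator, delta₂_eq_indicator, Set.indicator_apply,
    Set.mem_prod, Set.mem_univ, true_and]
  by_cases hz : z.2 ∈ gridCube ω' J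
  · simp only [hz, and_true, if_true, mdiff₁₂]
  · simp only [hz, and_false, if_false, mdiff_zero, ite_self]

lemma IsTame₂.measurable_doubleDelta (hf : IsTame₂ M R f) (hb₁ : IsAccretive b₁ β₁ κ₁)
    (hb₂ : IsAccretive b₂ β₂ κ₂) (ω : GridParam n) (ω' : GridParam m) (I : CubeLabel n)
    (J : CubeLabel m) : Measurable (doubleDelta b₁ b₂ ω ω' I J f) := by
  rw [doubleDelta_eq_indicator]
  exact (hf.measurable_mdiff₁₂ hb₁ hb₂ ω ω' I.1 J.1).indicator
    ((measurableSet_gridCube ω I).prod (measurableSet_gridCube ω' J))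

lemma sum_doubleDelta (b₁ : E n → ℂ) (b₂ : E m → ℂ) (ω : GridParam n) (ω' : GridParam m) (p q : ℤ)
    (f : E n × E m → ℂ) (s : Finset ((Fin n → ℤ) × (Fin m → ℤ)))
    (c : (Fin n → ℤ) × (Fin m → ℤ) → ℂ) (z : E n × E m) :
    ∑ i ∈ s, c i * doubleDelta b₁ b₂ ω ω' (p, i.1) (q, i.2) f z =
      if (cubeIndex ω p z.1, cubeIndex ω' q z.2) ∈ s then
        c (cubeIndex ω p z.1, cubeIndex ω' q z.2) * mdiff₁₂ b₁ b₂ ω ω' p q f z else 0 := by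
  classical
  rw [← Finset.sum_ite_eq s _ fun i => c i * mdiff₁₂ b₁ b₂ ω ω' p q f z]
  refine Finset.sum_congr rfl fun i _ => ?_
  simp only [doubleDelta_eq_indicator, Set.indicator_apply, Set.mem_prod, mem_gridCube_iff,
    Prod.ext_iff, mul_ite, mul_zero]

lemma IsTame₂.isTame_delta₂ (hf : IsTame₂ M R f) (hb₂ : IsAccretive b₂ β₂ κ₂) (ω' : GridParam m)
    (J : CubeLabel m) (y : E m) : IsTame (M * profile m (decayConst m β₂ κ₂ R) R J.1 y) R
      fun x => delta₂ b₂ ω' J f (x, y) := by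
  have h := hf.isTame_mdiff₂ hb₂ ω' J.1 y
  by_cases hy : y ∈ gridCube ω' J
  · have h_eq (x : E n) : delta₂ b₂ ω' J f (x, y) = mdiff₂ b₂ ω' J.1 f (x, y) := by
      rw [delta₂_eq_indicator, Set.indicator_of_mem]
      exact ⟨Set.mem_univ _, hy⟩
    simpa only [h_eq] using h
  · have h_eq (x : E n) : delta₂ b₂ ω' J f (x, y) = 0 := by
      rw [delta₂_eq_indicator, Set.indicator_of_notMem fun hz => hy hz.2]
    simp only [h_eq]
    exact ⟨fun _ => by simpa using h.nonneg,
      fun _ _ => by simpa using mul_nonneg h.nonneg (Real.sqrt_nonneg _), fun _ _ => rfl⟩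

lemma IsTame₂.doubleDelta_eq_zero (hf : IsTame₂ M R f) (hb₂ : IsAccretive b₂ β₂ κ₂)
    (h : I.2 ∉ posSet n R I.1 ∨ J.2 ∉ posSet m R J.1) :
    doubleDelta b₁ b₂ ω ω' I J f = fun _ => 0 := by
  ext z
  rcases h with hI | hJ
  · exact delta_eq_zero (hf.isTame_delta₂ hb₂ ω' J z.2).eq_zero hI z.1
  · have h_right (x : E n) : delta₂ b₂ ω' J f (x, z.2) = 0 :=
      delta_eq_zero (hf.right x).eq_zero hJ z.2
    simp only [doubleDelta, delta₁, h_right, delta_eq_indicator, Set.indicator_apply_eq_zero]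
    exact fun _ => mdiff_zero b₁ ω I.1 z.1

end TwoVariables

section Classes

open Filter Topology

variable {n m : ℕ} {b₁ : E n → ℂ} {b₂ : E m → ℂ} {β₁ κ₁ β₂ κ₂ M R : ℝ} {f : E n × E m → ℂ}

/-! ### Double martingale differences in `L²` -/

lemma aestronglyMeasurable_tensor (hb₁ : IsAccretive b₁ β₁ κ₁) (hb₂ : IsAccretive b₂ β₂ κ₂) :
    AEStronglyMeasurable (tensor b₁ b₂) volume := by
  rw [Measure.volume_eq_prod]
  exact hb₁.aestronglyMeasurable.comp_fst.mul hb₂.aestronglyMeasurable.comp_snd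

lemma ae_fst_and_snd {P : E n → Prop} {Q : E m → Prop} (hP : ∀ᵐ x, P x) (hQ : ∀ᵐ y, Q y) :
    ∀ᵐ z : E n × E m, P z.1 ∧ Q z.2 := by
  rw [Measure.volume_eq_prod]
  exact (Measure.quasiMeasurePreserving_fst.ae hP).and (Measure.quasiMeasurePreserving_snd.ae hQ)

lemma ae_norm_tensor_le (hb₁ : IsAccretive b₁ β₁ κ₁) (hb₂ : IsAccretive b₂ β₂ κ₂) :
    ∀ᵐ z, ‖tensor b₁ b₂ z‖ ≤ β₁ * β₂ := by
  filter_upwards [ae_fst_and_snd hb₁.ae_norm_le hb₂.ae_norm_le] with z hz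
  exact norm_mul_le_of_le hz.1 hz.2

lemma memLp_tensor_mul (hb₁ : IsAccretive b₁ β₁ κ₁) (hb₂ : IsAccretive b₂ β₂ κ₂)
    {F : E n × E m → ℂ} (hF : MemLp F 2 volume) :
    MemLp (fun z => tensor b₁ b₂ z * F z) 2 volume := by
  refine hF.of_le_mul (c := β₁ * β₂) ((aestronglyMeasurable_tensor hb₁ hb₂).mul hF.1) ?_
  filter_upwards [ae_norm_tensor_le hb₁ hb₂] with z hz
  exact norm_mul_le_of_le hz le_rfl

/-- The product of the profiles of scales `p` and `q`, which dominates the double martingale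
differences of these scales. -/
def profile₂ (n m : ℕ) (β₁ κ₁ β₂ κ₂ R : ℝ) (p q : ℤ) (z : E n × E m) : ℝ :=
  profile n (decayConst n β₁ κ₁ R) R p z.1 * profile m (decayConst m β₂ κ₂ R) R q z.2

/-- The norm in `L²` of `profile`. -/
def profileNorm (n : ℕ) (β κ R : ℝ) (p : ℤ) : ℝ :=
  (eLpNorm (profile n (decayConst n β κ R) R p) 2 volume).toReal

/-- The bound in `L²` for the weighted sums of `b Δ_I Δ_J f` over cubes of scales `p` and `q`. -/
def scaleBound (n m : ℕ) (β₁ κ₁ β₂ κ₂ M R : ℝ) (p q : ℤ) : ℝ :=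
  β₁ * β₂ * M * (profileNorm n β₁ κ₁ R p * profileNorm m β₂ κ₂ R q)

lemma memLp_profile₂ (n m : ℕ) (β₁ κ₁ β₂ κ₂ R : ℝ) (p q : ℤ) :
    MemLp (profile₂ n m β₁ κ₁ β₂ κ₂ R p q) 2 volume :=
  memLp_mul_fst_snd (memLp_profile n _ R p) (memLp_profile m _ R q)

lemma toReal_eLpNorm_profile₂ (n m : ℕ) (β₁ κ₁ β₂ κ₂ R : ℝ) (p q : ℤ) :
    (eLpNorm (profile₂ n m β₁ κ₁ β₂ κ₂ R p q) 2 volume).toReal =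
      profileNorm n β₁ κ₁ R p * profileNorm m β₂ κ₂ R q := by
  unfold profile₂
  rw [eLpNorm_mul_fst_snd (memLp_profile n _ R p).1 (memLp_profile m _ R q).1, ENNReal.toReal_mul]
  rfl

lemma profile₂_nonneg (hb₁ : IsAccretive b₁ β₁ κ₁) (hb₂ : IsAccretive b₂ β₂ κ₂) (R : ℝ) (p q : ℤ)
    (z : E n × E m) : 0 ≤ profile₂ n m β₁ κ₁ β₂ κ₂ R p q z :=
  mul_nonneg (profile_nonneg (hb₁.decayConst_nonneg R) R p z.1)
    (profile_nonneg (hb₂.decayConst_nonneg R) R q z.2)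

lemma IsTame₂.norm_doubleDelta_le (hf : IsTame₂ M R f) (hb₁ : IsAccretive b₁ β₁ κ₁)
    (hb₂ : IsAccretive b₂ β₂ κ₂) (ω : GridParam n) (ω' : GridParam m) (I : CubeLabel n)
    (J : CubeLabel m) (z : E n × E m) :
    ‖doubleDelta b₁ b₂ ω ω' I J f z‖ ≤ M * profile₂ n m β₁ κ₁ β₂ κ₂ R I.1 J.1 z := by
  rw [doubleDelta_eq_indicator]
  exact (norm_indicator_le_norm_self _ z).trans (hf.norm_mdiff₁₂_le hb₁ hb₂ ω ω' I.1 J.1 z)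

lemma IsTame₂.memLp_doubleDelta (hf : IsTame₂ M R f) (hb₁ : IsAccretive b₁ β₁ κ₁)
    (hb₂ : IsAccretive b₂ β₂ κ₂) (ω : GridParam n) (ω' : GridParam m) (I : CubeLabel n)
    (J : CubeLabel m) : MemLp (doubleDelta b₁ b₂ ω ω' I J f) 2 volume := by
  refine (memLp_profile₂ n m β₁ κ₁ β₂ κ₂ R I.1 J.1).of_le_mul (c := M)
    (hf.measurable_doubleDelta hb₁ hb₂ ω ω' I J).aestronglyMeasurable (ae_of_all _ fun z => ?_)
  rw [Real.norm_of_nonneg (profile₂_nonneg hb₁ hb₂ R I.1 J.1 z)]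
  exact hf.norm_doubleDelta_le hb₁ hb₂ ω ω' I J z

/-- The class of `b Δ_I Δ_J f` in `L²`, where `b = b₁ ⊗ b₂`. -/
def doubleTerm (b₁ : E n → ℂ) (b₂ : E m → ℂ) (f : E n × E m → ℂ) (ω : GridParam n)
    (ω' : GridParam m) (I : CubeLabel n) (J : CubeLabel m) : L2 n m :=
  toL2 fun z => tensor b₁ b₂ z * doubleDelta b₁ b₂ ω ω' I J f z

/-- The class of `b Δ_J f` in `L²`, where `b = b₁ ⊗ b₂`. -/
def singleTerm (b₁ : E n → ℂ) (b₂ : E m → ℂ) (f : E n × E m → ℂ) (ω' : GridParam m)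
    (J : CubeLabel m) : L2 n m :=
  toL2 fun z => tensor b₁ b₂ z * delta₂ b₂ ω' J f z

lemma IsTame₂.doubleTerm_eq_zero (hf : IsTame₂ M R f) (hb₂ : IsAccretive b₂ β₂ κ₂)
    {ω : GridParam n} {ω' : GridParam m} {I : CubeLabel n} {J : CubeLabel m}
    (h : I.2 ∉ posSet n R I.1 ∨ J.2 ∉ posSet m R J.1) : doubleTerm b₁ b₂ f ω ω' I J = 0 := by
  simp only [doubleTerm, hf.doubleDelta_eq_zero hb₂ h, mul_zero, toL2_zero]

-- The cubes of two given scales are disjoint, so at each point at most one term of the sum over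
-- the cubes is nonzero.
lemma IsTame₂.norm_sum_doubleTerm_le (hf : IsTame₂ M R f) (hb₁ : IsAccretive b₁ β₁ κ₁)
    (hb₂ : IsAccretive b₂ β₂ κ₂) (ω : GridParam n) (ω' : GridParam m) (p q : ℤ)
    (s : Finset ((Fin n → ℤ) × (Fin m → ℤ))) {c : (Fin n → ℤ) × (Fin m → ℤ) → ℂ}
    (hc : ∀ i, ‖c i‖ ≤ 1) :
    ‖∑ i ∈ s, c i • doubleTerm b₁ b₂ f ω ω' (p, i.1) (q, i.2)‖ ≤
      scaleBound n m β₁ κ₁ β₂ κ₂ M R p q := by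
  have h_memLp (i : (Fin n → ℤ) × (Fin m → ℤ)) :=
    memLp_tensor_mul hb₁ hb₂ (hf.memLp_doubleDelta hb₁ hb₂ ω ω' (p, i.1) (q, i.2))
  have h_nonneg : 0 ≤ β₁ * β₂ * M :=
    mul_nonneg (mul_pos hb₁.bound_pos hb₂.bound_pos).le hf.nonneg
  unfold doubleTerm
  rw [← toL2_sum_smul s c h_memLp, scaleBound, ← toReal_eLpNorm_profile₂]
  refine norm_toL2_le (memLp_finsetSum s fun i _ => (h_memLp i).const_mul (c i))
    (memLp_profile₂ n m β₁ κ₁ β₂ κ₂ R p q) h_nonneg ?_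
  filter_upwards [ae_norm_tensor_le hb₁ hb₂] with z hz
  have h_sum : ‖∑ i ∈ s, c i * doubleDelta b₁ b₂ ω ω' (p, i.1) (q, i.2) f z‖ ≤
      M * profile₂ n m β₁ κ₁ β₂ κ₂ R p q z := by
    rw [sum_doubleDelta]
    split_ifs
    · exact (norm_mul_le_of_le (hc _) (hf.norm_mdiff₁₂_le hb₁ hb₂ ω ω' p q z)).trans_eq (one_mul _)
    · rw [norm_zero]
      exact mul_nonneg hf.nonneg (profile₂_nonneg hb₁ hb₂ R p q z)
  rw [Real.norm_of_nonneg (profile₂_nonneg hb₁ hb₂ R p q z), mul_assoc]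
  simp only [mul_left_comm (c _), ← Finset.mul_sum]
  exact norm_mul_le_of_le hz h_sum

lemma IsTame₂.norm_sum_doubleTerm_left_le (hf : IsTame₂ M R f) (hb₁ : IsAccretive b₁ β₁ κ₁)
    (hb₂ : IsAccretive b₂ β₂ κ₂) (ω : GridParam n) (ω' : GridParam m) (p : ℤ) (J : CubeLabel m)
    (K : Finset (Fin n → ℤ)) {ε : (Fin n → ℤ) → ℂ} (hε : ∀ k, ‖ε k‖ ≤ 1) :
    ‖∑ k ∈ K, ε k • doubleTerm b₁ b₂ f ω ω' (p, k) J‖ ≤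
      scaleBound n m β₁ κ₁ β₂ κ₂ M R p J.1 := by
  have h := hf.norm_sum_doubleTerm_le hb₁ hb₂ ω ω' p J.1 (K ×ˢ {J.2}) (c := fun i => ε i.1)
    fun i => hε i.1
  simpa only [Finset.sum_product, Finset.sum_singleton] using h

lemma IsTame₂.tendsto_doubleDelta (hf : IsTame₂ M R f) (hb₁ : IsAccretive b₁ β₁ κ₁)
    (hb₂ : IsAccretive b₂ β₂ κ₂) {I : CubeLabel n} {J : CubeLabel m}
    {w₀ : GridParam n × GridParam m} {z : E n × E m}
    (h₁ : IsGeneric w₀.1 I.1 z.1 ∧ IsGeneric w₀.2 J.1 z.2)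
    (h₂ : IsGeneric w₀.1 (I.1 + 1) z.1 ∧ IsGeneric w₀.2 (J.1 + 1) z.2) :
    Tendsto (fun w : GridParam n × GridParam m => doubleDelta b₁ b₂ w.1 w.2 I J f z) (𝓝 w₀)
      (𝓝 (doubleDelta b₁ b₂ w₀.1 w₀.2 I J f z)) := by
  have h_fst : Tendsto Prod.fst (𝓝 w₀) (𝓝 w₀.1) := continuous_fst.tendsto w₀
  have h_snd : Tendsto Prod.snd (𝓝 w₀) (𝓝 w₀.2) := continuous_snd.tendsto w₀
  have h_mdiff₂ (x : E n) : Tendsto (fun w : GridParam n × GridParam m =>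
      mdiff₂ b₂ w.2 J.1 f (x, z.2)) (𝓝 w₀) (𝓝 (mdiff₂ b₂ w₀.2 J.1 f (x, z.2))) :=
    tendsto_mdiff hb₂ h_snd J.1 (h := fun _ t => f (x, t)) (fun _ => (hf.right x).continuous)
      (fun _ => (hf.right x).norm_le) (fun _ => tendsto_const_nhds) h₁.2 h₂.2
  have h_mdiff₁₂ : Tendsto (fun w : GridParam n × GridParam m =>
      mdiff₁₂ b₁ b₂ w.1 w.2 I.1 J.1 f z) (𝓝 w₀) (𝓝 (mdiff₁₂ b₁ b₂ w₀.1 w₀.2 I.1 J.1 f z)) :=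
    tendsto_mdiff hb₁ h_fst I.1 (h := fun w t => mdiff₂ b₂ w.2 J.1 f (t, z.2))
      (fun w => (hf.isTame_mdiff₂ hb₂ w.2 J.1 z.2).continuous)
      (fun w => (hf.isTame_mdiff₂ hb₂ w.2 J.1 z.2).norm_le) h_mdiff₂ h₁.1 h₂.1
  simp only [doubleDelta_eq_indicator]
  refine tendsto_indicator_of_eventually_mem_iff ?_ h_mdiff₁₂
  filter_upwards [h_fst.eventually h₁.1.eventually_mem_gridCube_iff,
    h_snd.eventually h₁.2.eventually_mem_gridCube_iff] with w hw₁ hw₂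
  exact and_congr hw₁ hw₂

lemma IsTame₂.continuous_doubleTerm (hf : IsTame₂ M R f) (hb₁ : IsAccretive b₁ β₁ κ₁)
    (hb₂ : IsAccretive b₂ β₂ κ₂) (I : CubeLabel n) (J : CubeLabel m) :
    Continuous fun w : GridParam n × GridParam m => doubleTerm b₁ b₂ f w.1 w.2 I J := by
  refine continuous_iff_continuousAt.2 fun w₀ => ?_
  have h_memLp (w : GridParam n × GridParam m) :=
    memLp_tensor_mul hb₁ hb₂ (hf.memLp_doubleDelta hb₁ hb₂ w.1 w.2 I J)
  refine tendsto_toL2_of_dominated h_memLp (h_memLp w₀)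
    ((memLp_profile₂ n m β₁ κ₁ β₂ κ₂ R I.1 J.1).const_mul (2 * (β₁ * β₂ * M))) (fun w => ?_) ?_
  · filter_upwards [ae_norm_tensor_le hb₁ hb₂] with z hz
    have h_bound (w : GridParam n × GridParam m) :=
      norm_mul_le_of_le hz (hf.norm_doubleDelta_le hb₁ hb₂ w.1 w.2 I J z)
    refine (norm_sub_le_of_le (h_bound w) (h_bound w₀)).trans_eq ?_
    ring
  · filter_upwards [ae_fst_and_snd (ae_isGeneric w₀.1 I.1) (ae_isGeneric w₀.2 J.1),
      ae_fst_and_snd (ae_isGeneric w₀.1 (I.1 + 1)) (ae_isGeneric w₀.2 (J.1 + 1))] with z h₁ h₂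
    exact (hf.tendsto_doubleDelta hb₁ hb₂ h₁ h₂).const_mul (tensor b₁ b₂ z)

end Classes

section Decompositions

variable {n m : ℕ} {b₁ : E n → ℂ} {b₂ : E m → ℂ} {β₁ κ₁ β₂ κ₂ M R : ℝ} {f : E n × E m → ℂ}

/-! ### Decompositions along the grids -/

lemma profileNorm_nonneg (n : ℕ) (β κ R : ℝ) : 0 ≤ profileNorm n β κ R := fun _ =>
  ENNReal.toReal_nonneg

lemma summable_profileNorm (hn : 0 < n) (hb₁ : IsAccretive b₁ β₁ κ₁) (hR : 0 ≤ R) :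
    Summable (profileNorm n β₁ κ₁ R) :=
  summable_eLpNorm_profile hn (hb₁.decayConst_nonneg R) hR

lemma summable_scaleBound (hn : 0 < n) (hb₁ : IsAccretive b₁ β₁ κ₁) (hR : 0 ≤ R) (β₂ κ₂ M : ℝ)
    (q : ℤ) : Summable fun p => scaleBound n m β₁ κ₁ β₂ κ₂ M R p q :=
  ((summable_profileNorm hn hb₁ hR).mul_right _).mul_left _

lemma summable_tsum_scaleBound (hm : 0 < m) (hb₂ : IsAccretive b₂ β₂ κ₂) (hR : 0 ≤ R)
    (β₁ κ₁ M : ℝ) : Summable fun q => ∑' p, scaleBound n m β₁ κ₁ β₂ κ₂ M R p q := by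
  simp only [scaleBound, tsum_mul_left, tsum_mul_right]
  exact ((summable_profileNorm hm hb₂ hR).mul_left _).mul_left _

lemma IsTame₂.hasSum_doubleTerm (hf : IsTame₂ M R f) (hn : 0 < n) (hb₁ : IsAccretive b₁ β₁ κ₁)
    (hb₂ : IsAccretive b₂ β₂ κ₂) (ω : GridParam n) (ω' : GridParam m) (J : CubeLabel m) :
    MemLp (fun z => tensor b₁ b₂ z * delta₂ b₂ ω' J f z) 2 volume ∧
      HasSum (fun p => ∑ k ∈ posSet n R p, doubleTerm b₁ b₂ f ω ω' (p, k) J)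
        (singleTerm b₁ b₂ f ω' J) := by
  refine hasSum_toL2 (u := fun p k z => tensor b₁ b₂ z * doubleDelta b₁ b₂ ω ω' (p, k) J f z)
    (fun p k => memLp_tensor_mul hb₁ hb₂ (hf.memLp_doubleDelta hb₁ hb₂ ω ω' (p, k) J)) ?_
    fun z => ?_
  · refine (summable_scaleBound (m := m) hn hb₁ hf.radius_nonneg β₂ κ₂ M J.1).of_norm_bounded
      fun p => ?_
    simpa only [one_smul, doubleTerm] using
      hf.norm_sum_doubleTerm_left_le hb₁ hb₂ ω ω' p J (posSet n R p) (ε := fun _ => 1) (by simp)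
  · have h_tame := hf.isTame_delta₂ hb₂ ω' J z.2
    simp only [← Finset.mul_sum, doubleDelta, delta₁, sum_delta h_tame.eq_zero]
    exact (tendsto_sum_mdiff hn hb₁ h_tame ω z.1).const_mul (tensor b₁ b₂ z)

lemma IsTame₂.isGridDecomp_doubleTerm (hf : IsTame₂ M R f) (hn : 0 < n)
    (hb₁ : IsAccretive b₁ β₁ κ₁) (hb₂ : IsAccretive b₂ β₂ κ₂) (ω' : GridParam m)
    (J : CubeLabel m) :
    IsGridDecomp (posSet n R) (fun p => scaleBound n m β₁ κ₁ β₂ κ₂ M R p J.1)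
      (fun ω p k => doubleTerm b₁ b₂ f ω ω' (p, k) J) (singleTerm b₁ b₂ f ω' J) where
  stronglyMeasurable p k := ((hf.continuous_doubleTerm hb₁ hb₂ (p, k) J).comp
    (Continuous.prodMk_left ω')).stronglyMeasurable
  dependsOn p k ω ω₂ h := by
    simp only [doubleTerm, doubleDelta, delta₁, delta_eq_indicator, dependsOn_mdiff b₁ p h,
      dependsOn_gridCube (p, k) h]
  norm_weighted_sum_le ω p ε hε :=
    hf.norm_sum_doubleTerm_left_le hb₁ hb₂ ω ω' p J (posSet n R p) hε
  summable := summable_scaleBound hn hb₁ hf.radius_nonneg β₂ κ₂ M J.1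
  hasSum ω := (hf.hasSum_doubleTerm hn hb₁ hb₂ ω ω' J).2

lemma stronglyMeasurable_of_hasSum {Ω ι V : Type*} [MeasurableSpace Ω] [Countable ι]
    [NormedAddCommGroup V] {F : ι → Ω → V} {G : Ω → V} (hF : ∀ i, StronglyMeasurable (F i))
    (h : ∀ w, HasSum (fun i => F i w) (G w)) : StronglyMeasurable G :=
  stronglyMeasurable_of_tendsto (ι := Finset ι) Filter.atTop (f := fun s w => ∑ i ∈ s, F i w)
    (fun s => Finset.stronglyMeasurable_fun_sum s fun i _ => hF i) (tendsto_pi_nhds.2 h)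

lemma IsTame₂.norm_sum_singleTerm_le (hf : IsTame₂ M R f) (hn : 0 < n)
    (hb₁ : IsAccretive b₁ β₁ κ₁) (hb₂ : IsAccretive b₂ β₂ κ₂) (ω' : GridParam m) (q : ℤ)
    (L : Finset (Fin m → ℤ)) {ε : (Fin m → ℤ) → ℂ} (hε : ∀ l, ‖ε l‖ ≤ 1) :
    ‖∑ l ∈ L, ε l • singleTerm b₁ b₂ f ω' (q, l)‖ ≤
      ∑' p, scaleBound n m β₁ κ₁ β₂ κ₂ M R p q := by
  have h_hasSum : HasSum
      (fun p => ∑ l ∈ L, ε l • ∑ k ∈ posSet n R p, doubleTerm b₁ b₂ f 0 ω' (p, k) (q, l))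
      (∑ l ∈ L, ε l • singleTerm b₁ b₂ f ω' (q, l)) :=
    hasSum_sum fun l _ => (hf.hasSum_doubleTerm hn hb₁ hb₂ 0 ω' (q, l)).2.const_smul (ε l)
  refine h_hasSum.norm_le_of_bounded
    (summable_scaleBound hn hb₁ hf.radius_nonneg β₂ κ₂ M q).hasSum fun p => ?_
  have h := hf.norm_sum_doubleTerm_le hb₁ hb₂ 0 ω' p q (posSet n R p ×ˢ L) (c := fun i => ε i.2)
    fun i => hε i.2
  rw [Finset.sum_product_right] at h
  simpa only [Finset.smul_sum] using h

lemma IsTame₂.hasSum_singleTerm (hf : IsTame₂ M R f) (hn : 0 < n) (hm : 0 < m)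
    (hb₁ : IsAccretive b₁ β₁ κ₁) (hb₂ : IsAccretive b₂ β₂ κ₂) (ω' : GridParam m) :
    MemLp (fun z => tensor b₁ b₂ z * f z) 2 volume ∧
      HasSum (fun q => ∑ l ∈ posSet m R q, singleTerm b₁ b₂ f ω' (q, l))
        (toL2 fun z => tensor b₁ b₂ z * f z) := by
  refine hasSum_toL2 (u := fun q l z => tensor b₁ b₂ z * delta₂ b₂ ω' (q, l) f z)
    (fun q l => (hf.hasSum_doubleTerm hn hb₁ hb₂ 0 ω' (q, l)).1) ?_ fun z => ?_
  · refine (summable_tsum_scaleBound (n := n) hm hb₂ hf.radius_nonneg β₁ κ₁ M).of_norm_bounded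
      fun q => ?_
    simpa only [one_smul, singleTerm] using
      hf.norm_sum_singleTerm_le hn hb₁ hb₂ ω' q (posSet m R q) (ε := fun _ => 1) (by simp)
  · simp only [← Finset.mul_sum, delta₂, sum_delta (hf.right z.1).eq_zero]
    exact (tendsto_sum_mdiff hm hb₂ (hf.right z.1) ω' z.2).const_mul (tensor b₁ b₂ z)

lemma IsTame₂.isGridDecomp_singleTerm (hf : IsTame₂ M R f) (hn : 0 < n) (hm : 0 < m)
    (hb₁ : IsAccretive b₁ β₁ κ₁) (hb₂ : IsAccretive b₂ β₂ κ₂) :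
    IsGridDecomp (posSet m R) (fun q => ∑' p, scaleBound n m β₁ κ₁ β₂ κ₂ M R p q)
      (fun ω' q l => singleTerm b₁ b₂ f ω' (q, l)) (toL2 fun z => tensor b₁ b₂ z * f z) where
  stronglyMeasurable q l := stronglyMeasurable_of_hasSum
    (fun p => Finset.stronglyMeasurable_fun_sum _ fun k _ =>
      ((hf.continuous_doubleTerm hb₁ hb₂ (p, k) (q, l)).comp
        (Continuous.prodMk_right 0)).stronglyMeasurable)
    fun ω' => (hf.hasSum_doubleTerm hn hb₁ hb₂ 0 ω' (q, l)).2
  dependsOn q l ω' ω₂ h := by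
    simp only [singleTerm, delta₂, delta_eq_indicator, dependsOn_mdiff b₂ q h,
      dependsOn_gridCube (q, l) h]
  norm_weighted_sum_le ω' q ε hε :=
    hf.norm_sum_singleTerm_le hn hb₁ hb₂ ω' q (posSet m R q) hε
  summable := summable_tsum_scaleBound hm hb₂ hf.radius_nonneg β₁ κ₁ M
  hasSum ω' := (hf.hasSum_singleTerm hn hm hb₁ hb₂ ω').2

/-! ### The bilinear form -/

/-- The bilinear form `(u, v) ↦ ∫ (T u) v` on `L²`. -/
def pairing (T : L2 n m →L[ℂ] L2 n m) : L2 n m →L[ℂ] L2 n m →L[ℂ] ℂ :=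
  ((ContinuousLinearMap.mul ℂ ℂ).lpPairing volume 2 2).comp T

lemma form_eq_pairing (T : L2 n m →L[ℂ] L2 n m) (b F : E n × E m → ℂ) {b' G : E n × E m → ℂ}
    (hG : MemLp (fun z => b' z * G z) 2 volume) :
    form T b b' F G = pairing T (toL2 fun z => b z * F z) (toL2 fun z => b' z * G z) := by
  rw [pairing, ContinuousLinearMap.comp_apply, ContinuousLinearMap.lpPairing_eq_integral]
  refine integral_congr_ae ?_
  filter_upwards [coeFn_toL2 hG] with z hz
  rw [hz, ContinuousLinearMap.mul_apply']
  ring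

end Decompositions

section Averaging

variable {n m : ℕ} {b₁ b₁' : E n → ℂ} {b₂ b₂' : E m → ℂ} {f g : E n × E m → ℂ}
  {β₁ κ₁ β₂ κ₂ β₁' κ₁' β₂' κ₂' M R M' R' : ℝ}

/-! ### The sum over the cubes of four scales -/

/-- The positions of the cubes of the scales `P` that can contribute to the sum, for functions `f`
and `g` supported in the balls of radii `R` and `R'`. -/
def positionSet (n m : ℕ) (R R' : ℝ) (P : Scales) : Finset (Positions n m) :=
  posSet n R P.1 ×ˢ posSet n R' P.2.1 ×ˢ posSet m R P.2.2.1 ×ˢ posSet m R' P.2.2.2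

variable (δ : ℝ) (r : ℕ) (T : L2 n m →L[ℂ] L2 n m)

lemma summand_eq (hg : IsTame₂ M' R' g) (hb₁' : IsAccretive b₁' β₁' κ₁')
    (hb₂' : IsAccretive b₂' β₂' κ₂') (ω : GridParam n) (ω' : GridParam m) (P : Scales)
    (Q : Positions n m) :
    summand δ r T b₁ b₁' b₂ b₂' f g ω ω' P Q =
      chiGood δ r ω (small (P.1, Q.1) (P.2.1, Q.2.1)) *
        chiGood δ r ω' (small (P.2.2.1, Q.2.2.1) (P.2.2.2, Q.2.2.2)) *
        pairing T (doubleTerm b₁ b₂ f ω ω' (P.1, Q.1) (P.2.2.1, Q.2.2.1))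
          (doubleTerm b₁' b₂' g ω ω' (P.2.1, Q.2.1) (P.2.2.2, Q.2.2.2)) := by
  rw [summand, form_eq_pairing T _ _
    (memLp_tensor_mul hb₁' hb₂' (hg.memLp_doubleDelta hb₁' hb₂' ω ω' _ _))]
  rfl

lemma support_summand_subset (hf : IsTame₂ M R f) (hg : IsTame₂ M' R' g)
    (hb₂ : IsAccretive b₂ β₂ κ₂) (hb₁' : IsAccretive b₁' β₁' κ₁')
    (hb₂' : IsAccretive b₂' β₂' κ₂') (ω : GridParam n) (ω' : GridParam m) (P : Scales) :
    Function.support (summand δ r T b₁ b₁' b₂ b₂' f g ω ω' P) ⊆ positionSet n m R R' P := by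
  intro Q hQ
  rw [Function.mem_support, summand_eq δ r T hg hb₁' hb₂'] at hQ
  have h_pairing := right_ne_zero_of_mul hQ
  have h_left : ¬ (Q.1 ∉ posSet n R P.1 ∨ Q.2.2.1 ∉ posSet m R P.2.2.1) := fun h =>
    h_pairing (by
      rw [hf.doubleTerm_eq_zero (I := (P.1, Q.1)) (J := (P.2.2.1, Q.2.2.1)) hb₂ h,
        map_zero, _root_.zero_apply])
  have h_right : ¬ (Q.2.1 ∉ posSet n R' P.2.1 ∨ Q.2.2.2 ∉ posSet m R' P.2.2.2) := fun h =>
    h_pairing (by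
      rw [hg.doubleTerm_eq_zero (I := (P.2.1, Q.2.1)) (J := (P.2.2.2, Q.2.2.2)) hb₂' h,
        map_zero])
  simp only [positionSet, Finset.coe_product, Set.mem_prod, Finset.mem_coe]
  tauto

lemma scaleSum_eq (hf : IsTame₂ M R f) (hg : IsTame₂ M' R' g) (hb₂ : IsAccretive b₂ β₂ κ₂)
    (hb₁' : IsAccretive b₁' β₁' κ₁') (hb₂' : IsAccretive b₂' β₂' κ₂') (ω : GridParam n)
    (ω' : GridParam m) (P : Scales) :
    scaleSum δ r T b₁ b₁' b₂ b₂' f g ω ω' P =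
      ∑ k₁ ∈ posSet n R P.1, ∑ k₂ ∈ posSet n R' P.2.1,
        ∑ l₁ ∈ posSet m R P.2.2.1, ∑ l₂ ∈ posSet m R' P.2.2.2,
        chiGood δ r ω (small (P.1, k₁) (P.2.1, k₂)) *
        chiGood δ r ω' (small (P.2.2.1, l₁) (P.2.2.2, l₂)) *
        pairing T (doubleTerm b₁ b₂ f ω ω' (P.1, k₁) (P.2.2.1, l₁))
          (doubleTerm b₁' b₂' g ω ω' (P.2.1, k₂) (P.2.2.2, l₂)) := by
  rw [scaleSum, tsum_eq_sum' (support_summand_subset δ r T hf hg hb₂ hb₁' hb₂' ω ω' P)]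
  simp only [positionSet, Finset.sum_product, summand_eq δ r T hg hb₁' hb₂']

lemma sum_comm_four {ι ι' V : Type*} [AddCommMonoid V] (A B : Finset ι) (C D : Finset ι')
    (F : ι → ι → ι' → ι' → V) :
    ∑ a ∈ A, ∑ b ∈ B, ∑ c ∈ C, ∑ d ∈ D, F a b c d =
      ∑ c ∈ C, ∑ d ∈ D, ∑ a ∈ A, ∑ b ∈ B, F a b c d := by
  calc _ = ∑ x ∈ A ×ˢ B, ∑ y ∈ C ×ˢ D, F x.1 x.2 y.1 y.2 := by simp only [Finset.sum_product]
    _ = ∑ y ∈ C ×ˢ D, ∑ x ∈ A ×ˢ B, F x.1 x.2 y.1 y.2 := Finset.sum_comm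
    _ = _ := by simp only [Finset.sum_product]

lemma scaleSum_eq_sum_goodPairSum (hf : IsTame₂ M R f) (hg : IsTame₂ M' R' g)
    (hb₂ : IsAccretive b₂ β₂ κ₂) (hb₁' : IsAccretive b₁' β₁' κ₁')
    (hb₂' : IsAccretive b₂' β₂' κ₂') (ω : GridParam n) (ω' : GridParam m) (p q : ℤ × ℤ) :
    scaleSum δ r T b₁ b₁' b₂ b₂' f g ω ω' (p.1, p.2, q.1, q.2) =
      ∑ l₁ ∈ posSet m R q.1, ∑ l₂ ∈ posSet m R' q.2,
        chiGood δ r ω' (small (q.1, l₁) (q.2, l₂)) *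
        goodPairSum δ r (pairing T) (posSet n R) (posSet n R')
          (fun ω p k => doubleTerm b₁ b₂ f ω ω' (p, k) (q.1, l₁))
          (fun ω p k => doubleTerm b₁' b₂' g ω ω' (p, k) (q.2, l₂)) ω p := by
  rw [scaleSum_eq δ r T hf hg hb₂ hb₁' hb₂', sum_comm_four]
  simp only [goodPairSum, Finset.mul_sum]
  refine Finset.sum_congr rfl fun _ _ => Finset.sum_congr rfl fun _ _ =>
    Finset.sum_congr rfl fun _ _ => Finset.sum_congr rfl fun _ _ => ?_
  ring

lemma scaleSum_eq_pairing (hf : IsTame₂ M R f) (hg : IsTame₂ M' R' g)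
    (hb₂ : IsAccretive b₂ β₂ κ₂) (hb₁' : IsAccretive b₁' β₁' κ₁')
    (hb₂' : IsAccretive b₂' β₂' κ₂') (ω : GridParam n) (ω' : GridParam m) (P : Scales) :
    scaleSum δ r T b₁ b₁' b₂ b₂' f g ω ω' P = pairing T
      (∑ i ∈ posSet n R P.1 ×ˢ posSet m R P.2.2.1,
        (weightLeft δ r ω P.1 P.2.1 i.1 * weightLeft δ r ω' P.2.2.1 P.2.2.2 i.2) •
          doubleTerm b₁ b₂ f ω ω' (P.1, i.1) (P.2.2.1, i.2))
      (∑ i ∈ posSet n R' P.2.1 ×ˢ posSet m R' P.2.2.2,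
        (weightRight δ r ω P.1 P.2.1 i.1 * weightRight δ r ω' P.2.2.1 P.2.2.2 i.2) •
          doubleTerm b₁' b₂' g ω ω' (P.2.1, i.1) (P.2.2.2, i.2)) := by
  rw [bilin_weighted_sum, scaleSum_eq δ r T hf hg hb₂ hb₁' hb₂']
  simp only [Finset.sum_product, chiGood_small]
  refine Finset.sum_congr rfl fun k₁ _ => ?_
  rw [Finset.sum_comm]
  refine Finset.sum_congr rfl fun l₁ _ => Finset.sum_congr rfl fun k₂ _ =>
    Finset.sum_congr rfl fun l₂ _ => ?_
  ring

lemma norm_scaleSum_le (hf : IsTame₂ M R f) (hg : IsTame₂ M' R' g)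
    (hb₁ : IsAccretive b₁ β₁ κ₁) (hb₂ : IsAccretive b₂ β₂ κ₂) (hb₁' : IsAccretive b₁' β₁' κ₁')
    (hb₂' : IsAccretive b₂' β₂' κ₂') (ω : GridParam n) (ω' : GridParam m) (P : Scales) :
    ‖scaleSum δ r T b₁ b₁' b₂ b₂' f g ω ω' P‖ ≤ ‖pairing T‖ *
      (scaleBound n m β₁ κ₁ β₂ κ₂ M R P.1 P.2.2.1 *
        scaleBound n m β₁' κ₁' β₂' κ₂' M' R' P.2.1 P.2.2.2) := by
  rw [scaleSum_eq_pairing δ r T hf hg hb₂ hb₁' hb₂']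
  refine norm_bilin_le _ (hf.norm_sum_doubleTerm_le hb₁ hb₂ ω ω' _ _ _ fun i => ?_)
    (hg.norm_sum_doubleTerm_le hb₁' hb₂' ω ω' _ _ _ fun i => ?_)
  · rw [norm_mul]
    exact mul_le_one₀ (norm_weightLeft_le ..) (norm_nonneg _) (norm_weightLeft_le ..)
  · rw [norm_mul]
    exact mul_le_one₀ (norm_weightRight_le ..) (norm_nonneg _) (norm_weightRight_le ..)

lemma exists_scaleSum_bound (hn : 0 < n) (hm : 0 < m) (hf : IsTame₂ M R f) (hg : IsTame₂ M' R' g)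
    (hb₁ : IsAccretive b₁ β₁ κ₁) (hb₂ : IsAccretive b₂ β₂ κ₂) (hb₁' : IsAccretive b₁' β₁' κ₁')
    (hb₂' : IsAccretive b₂' β₂' κ₂') :
    ∃ c : Scales → ℝ, Summable c ∧
      ∀ ω ω' P, ‖scaleSum δ r T b₁ b₁' b₂ b₂' f g ω ω' P‖ ≤ c P := by
  have h₁ := summable_profileNorm hn hb₁ hf.radius_nonneg
  have h₂ := summable_profileNorm hm hb₂ hf.radius_nonneg
  have h₁' := summable_profileNorm hn hb₁' hg.radius_nonneg
  have h₂' := summable_profileNorm hm hb₂' hg.radius_nonneg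
  have h0₁' := profileNorm_nonneg n β₁' κ₁' R'
  have h0₂ := profileNorm_nonneg m β₂ κ₂ R
  have h0₂' := profileNorm_nonneg m β₂' κ₂' R'
  have h_prod := h₁.mul_of_nonneg
    (h₁'.mul_of_nonneg (h₂.mul_of_nonneg h₂' h0₂ h0₂') h0₁'
      fun _ => mul_nonneg (h0₂ _) (h0₂' _))
    (profileNorm_nonneg n β₁ κ₁ R)
    fun _ => mul_nonneg (h0₁' _) (mul_nonneg (h0₂ _) (h0₂' _))
  refine ⟨_, h_prod.mul_left (‖pairing T‖ * (β₁ * β₂ * M) * (β₁' * β₂' * M')), fun ω ω' P => ?_⟩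
  refine (norm_scaleSum_le δ r T hf hg hb₁ hb₂ hb₁' hb₂' ω ω' P).trans_eq ?_
  simp only [scaleBound]
  ring

lemma stronglyMeasurable_scaleSum (hf : IsTame₂ M R f) (hg : IsTame₂ M' R' g)
    (hb₁ : IsAccretive b₁ β₁ κ₁) (hb₂ : IsAccretive b₂ β₂ κ₂) (hb₁' : IsAccretive b₁' β₁' κ₁')
    (hb₂' : IsAccretive b₂' β₂' κ₂') (P : Scales) :
    StronglyMeasurable fun w : GridParam n × GridParam m =>
      scaleSum δ r T b₁ b₁' b₂ b₂' f g w.1 w.2 P := by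
  simp only [scaleSum_eq δ r T hf hg hb₂ hb₁' hb₂']
  refine Finset.stronglyMeasurable_fun_sum _ fun k₁ _ =>
    Finset.stronglyMeasurable_fun_sum _ fun k₂ _ => Finset.stronglyMeasurable_fun_sum _ fun l₁ _ =>
    Finset.stronglyMeasurable_fun_sum _ fun l₂ _ => .mul (.mul ?_ ?_) ?_
  · exact ((measurable_chiGood δ r _).comp measurable_fst).stronglyMeasurable
  · exact ((measurable_chiGood δ r _).comp measurable_snd).stronglyMeasurable
  · exact stronglyMeasurable_bilin (pairing T)
      (hf.continuous_doubleTerm hb₁ hb₂ _ _).stronglyMeasurable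
      (hg.continuous_doubleTerm hb₁' hb₂' _ _).stronglyMeasurable

/-! ### Averaging over both families of grids -/

lemma hasSum_goodSum (hn : 0 < n) (hm : 0 < m) (hf : IsTame₂ M R f) (hg : IsTame₂ M' R' g)
    (hb₁ : IsAccretive b₁ β₁ κ₁) (hb₂ : IsAccretive b₂ β₂ κ₂) (hb₁' : IsAccretive b₁' β₁' κ₁')
    (hb₂' : IsAccretive b₂' β₂' κ₂') (ω : GridParam n) (ω' : GridParam m) :
    HasSum (scaleSum δ r T b₁ b₁' b₂ b₂' f g ω ω') (goodSum δ r T b₁ b₁' b₂ b₂' f g ω ω') := by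
  obtain ⟨c, hc, hle⟩ := exists_scaleSum_bound δ r T hn hm hf hg hb₁ hb₂ hb₁' hb₂'
  exact (Summable.of_norm_bounded hc (hle ω ω')).hasSum

lemma integrable_goodSum (hn : 0 < n) (hm : 0 < m) (hf : IsTame₂ M R f) (hg : IsTame₂ M' R' g)
    (hb₁ : IsAccretive b₁ β₁ κ₁) (hb₂ : IsAccretive b₂ β₂ κ₂) (hb₁' : IsAccretive b₁' β₁' κ₁')
    (hb₂' : IsAccretive b₂' β₂' κ₂') :
    Integrable (fun w : GridParam n × GridParam m => goodSum δ r T b₁ b₁' b₂ b₂' f g w.1 w.2)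
      ((gridMeasure n).prod (gridMeasure m)) := by
  have h_hasSum := hasSum_goodSum δ r T hn hm hf hg hb₁ hb₂ hb₁' hb₂'
  obtain ⟨c, hc, hle⟩ := exists_scaleSum_bound δ r T hn hm hf hg hb₁ hb₂ hb₁' hb₂'
  refine Integrable.of_bound (stronglyMeasurable_of_hasSum
    (stronglyMeasurable_scaleSum δ r T hf hg hb₁ hb₂ hb₁' hb₂')
    fun w => h_hasSum w.1 w.2).aestronglyMeasurable (∑' P, c P) ?_
  exact ae_of_all _ fun w => (h_hasSum w.1 w.2).norm_le_of_bounded hc.hasSum (hle w.1 w.2)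

/-- Regrouping of four scales `(p₁, p₂, q₁, q₂)` as the pair of `(q₁, q₂)` and `(p₁, p₂)`. -/
def scalesEquiv : (ℤ × ℤ) × (ℤ × ℤ) ≃ Scales where
  toFun x := (x.2.1, x.2.2, x.1.1, x.1.2)
  invFun P := ((P.2.2.1, P.2.2.2), (P.1, P.2.1))

lemma integral_scaleSum (hn : 0 < n) (hf : IsTame₂ M R f) (hg : IsTame₂ M' R' g)
    (hb₁ : IsAccretive b₁ β₁ κ₁) (hb₂ : IsAccretive b₂ β₂ κ₂) (hb₁' : IsAccretive b₁' β₁' κ₁')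
    (hb₂' : IsAccretive b₂' β₂' κ₂') (ω' : GridParam m) (p q : ℤ × ℤ) :
    ∫ ω, scaleSum δ r T b₁ b₁' b₂ b₂' f g ω ω' (p.1, p.2, q.1, q.2) ∂gridMeasure n =
      ∑ l₁ ∈ posSet m R q.1, ∑ l₂ ∈ posSet m R' q.2,
        chiGood δ r ω' (small (q.1, l₁) (q.2, l₂)) *
        ∫ ω, goodPairSum δ r (pairing T) (posSet n R) (posSet n R')
          (fun ω p k => doubleTerm b₁ b₂ f ω ω' (p, k) (q.1, l₁))
          (fun ω p k => doubleTerm b₁' b₂' g ω ω' (p, k) (q.2, l₂)) ω p ∂gridMeasure n := by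
  have h_integrable (l₁ l₂ : Fin m → ℤ) :
      Integrable (fun ω => chiGood δ r ω' (small (q.1, l₁) (q.2, l₂)) *
        goodPairSum δ r (pairing T) (posSet n R) (posSet n R')
          (fun ω p k => doubleTerm b₁ b₂ f ω ω' (p, k) (q.1, l₁))
          (fun ω p k => doubleTerm b₁' b₂' g ω ω' (p, k) (q.2, l₂)) ω p) (gridMeasure n) := by
    have hu := hf.isGridDecomp_doubleTerm hn hb₁ hb₂ ω' (q.1, l₁)
    have hv := hg.isGridDecomp_doubleTerm hn hb₁' hb₂' ω' (q.2, l₂)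
    exact (Integrable.of_bound
      (stronglyMeasurable_goodPairSum δ r (pairing T) hu hv p).aestronglyMeasurable _
      (ae_of_all _ fun ω => norm_goodPairSum_le δ r (pairing T) hu hv ω p)).const_mul _
  simp only [scaleSum_eq_sum_goodPairSum δ r T hf hg hb₂ hb₁' hb₂']
  rw [integral_finsetSum _ fun l₁ _ => integrable_finsetSum _ fun l₂ _ => h_integrable l₁ l₂]
  simp only [integral_finsetSum _ fun l₂ _ => h_integrable _ l₂, integral_const_mul]

lemma hasSum_integral_scaleSum (hn : 0 < n) (hf : IsTame₂ M R f) (hg : IsTame₂ M' R' g)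
    (hb₁ : IsAccretive b₁ β₁ κ₁) (hb₂ : IsAccretive b₂ β₂ κ₂) (hb₁' : IsAccretive b₁' β₁' κ₁')
    (hb₂' : IsAccretive b₂' β₂' κ₂') (ω' : GridParam m) (q : ℤ × ℤ) :
    HasSum (fun p : ℤ × ℤ =>
        ∫ ω, scaleSum δ r T b₁ b₁' b₂ b₂' f g ω ω' (p.1, p.2, q.1, q.2) ∂gridMeasure n)
      (piGood n δ r * goodPairSum δ r (pairing T) (posSet m R) (posSet m R')
        (fun ω' q l => singleTerm b₁ b₂ f ω' (q, l))
        (fun ω' q l => singleTerm b₁' b₂' g ω' (q, l)) ω' q) := by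
  have h_sum := hasSum_sum fun l₁ (_ : l₁ ∈ posSet m R q.1) =>
    hasSum_sum fun l₂ (_ : l₂ ∈ posSet m R' q.2) =>
      (hasSum_integral_goodPairSum δ r (pairing T)
        (hf.isGridDecomp_doubleTerm hn hb₁ hb₂ ω' (q.1, l₁))
        (hg.isGridDecomp_doubleTerm hn hb₁' hb₂' ω' (q.2, l₂))).mul_left
          (chiGood δ r ω' (small (q.1, l₁) (q.2, l₂)))
  have h_value : ∑ l₁ ∈ posSet m R q.1, ∑ l₂ ∈ posSet m R' q.2,
      chiGood δ r ω' (small (q.1, l₁) (q.2, l₂)) * (piGood n δ r *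
        pairing T (singleTerm b₁ b₂ f ω' (q.1, l₁)) (singleTerm b₁' b₂' g ω' (q.2, l₂))) =
      piGood n δ r * goodPairSum δ r (pairing T) (posSet m R) (posSet m R')
        (fun ω' q l => singleTerm b₁ b₂ f ω' (q, l))
        (fun ω' q l => singleTerm b₁' b₂' g ω' (q, l)) ω' q := by
    simp only [goodPairSum, Finset.mul_sum, mul_left_comm]
  rw [h_value] at h_sum
  exact h_sum.congr_fun fun p => integral_scaleSum δ r T hn hf hg hb₁ hb₂ hb₁' hb₂' ω' p q

lemma integral_goodSum_left (hn : 0 < n) (hm : 0 < m) (hf : IsTame₂ M R f) (hg : IsTame₂ M' R' g)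
    (hb₁ : IsAccretive b₁ β₁ κ₁) (hb₂ : IsAccretive b₂ β₂ κ₂) (hb₁' : IsAccretive b₁' β₁' κ₁')
    (hb₂' : IsAccretive b₂' β₂' κ₂') (ω' : GridParam m) :
    ∫ ω, goodSum δ r T b₁ b₁' b₂ b₂' f g ω ω' ∂gridMeasure n =
      piGood n δ r * ∑' q : ℤ × ℤ, goodPairSum δ r (pairing T) (posSet m R) (posSet m R')
        (fun ω' q l => singleTerm b₁ b₂ f ω' (q, l))
        (fun ω' q l => singleTerm b₁' b₂' g ω' (q, l)) ω' q := by
  obtain ⟨c, hc, hle⟩ := exists_scaleSum_bound δ r T hn hm hf hg hb₁ hb₂ hb₁' hb₂'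
  have h_meas (P : Scales) :
      StronglyMeasurable fun ω => scaleSum δ r T b₁ b₁' b₂ b₂' f g ω ω' P := by
    simpa only [Function.comp_def] using
      (stronglyMeasurable_scaleSum δ r T hf hg hb₁ hb₂ hb₁' hb₂' P).comp_measurable
        (measurable_prodMk_right (y := ω'))
  have h_hasSum := hasSum_integral_of_summable_bound (μ := gridMeasure n) h_meas
    (fun P ω => hle ω ω' P) hc fun ω => hasSum_goodSum δ r T hn hm hf hg hb₁ hb₂ hb₁' hb₂' ω ω'
  have h_fiberwise := (scalesEquiv.hasSum_iff.2 h_hasSum).prod_fiberwise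
    (hasSum_integral_scaleSum δ r T hn hf hg hb₁ hb₂ hb₁' hb₂' ω')
  rw [← tsum_mul_left, h_fiberwise.tsum_eq]

theorem integral_integral_goodSum (hn : 0 < n) (hm : 0 < m) (hf : IsTame₂ M R f)
    (hg : IsTame₂ M' R' g) (hb₁ : IsAccretive b₁ β₁ κ₁) (hb₂ : IsAccretive b₂ β₂ κ₂)
    (hb₁' : IsAccretive b₁' β₁' κ₁') (hb₂' : IsAccretive b₂' β₂' κ₂') :
    ∫ ω, ∫ ω', goodSum δ r T b₁ b₁' b₂ b₂' f g ω ω' ∂gridMeasure m ∂gridMeasure n =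
      piGood n δ r * (piGood m δ r * form T (tensor b₁ b₂) (tensor b₁' b₂') f g) := by
  rw [integral_integral_swap (integrable_goodSum δ r T hn hm hf hg hb₁ hb₂ hb₁' hb₂')]
  simp only [integral_goodSum_left δ r T hn hm hf hg hb₁ hb₂ hb₁' hb₂']
  rw [integral_const_mul, integral_tsum_goodPairSum δ r (pairing T)
    (hf.isGridDecomp_singleTerm hn hm hb₁ hb₂) (hg.isGridDecomp_singleTerm hn hm hb₁' hb₂'),
    form_eq_pairing T _ _ (hg.hasSum_singleTerm hn hm hb₁' hb₂' 0).1]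

end Averaging

end BiParam

end

open BiParam NNReal in
theorem proposition4p1_general {n m : ℕ} (hn : 0 < n) (hm : 0 < m)
    (b₁ b₁' : E n → ℂ) (b₂ b₂' : E m → ℂ)
    (hb₁ : MemLp b₁ ∞ volume) (hb₂ : MemLp b₂ ∞ volume)
    (hb₁' : MemLp b₁' ∞ volume) (hb₂' : MemLp b₂' ∞ volume)
    (hb : IsPseudoAccretive (tensor b₁ b₂)) (hb' : IsPseudoAccretive (tensor b₁' b₂'))
    (T : L2 n m →L[ℂ] L2 n m) (δ : ℝ) (hδ : 0 < δ)
    (f g : E n × E m → ℂ) {Lf Lg : ℝ≥0}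
    (hf : LipschitzWith Lf f) (hfc : HasCompactSupport f)
    (hg : LipschitzWith Lg g) (hgc : HasCompactSupport g) :
    (∀ (r : ℕ) (I : CubeLabel n), goodProb δ r I = piGood n δ r) ∧
    (∀ (r : ℕ) (J : CubeLabel m), goodProb δ r J = piGood m δ r) ∧
    (∃ r₀ : ℕ, ∀ r : ℕ, r₀ ≤ r → 0 < piGood n δ r ∧ 0 < piGood m δ r) ∧
    (∀ (ω : GridParam n) (ω' : GridParam m)
      (I : CubeLabel n) (J : CubeLabel m),
      MemLp (fun y => tensor b₁ b₂ y * doubleDelta b₁ b₂ ω ω' I J f y)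
        2 volume ∧
      MemLp (doubleDelta b₁' b₂' ω ω' I J g) 2 volume) ∧
    (∀ r : ℕ, 0 < piGood n δ r → 0 < piGood m δ r →
      (∀ (ω : GridParam n) (ω' : GridParam m),
        (∀ P : Scales,
          (Function.support (summand δ r T b₁ b₁' b₂ b₂' f g ω ω' P)).Finite) ∧
        Summable (scaleSum δ r T b₁ b₁' b₂ b₂' f g ω ω')) ∧
      Integrable (fun w : GridParam n × GridParam m =>
          goodSum δ r T b₁ b₁' b₂ b₂' f g w.1 w.2)
        ((gridMeasure n).prod (gridMeasure m)) ∧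
      form T (tensor b₁ b₂) (tensor b₁' b₂') f g =
        1 / ((piGood n δ r : ℂ) * (piGood m δ r : ℂ)) *
          ∫ ω, ∫ ω', goodSum δ r T b₁ b₁' b₂ b₂' f g ω ω'
            ∂(gridMeasure m) ∂(gridMeasure n)) := by
  obtain ⟨⟨β₁, κ₁, hc₁⟩, β₂, κ₂, hc₂⟩ := hb.exists_isAccretive hb₁ hb₂
  obtain ⟨⟨β₁', κ₁', hc₁'⟩, β₂', κ₂', hc₂'⟩ := hb'.exists_isAccretive hb₁' hb₂'
  obtain ⟨M, R, hF⟩ := exists_isTame₂ hf hfc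
  obtain ⟨M', R', hG⟩ := exists_isTame₂ hg hgc
  refine ⟨goodProb_eq δ, goodProb_eq δ, ?_, fun ω ω' I J =>
    ⟨memLp_tensor_mul hc₁ hc₂ (hF.memLp_doubleDelta hc₁ hc₂ ω ω' I J),
      hG.memLp_doubleDelta hc₁' hc₂' ω ω' I J⟩, fun r hr hr' => ⟨fun ω ω' => ⟨fun P => ?_,
    (hasSum_goodSum δ r T hn hm hF hG hc₁ hc₂ hc₁' hc₂' ω ω').summable⟩,
    integrable_goodSum δ r T hn hm hF hG hc₁ hc₂ hc₁' hc₂', ?_⟩⟩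
  · obtain ⟨r₁, h₁⟩ := exists_piGood_pos hn hδ
    obtain ⟨r₂, h₂⟩ := exists_piGood_pos hm hδ
    exact ⟨max r₁ r₂, fun r hr => ⟨h₁ r (le_of_max_le_left hr), h₂ r (le_of_max_le_right hr)⟩⟩
  · exact (Finset.finite_toSet _).subset
      (support_summand_subset δ r T hF hG hc₂ hc₁' hc₂' ω ω' P)
  · have h_ne : (piGood n δ r : ℂ) ≠ 0 := by exact_mod_cast hr.ne'
    have h_ne' : (piGood m δ r : ℂ) ≠ 0 := by exact_mod_cast hr'.ne'
    rw [integral_integral_goodSum δ r T hn hm hF hG hc₁ hc₂ hc₁' hc₂']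
    field_simp

theorem proposition4p1 {n m : ℕ} (hn : 0 < n) (hm : 0 < m)
    (b₁ b₁' : BiParam.E n → ℂ) (b₂ b₂' : BiParam.E m → ℂ)
    (hb₁ : MemLp b₁ ∞ volume) (hb₂ : MemLp b₂ ∞ volume)
    (hb₁' : MemLp b₁' ∞ volume) (hb₂' : MemLp b₂' ∞ volume)
    (hb : BiParam.IsPseudoAccretive (BiParam.tensor b₁ b₂))
    (hb' : BiParam.IsPseudoAccretive (BiParam.tensor b₁' b₂'))
    (T : BiParam.L2 n m →L[ℂ] BiParam.L2 n m)
    (δ : ℝ) (hδ : 0 < δ)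
    (f g : BiParam.E n × BiParam.E m → ℂ)
    (hf : ContDiff ℝ ((⊤ : ℕ∞) : WithTop ℕ∞) f) (hfc : HasCompactSupport f)
    (hg : ContDiff ℝ ((⊤ : ℕ∞) : WithTop ℕ∞) g) (hgc : HasCompactSupport g) :
    -- the probability of being good does not depend on the cube, and is positive for large `r`
    (∀ (r : ℕ) (I : BiParam.CubeLabel n), BiParam.goodProb δ r I = BiParam.piGood n δ r) ∧
    (∀ (r : ℕ) (J : BiParam.CubeLabel m), BiParam.goodProb δ r J = BiParam.piGood m δ r) ∧
    (∃ r₀ : ℕ, ∀ r : ℕ, r₀ ≤ r → 0 < BiParam.piGood n δ r ∧ 0 < BiParam.piGood m δ r) ∧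
    -- all the functions that enter the bilinear forms are square integrable
    (∀ (ω : BiParam.GridParam n) (ω' : BiParam.GridParam m)
      (I : BiParam.CubeLabel n) (J : BiParam.CubeLabel m),
      MemLp (fun y => BiParam.tensor b₁ b₂ y * BiParam.doubleDelta b₁ b₂ ω ω' I J f y)
        2 volume ∧
      MemLp (BiParam.doubleDelta b₁' b₂' ω ω' I J g) 2 volume) ∧
    -- the averaging formula
    (∀ r : ℕ, 0 < BiParam.piGood n δ r → 0 < BiParam.piGood m δ r →
      (∀ (ω : BiParam.GridParam n) (ω' : BiParam.GridParam m),
        (∀ P : BiParam.Scales,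
          (Function.support (BiParam.summand δ r T b₁ b₁' b₂ b₂' f g ω ω' P)).Finite) ∧
        Summable (BiParam.scaleSum δ r T b₁ b₁' b₂ b₂' f g ω ω')) ∧
      Integrable (fun w : BiParam.GridParam n × BiParam.GridParam m =>
          BiParam.goodSum δ r T b₁ b₁' b₂ b₂' f g w.1 w.2)
        ((BiParam.gridMeasure n).prod (BiParam.gridMeasure m)) ∧
      BiParam.form T (BiParam.tensor b₁ b₂) (BiParam.tensor b₁' b₂') f g =
        1 / ((BiParam.piGood n δ r : ℂ) * (BiParam.piGood m δ r : ℂ)) *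
          ∫ ω, ∫ ω', BiParam.goodSum δ r T b₁ b₁' b₂ b₂' f g ω ω'
            ∂(BiParam.gridMeasure m) ∂(BiParam.gridMeasure n)) := by
  obtain ⟨_, hf_lip⟩ := ContDiff.lipschitzWith_of_hasCompactSupport hfc hf (by simp)
  obtain ⟨_, hg_lip⟩ := ContDiff.lipschitzWith_of_hasCompactSupport hgc hg (by simp)
  exact proposition4p1_general hn hm b₁ b₁' b₂ b₂' hb₁ hb₂ hb₁' hb₂' hb hb' T δ hδ f g
    hf_lip hfc hg_lip hgc
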